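/- **Setting.** Let $E=(\mathcal C,J)$ be a $\mathcal U$-site: a category $\mathcal C$ with $\mathcal U$-small Hom-sets, with a Grothendieck topology $J$ that has a $\mathcal U$-small family of topological generators. Sheaves have values in $\mathcal U$-small sets or groups. "Stack" means stack over $E$, "morphism of stacks" means cartesian functor over $E$. *Sheaf of crossed groups.* A sheaf of crossed groups $\Phi=(A,\rho,\Pi)$ on $E$ consists of sheaves of groups $A,\Pi$, a homomorphism $\rho:A\to\Pi$ and a left action of $\Pi$ on $A$ by group automorphisms, written $(\alpha,a)\mapsto{}^{\alpha}a$, such that $\rho({}^{\alpha}a)=\alpha\rho(a)\alpha^{-1}$ and ${}^{\rho(a)}b=aba^{-1}$ for all local sections. *Torsors.* For a sheaf of groups $B$ and $S\in\mathcal C$, a $B$-torsor over $S$ is a sheaf $P$ on $\mathcal C/S$ that locally has sections, with a right action of $B|_S$ that is free and transitive on the sections over every object of $\mathcal C/S$ (wherever there are any); morphisms are the equivariant maps. $\mathrm{TORSC}(E;B)$ is the fibred category $S\mapsto\mathrm{Tors}(E/S,B|_S)$ with restriction as inverse image. If $Q$ is a sheaf with a left action of $B$, then $P\wedge^{B}Q$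 is the sheaf on $\mathcal C/S$ associated with the quotient of $P\times Q|_S$ by $(p\cdot b,q)\sim(p,b\cdot q)$. If $Q$ is a sheaf of groups on which $B$ acts by automorphisms, $P\wedge^{B}Q$ is a sheaf of groups, with $[p,q][p,q']=[p,qq']$. For a homomorphism $u:B\to B'$, with $B$ acting on $B'$ by left multiplication through $u$, $P\wedge^{B}B'$ is a $B'$-torsor, and $P\mapsto P\wedge^{B}B'$ is a morphism $\mathrm{TORSC}(E;u):\mathrm{TORSC}(E;B)\to\mathrm{TORSC}(E;B')$. *Gerbes.* A gerbe on $E$ is a stack in groupoids $G$ over $E$ such that every $S\in\mathcal C$ has a covering by objects over which $G$ is non-empty, and any two objects of a fibre $G_S$ are locally isomorphic. For $x\in G_S$, $\mathrm{Aut}(G)(x)=\mathrm{Aut}_S(x)$ is the sheaf of groups of automorphisms of $x$ on $\mathcal C/S$. *$(A,\Pi)$-gerbes.* An $(A,\Pi)$-gerbe structure on a gerbe $G$ is a pair $(\mu,j)$, with $\mu:G\to\mathrm{TORSC}(E;\Pi)$ a morphism of stacks and $j:\mathrm{Aut}(G)\to(-\wedge^{\Pi}A)\circ\mu$ an isomorphism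 of morphisms of stacks (isomorphisms of sheaves of groups $j_x:\mathrm{Aut}_S(x)\to\mu(x)\wedge^{\Pi}A$, natural in $x$ and compatible with inverse images), such that for every $x\in G_S$, every section $a_x$ of $\mu(x)\wedge^{\Pi}A$ over $S$ and every local representative $(\alpha,a)$ of $a_x$, $$\mu\bigl(j_x^{-1}(a_x)\bigr)(\alpha)=\alpha\cdot\rho(a).$$ An $(A,\Pi)$-gerbe is a gerbe with such a structure. A morphism $(G,\mu,j)\to(G',\mu',j')$ of $(A,\Pi)$-gerbes, over the identity of $(A,\Pi)$, is a morphism of stacks $\lambda:G\to G'$ for which there is an isomorphism $i:\mathrm{TORSC}(E;1_\Pi)\circ\mu\cong\mu'\circ\lambda$ such that, for all $x$, $j'_{\lambda(x)}\circ\mathrm{Aut}(\lambda)$ equals $j_x$ followed by the isomorphism $\mu(x)\wedge^{\Pi}A\cong\mu'(\lambda(x))\wedge^{\Pi}A$ induced by $i$. Let $H^2(E,\Phi)$ be the set of classes of $(A,\Pi)$-gerbes for the equivalence relation generated by the existence of such a morphism. *Canonical maps.* For an $A$-torsor $P$ over $S$, let $\mathrm{dui}:\mathrm{Aut}_A(P)\to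 P\wedge^{A}A$ ($A$ acting on itself by inner automorphisms) be the map that sends $\beta$ to the section locally given by $[p,a]$ with $\beta(p)=p\cdot a$, and let $\mathrm{uni}:(P\wedge^{A}\Pi)\wedge^{\Pi}A\to P\wedge^{A}A$ be the isomorphism of sheaves of groups $[[p,\alpha],a]\mapsto[p,{}^{\alpha}a]$. A structure $(\mu,j)$ of $(A,\Pi)$-gerbe on $\mathrm{TORSC}(E;A)$ is called *canonical* if $\mu=\mathrm{TORSC}(E;\rho)$, that is $\mu(P)=P\wedge^{A}\Pi$, and $j_P=\mathrm{uni}^{-1}\circ\mathrm{dui}$ for every $P$. **Theorem.** For every sheaf of crossed groups $\Phi=(A,\rho,\Pi)$ on $E$: 1. $\mathrm{TORSC}(E;A)$ is a gerbe on $E$. 2. There is exactly one canonical structure of $(A,\Pi)$-gerbe on $\mathrm{TORSC}(E;A)$. In other words, $\mu(P)=P\wedge^{A}\Pi$ and $j_P=\mathrm{uni}^{-1}\circ\mathrm{dui}$ do define an isomorphism of morphisms of stacks $j:\mathrm{Aut}(\mathrm{TORSC}(E;A))\to(-\wedge^{\Pi}A)\circ\mu$, and it satisfies the condition $\mu(j_P^{-1}(a_P))(\alpha)=\alpha\cdot\rho(a)$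 above. 3. There is exactly one class in $H^2(E,\Phi)$ that is the class of $\mathrm{TORSC}(E;A)$ with a canonical structure; it is the unit class. -/

import Mathlib

open CategoryTheory Opposite Bicategory

universe w u

namespace CrossedGerbes

/-- The site `(C, J)` is a `w`-site: its hom sets live in `Type w` (this is built into
`Category.{w} C`) and there is a `w`-small family of topological generators, i.e. every object is
covered by the family of all morphisms whose sources belong to the family of generators. -/
class HasSmallGenerators {C : Type u} [Category.{w} C] (J : GrothendieckTopology C) : Prop where
  exists_generators : ∃ (ι : Type w) (X : ι → C), ∀ S : C,
    Sieve.ofArrows (fun f : Σ i, X i ⟶ S => X f.1) (fun f => f.2) ∈ J S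

section Sheafification

variable {C : Type u} [Category.{w} C] (J : GrothendieckTopology C)

instance hasSmallGenerators_of_small {C : Type w} [Category.{w} C] (J : GrothendieckTopology C) :
    HasSmallGenerators.{w} J where
  exists_generators := ⟨C, id, fun S => by
    convert! J.top_mem S
    exact (Sieve.id_mem_iff_eq_top).1 (Sieve.ofArrows_mk _ _ (⟨S, 𝟙 S⟩ : Σ i, id i ⟶ S))⟩

lemma isCoverDense_inducedFunctor {ι : Type w} (X : ι → C)
    (hX : ∀ S, Sieve.ofArrows (fun f : Σ i, X i ⟶ S => X f.1) (fun f => f.2) ∈ J S) :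
    (inducedFunctor X).IsCoverDense J where
  is_cover S := by
    refine J.superset_covering ?_ (hX S)
    rintro Y f ⟨_, g, _, ⟨i⟩, rfl⟩
    exact ⟨⟨i.1, g, i.2, rfl⟩⟩

instance hasSheafify_of_hasSmallGenerators [HasSmallGenerators.{w} J] : HasSheafify J (Type w) := by
  obtain ⟨ι, X, hX⟩ := HasSmallGenerators.exists_generators (J := J)
  have := isCoverDense_inducedFunctor J X hX
  exact Functor.IsDenseSubsite.hasSheafify_of_isEquivalence
    ((inducedFunctor X).restrictedTopology J) J (inducedFunctor X)

instance wEqualsLocallyBijective_of_hasSmallGenerators [HasSmallGenerators.{w} J] :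
    J.WEqualsLocallyBijective (Type w) := by
  obtain ⟨ι, X, hX⟩ := HasSmallGenerators.exists_generators (J := J)
  have := isCoverDense_inducedFunctor J X hX
  exact GrothendieckTopology.WEqualsLocallyBijective.transport J
    ((inducedFunctor X).restrictedTopology J) (inducedFunctor X)
    ((inducedFunctor X).coverPreserving_restrictedTopology J)

instance hasSmallGenerators_over [HasSmallGenerators.{w} J] (S : C) :
    HasSmallGenerators.{w} (J.over S) where
  exists_generators := by
    obtain ⟨ι, X, hX⟩ := HasSmallGenerators.exists_generators (J := J)
    refine ⟨Σ i, X i ⟶ S, fun f => Over.mk f.2, fun T => ?_⟩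
    rw [J.mem_over_iff]
    refine J.superset_covering ?_ (hX T.left)
    rintro Y f ⟨_, g, _, ⟨i⟩, rfl⟩
    rw [Sieve.overEquiv_iff]
    refine ⟨Over.mk (i.2 ≫ T.hom), Over.homMk g (by simp), Over.homMk i.2, ?_, by ext; simp⟩
    exact Presieve.ofArrows.mk
      (⟨⟨i.1, i.2 ≫ T.hom⟩, Over.homMk i.2⟩ :
        Σ j : (Σ i, X i ⟶ S), Over.mk j.2 ⟶ T)

end Sheafification

section Torsors

variable {C : Type u} [Category.{w} C] {J : GrothendieckTopology C}

/-- The group of sections `A(X)` of a sheaf of groups. -/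
abbrev gsec (A : Sheaf J GrpCat.{w}) (X : C) : Type w := A.obj.obj (op X)

/-- The restriction homomorphism `A(X) → A(Y)`. -/
def gres (A : Sheaf J GrpCat.{w}) {X Y : C} (f : Y ⟶ X) : gsec A X →* gsec A Y :=
  (A.obj.map f.op).hom

lemma gres_id (A : Sheaf J GrpCat.{w}) {X : C} (a : gsec A X) : gres A (𝟙 X) a = a := by
  simp [gres]

lemma gres_comp (A : Sheaf J GrpCat.{w}) {X Y Z : C} (f : Y ⟶ X) (g : Z ⟶ Y) (a : gsec A X) :
    gres A (g ≫ f) a = gres A g (gres A f a) := by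
  simp [gres]

/-- The homomorphism `A(X) → B(X)` given by a morphism of sheaves of groups. -/
def ghom {A B : Sheaf J GrpCat.{w}} (u : A ⟶ B) (X : C) : gsec A X →* gsec B X :=
  (u.hom.app (op X)).hom

lemma gres_ghom {A B : Sheaf J GrpCat.{w}} (u : A ⟶ B) {X Y : C} (f : Y ⟶ X) (a : gsec A X) :
    gres B f (ghom u X a) = ghom u Y (gres A f a) :=
  (ConcreteCategory.congr_hom (u.hom.naturality f.op) a).symm

/-- The set of sections of a sheaf of sets. -/
abbrev sec {D : Type*} [Category* D] {K : GrothendieckTopology D} (F : Sheaf K (Type w)) (X : D) :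
    Type w :=
  F.obj.obj (op X)

/-- The restriction map of a sheaf of sets. -/
def res {D : Type*} [Category* D] {K : GrothendieckTopology D} (F : Sheaf K (Type w)) {X Y : D}
    (f : Y ⟶ X) (x : sec F X) : sec F Y :=
  F.obj.map f.op x

section

variable {D : Type*} [Category* D] {K : GrothendieckTopology D} (F : Sheaf K (Type w))

lemma res_id {X : D} (x : sec F X) : res F (𝟙 X) x = x := by
  simp [res]

lemma res_comp {X Y Z : D} (f : Y ⟶ X) (g : Z ⟶ Y) (x : sec F X) :
    res F (g ≫ f) x = res F g (res F f x) := by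
  simp [res]

lemma sec_ext {X : D} {R : Sieve X} (hR : R ∈ K X) {x y : sec F X}
    (h : ∀ ⦃Y : D⦄ (f : Y ⟶ X), R f → res F f x = res F f y) : x = y :=
  (((isSheaf_iff_isSheaf_of_type _ _).1 F.property).isSeparated R hR).ext h

lemma sec_glue {X : D} {R : Sieve X} (hR : R ∈ K X) (x : ∀ ⦃Y : D⦄ (f : Y ⟶ X), R f → sec F Y)
    (hx : ∀ ⦃Y Z : D⦄ (f : Y ⟶ X) (hf : R f) (g : Z ⟶ Y),
      res F g (x f hf) = x (g ≫ f) (R.downward_closed hf g)) :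
    ∃ y : sec F X, ∀ ⦃Y : D⦄ (f : Y ⟶ X) (hf : R f), res F f y = x f hf := by
  obtain ⟨y, hy, -⟩ := ((isSheaf_iff_isSheaf_of_type _ _).1 F.property) R hR x
    ((Presieve.compatible_iff_sieveCompatible x).2 fun Y Z f g hf => (hx f hf g).symm)
  exact ⟨y, hy⟩

end

/-- Sections over `x : U ⟶ S` and over `y : U ⟶ S` are identified if `x = y`. -/
def ocast {S : C} (F : Sheaf (J.over S) (Type w)) {U : C} {x y : U ⟶ S} (h : x = y)
    (p : sec F (Over.mk x)) : sec F (Over.mk y) :=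
  res F (Over.homMk (𝟙 U) (by simp [h]) : Over.mk y ⟶ Over.mk x) p

section

variable {S : C} (F : Sheaf (J.over S) (Type w))

@[simp]
lemma ocast_rfl {U : C} {x : U ⟶ S} (p : sec F (Over.mk x)) : ocast F rfl p = p := by
  have : (Over.homMk (𝟙 U) (by simp) : Over.mk x ⟶ Over.mk x) = 𝟙 _ := by ext; simp
  rw [ocast, this, res_id]

@[simp]
lemma ocast_ocast {U : C} {x y z : U ⟶ S} (h : x = y) (h' : y = z) (p : sec F (Over.mk x)) :
    ocast F h' (ocast F h p) = ocast F (h.trans h') p := by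
  subst h h'
  simp

lemma ocast_ocast4 {U : C} {u v x y z : U ⟶ S} (h₁ : u = v) (h₂ : v = x) (h₃ : x = y) (h₄ : y = z)
    (p : sec F (Over.mk u)) : ocast F h₄ (ocast F h₃ (ocast F h₂ (ocast F h₁ p))) =
      ocast F (h₁.trans (h₂.trans (h₃.trans h₄))) p := by
  subst h₁ h₂ h₃ h₄
  simp

lemma res_ocast {U V : C} {x y : U ⟶ S} (h : x = y) {z : V ⟶ S} (f : V ⟶ U) (w : f ≫ y = z)
    (p : sec F (Over.mk x)) :
    res F (Over.homMk f w : Over.mk z ⟶ Over.mk y) (ocast F h p) =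
      res F (Over.homMk f (by simp [h, w]) : Over.mk z ⟶ Over.mk x) p := by
  subst h
  simp

lemma ocast_res {U V : C} {x : U ⟶ S} {y z : V ⟶ S} (h : y = z) (f : V ⟶ U) (w : f ≫ x = y)
    (p : sec F (Over.mk x)) :
    ocast F h (res F (Over.homMk f w : Over.mk y ⟶ Over.mk x) p) =
      res F (Over.homMk f (by simp [w, h]) : Over.mk z ⟶ Over.mk x) p := by
  subst h
  simp

end

/-- A torsor under `A` over the object `S`, i.e. a torsor under the restriction of `A` to the site
`C/S`: a sheaf of sets on `C/S` with a right action of `A`, which is free and transitive, and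
which locally has a section. -/
structure Torsor (A : Sheaf J GrpCat.{w}) (S : C) where
  sheaf : Sheaf (J.over S) (Type w)
  act : ∀ {X : Over S}, sec sheaf X → gsec A X.left → sec sheaf X
  act_one : ∀ {X : Over S} (p : sec sheaf X), act p 1 = p
  act_mul : ∀ {X : Over S} (p : sec sheaf X) (a b : gsec A X.left),
    act p (a * b) = act (act p a) b
  res_act : ∀ {X Y : Over S} (f : Y ⟶ X) (p : sec sheaf X) (a : gsec A X.left),
    res sheaf f (act p a) = act (res sheaf f p) (gres A f.left a)
  existsUnique_act : ∀ {X : Over S} (p q : sec sheaf X), ∃! a : gsec A X.left, act p a = q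
  locally_nonempty : ∀ X : Over S, ∃ R ∈ J.over S X, ∀ ⦃Y : Over S⦄ (f : Y ⟶ X), R f →
    Nonempty (sec sheaf Y)

namespace Torsor

variable {A : Sheaf J GrpCat.{w}} {S : C}

/-- A morphism of `A`-torsors is an `A`-equivariant morphism of sheaves. -/
@[ext]
structure Hom (P Q : Torsor A S) where
  app : ∀ (X : Over S), sec P.sheaf X → sec Q.sheaf X
  res_app : ∀ {X Y : Over S} (f : Y ⟶ X) (p : sec P.sheaf X),
    res Q.sheaf f (app X p) = app Y (res P.sheaf f p)
  app_act : ∀ {X : Over S} (p : sec P.sheaf X) (a : gsec A X.left),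
    app X (P.act p a) = Q.act (app X p) a

instance : Category (Torsor A S) where
  Hom P Q := Hom P Q
  id P := ⟨fun _ p => p, fun _ _ => rfl, fun _ _ => rfl⟩
  comp m n := ⟨fun X p => n.app X (m.app X p), fun f p => by rw [n.res_app, m.res_app],
    fun p a => by rw [m.app_act, n.app_act]⟩

/-- The map on sections given by a morphism of torsors. -/
def app {P Q : Torsor A S} (m : P ⟶ Q) (X : Over S) (p : sec P.sheaf X) : sec Q.sheaf X :=
  Hom.app m X p

@[ext]
lemma hom_ext {P Q : Torsor A S} {m n : P ⟶ Q}
    (h : ∀ (X : Over S) (p : sec P.sheaf X), app m X p = app n X p) : m = n := by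
  apply Hom.ext
  funext X p
  exact h X p

@[simp]
lemma id_app (P : Torsor A S) (X : Over S) (p : sec P.sheaf X) : app (𝟙 P) X p = p := rfl

@[simp]
lemma comp_app {P Q R : Torsor A S} (m : P ⟶ Q) (n : Q ⟶ R) (X : Over S) (p : sec P.sheaf X) :
    app (m ≫ n) X p = app n X (app m X p) := rfl

lemma app_act {P Q : Torsor A S} (m : P ⟶ Q) {X : Over S} (p : sec P.sheaf X)
    (a : gsec A X.left) : app m X (P.act p a) = Q.act (app m X p) a :=
  Hom.app_act m p a

lemma res_app {P Q : Torsor A S} (m : P ⟶ Q) {X Y : Over S} (f : Y ⟶ X) (p : sec P.sheaf X) :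
    res Q.sheaf f (app m X p) = app m Y (res P.sheaf f p) :=
  Hom.res_app m f p

/-- The restriction of a torsor along a morphism `T ⟶ S`. -/
def restrict (P : Torsor A S) {T : C} (f : T ⟶ S) : Torsor A T where
  sheaf := (J.overMapPullback (Type w) f).obj P.sheaf
  act {X} p a := P.act (X := (Over.map f).obj X) p a
  act_one {X} p := P.act_one (X := (Over.map f).obj X) p
  act_mul {X} p a b := P.act_mul (X := (Over.map f).obj X) p a b
  res_act {X Y} g p a := P.res_act ((Over.map f).map g) p a
  existsUnique_act {X} p q := P.existsUnique_act (X := (Over.map f).obj X) p q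
  locally_nonempty X := by
    obtain ⟨R, hR, h⟩ := P.locally_nonempty ((Over.map f).obj X)
    exact ⟨R.functorPullback (Over.map f), (Over.map f).cover_lift (J.over T) (J.over S) hR,
      fun Y g hg => h ((Over.map f).map g) hg⟩

/-- The restriction functor on torsors. -/
def restrictFunctor (A : Sheaf J GrpCat.{w}) {S T : C} (f : T ⟶ S) : Torsor A S ⥤ Torsor A T where
  obj P := P.restrict f
  map {P Q} m := ⟨fun X p => app m ((Over.map f).obj X) p,
    fun {X Y} g p => res_app m ((Over.map f).map g) p,
    fun {X} p a => app_act m (X := (Over.map f).obj X) p a⟩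

@[simp]
lemma act_ocast (P : Torsor A S) {U : C} {x y : U ⟶ S} (h : x = y) (p : sec P.sheaf (Over.mk x))
    (a : gsec A U) : ocast P.sheaf h (P.act (X := Over.mk x) p a) =
      P.act (X := Over.mk y) (ocast P.sheaf h p) a := by
  subst h
  simp

@[simp]
lemma app_ocast {P Q : Torsor A S} (m : P ⟶ Q) {U : C} {x y : U ⟶ S} (h : x = y)
    (p : sec P.sheaf (Over.mk x)) :
    app m (Over.mk y) (ocast P.sheaf h p) = ocast Q.sheaf h (app m (Over.mk x) p) := by
  subst h
  simp

/-- Restriction along an identity. -/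
def restrictId (A : Sheaf J GrpCat.{w}) (S : C) : restrictFunctor A (𝟙 S) ≅ 𝟭 (Torsor A S) :=
  NatIso.ofComponents (fun P =>
    { hom := ⟨fun X p => ocast (x := X.hom ≫ 𝟙 S) (y := X.hom) P.sheaf (by simp) p,
        fun {X Y} f p => (res_ocast (x := X.hom ≫ 𝟙 S) P.sheaf (by simp) f.left (by simp) p).trans
          (ocast_res (x := X.hom ≫ 𝟙 S) P.sheaf (by simp) f.left (by simp) p).symm,
        fun {X} p a => act_ocast P (x := X.hom ≫ 𝟙 S) (y := X.hom) (by simp) p a⟩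
      inv := ⟨fun X p => ocast (x := X.hom) (y := X.hom ≫ 𝟙 S) P.sheaf (by simp) p,
        fun {X Y} f p => (res_ocast (x := X.hom) (y := X.hom ≫ 𝟙 S) (z := Y.hom ≫ 𝟙 S) P.sheaf
            (by simp) f.left (by simp) p).trans
          (ocast_res (x := X.hom) (y := Y.hom) (z := Y.hom ≫ 𝟙 S) P.sheaf (by simp) f.left (by simp) p).symm,
        fun {X} p a => act_ocast P (x := X.hom) (y := X.hom ≫ 𝟙 S) (by simp) p a⟩
      hom_inv_id := hom_ext fun X p =>
        (ocast_ocast (x := X.hom ≫ 𝟙 S) P.sheaf (by simp) (by simp) p).trans (ocast_rfl _ _)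
      inv_hom_id := hom_ext fun X p =>
        (ocast_ocast (x := X.hom) P.sheaf (by simp) (by simp) p).trans (ocast_rfl _ _) })
    (fun {P Q} m => hom_ext fun X p =>
      (app_ocast m (x := X.hom ≫ 𝟙 S) (y := X.hom) (by simp) p).symm)

/-- Restriction along a composition. -/
def restrictComp (A : Sheaf J GrpCat.{w}) {S T U : C} (f : T ⟶ S) (g : U ⟶ T) :
    restrictFunctor A (g ≫ f) ≅ restrictFunctor A f ⋙ restrictFunctor A g :=
  NatIso.ofComponents (fun P =>
    { hom := ⟨fun X p => ocast (x := X.hom ≫ g ≫ f) (y := (X.hom ≫ g) ≫ f) P.sheaf (by simp) p,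
        fun {X Y} h p => (res_ocast (x := X.hom ≫ g ≫ f) (y := (X.hom ≫ g) ≫ f) P.sheaf
            (by simp) h.left (by simp) p).trans
          (ocast_res (x := X.hom ≫ g ≫ f) P.sheaf (by simp) h.left (by simp) p).symm,
        fun {X} p a => act_ocast P (x := X.hom ≫ g ≫ f) (y := (X.hom ≫ g) ≫ f) (by simp) p a⟩
      inv := ⟨fun X p => ocast (x := (X.hom ≫ g) ≫ f) (y := X.hom ≫ g ≫ f) P.sheaf (by simp) p,
        fun {X Y} h p => (res_ocast (x := (X.hom ≫ g) ≫ f) (y := X.hom ≫ g ≫ f) P.sheaf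
            (by simp) h.left (by simp) p).trans
          (ocast_res (x := (X.hom ≫ g) ≫ f) P.sheaf (by simp) h.left (by simp) p).symm,
        fun {X} p a => act_ocast P (x := (X.hom ≫ g) ≫ f) (y := X.hom ≫ g ≫ f) (by simp) p a⟩
      hom_inv_id := hom_ext fun X p =>
        (ocast_ocast (x := X.hom ≫ g ≫ f) P.sheaf (by simp) (by simp) p).trans (ocast_rfl _ _)
      inv_hom_id := hom_ext fun X p =>
        (ocast_ocast (x := (X.hom ≫ g) ≫ f) P.sheaf (by simp) (by simp) p).trans
          (ocast_rfl _ _) })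
    (fun {P Q} m => hom_ext fun X p =>
      (app_ocast m (x := X.hom ≫ g ≫ f) (y := (X.hom ≫ g) ≫ f) (by simp) p).symm)

lemma eqToHom_app_app (A : Sheaf J GrpCat.{w}) {S T : C} {f g : T ⟶ S} (h : f = g)
    (P : Torsor A S) (X : Over T) (p : sec P.sheaf (Over.mk (X.hom ≫ f))) :
    app ((eqToHom (show (restrictFunctor A f).toCatHom = (restrictFunctor A g).toCatHom by
      rw [h])).toNatTrans.app P) X p =
      ocast (x := X.hom ≫ f) (y := X.hom ≫ g) P.sheaf (by rw [h]) p := by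
  subst h
  exact (ocast_rfl _ _).symm

end Torsor

/-- The fibred category of `A`-torsors: its fibre over `S` is the category of torsors under
the restriction of `A` to `C/S`, and its inverse image functors are given by restriction. -/
def torsc (A : Sheaf J GrpCat.{w}) : LocallyDiscrete Cᵒᵖ ⥤ᵖ Cat.{max u w, max u (w + 1)} :=
  LocallyDiscrete.mkPseudofunctor
    (fun S => Cat.of (Torsor A S.unop))
    (fun f => (Torsor.restrictFunctor A f.unop).toCatHom)
    (fun S => Cat.Hom.isoMk (Torsor.restrictId A S.unop))
    (fun f g => Cat.Hom.isoMk (Torsor.restrictComp A f.unop g.unop))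
    (fun f g h => by
      ext P
      refine Torsor.hom_ext fun X p => ?_
      refine Eq.trans ?_ (Torsor.eqToHom_app_app A (by simp) P X p).symm
      exact ocast_ocast4 P.sheaf (u := X.hom ≫ h.unop ≫ g.unop ≫ f.unop)
        (v := (X.hom ≫ h.unop) ≫ g.unop ≫ f.unop) (x := ((X.hom ≫ h.unop) ≫ g.unop) ≫ f.unop)
        (y := (X.hom ≫ h.unop ≫ g.unop) ≫ f.unop) (z := X.hom ≫ (h.unop ≫ g.unop) ≫ f.unop)
        (by simp) (by simp) (by simp) (by simp) p)
    (fun f => by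
      ext P
      refine Torsor.hom_ext fun X p => ?_
      refine Eq.trans ?_ (Torsor.eqToHom_app_app A (by simp) P X p).symm
      exact ocast_ocast P.sheaf (x := X.hom ≫ f.unop ≫ 𝟙 _) (y := (X.hom ≫ f.unop) ≫ 𝟙 _)
        (z := X.hom ≫ f.unop) (by simp) (by simp) p)
    (fun f => by
      ext P
      refine Torsor.hom_ext fun X p => ?_
      refine Eq.trans ?_ (Torsor.eqToHom_app_app A (by simp) P X p).symm
      exact ocast_ocast P.sheaf (x := X.hom ≫ 𝟙 _ ≫ f.unop) (y := (X.hom ≫ 𝟙 _) ≫ f.unop)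
        (z := X.hom ≫ f.unop) (by simp) (by simp) p)

/-- A sheaf of sets with a left action of the sheaf of groups `G`. -/
structure LeftObject (G : Sheaf J GrpCat.{w}) where
  sheaf : Sheaf J (Type w)
  smul : ∀ {X : C}, gsec G X → sec sheaf X → sec sheaf X
  one_smul : ∀ {X : C} (q : sec sheaf X), smul 1 q = q
  mul_smul : ∀ {X : C} (g h : gsec G X) (q : sec sheaf X), smul (g * h) q = smul g (smul h q)
  res_smul : ∀ {X Y : C} (f : Y ⟶ X) (g : gsec G X) (q : sec sheaf X),
    res sheaf f (smul g q) = smul (gres G f g) (res sheaf f q)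

section Contracted

variable {G : Sheaf J GrpCat.{w}} {S : C}

/-- The equivalence relation `(p, q) ∼ (p · g, g⁻¹ • q)` on `P(X) × Q(X)`. -/
def contrSetoid (P : Torsor G S) (Q : LeftObject G) (X : Over S) :
    Setoid (sec P.sheaf X × sec Q.sheaf X.left) where
  r x y := ∃ g : gsec G X.left, y = (P.act x.1 g, Q.smul g⁻¹ x.2)
  iseqv :=
    { refl := fun x => ⟨1, by simp [P.act_one, Q.one_smul]⟩
      symm := by
        rintro x _ ⟨g, rfl⟩
        exact ⟨g⁻¹, by simp [← P.act_mul, ← Q.mul_smul, P.act_one, Q.one_smul]⟩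
      trans := by
        rintro x _ _ ⟨g, rfl⟩ ⟨h, rfl⟩
        exact ⟨g * h, by simp [P.act_mul, Q.mul_smul]⟩ }

/-- The presheaf quotient of `P × Q` by the relation `(p, q) ∼ (p · g, g⁻¹ • q)`. -/
def contrPresheaf (P : Torsor G S) (Q : LeftObject G) : (Over S)ᵒᵖ ⥤ Type w where
  obj X := Quotient (contrSetoid P Q X.unop)
  map {X Y} f := ↾(Quotient.map
    (fun x => (res P.sheaf f.unop x.1, res Q.sheaf f.unop.left x.2)) (by
      rintro x _ ⟨g, rfl⟩
      refine ⟨gres G f.unop.left g, ?_⟩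
      rw [P.res_act, Q.res_smul, map_inv]))
  map_id X := by
    ext x
    induction x using Quotient.inductionOn with
    | h x =>
      refine congrArg (Quotient.mk _) (Prod.ext ?_ ?_)
      · exact res_id P.sheaf x.1
      · exact res_id Q.sheaf x.2
  map_comp f g := by
    ext x
    induction x using Quotient.inductionOn with
    | h x =>
      refine congrArg (Quotient.mk _) (Prod.ext ?_ ?_)
      · exact res_comp P.sheaf _ _ x.1
      · exact res_comp Q.sheaf _ _ x.2

lemma Torsor.eq_one_of_act_eq {X : Over S} (P : Torsor G S) {p : sec P.sheaf X} {g : gsec G X.left} (h : P.act p g = p) :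
    g = 1 :=
  (P.existsUnique_act p p).unique h (P.act_one p)

variable [HasSmallGenerators.{w} J]

/-- The contracted product `P ∧^G Q` of a `G`-torsor `P` over `S` (on which `G` acts on the right)
and of a sheaf `Q` with left action of `G`: the sheaf on `C/S` associated to the presheaf quotient
of `P × Q` by the relation `(p, q) ∼ (p · g, g⁻¹ • q)`. -/
noncomputable def contr (P : Torsor G S) (Q : LeftObject G) : Sheaf (J.over S) (Type w) :=
  (presheafToSheaf (J.over S) (Type w)).obj (contrPresheaf P Q)

namespace contr

variable {P : Torsor G S} {Q : LeftObject G}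

/-- The section of `P ∧^G Q` represented by the pair `(p, q)`. -/
noncomputable def mk {X : Over S} (p : sec P.sheaf X) (q : sec Q.sheaf X.left) : sec (contr P Q) X :=
  (toSheafify (J.over S) (contrPresheaf P Q)).app (op X) (Quotient.mk (contrSetoid P Q X) (p, q))

lemma mk_act {X : Over S} (p : sec P.sheaf X) (g : gsec G X.left) (q : sec Q.sheaf X.left) :
    mk (P.act p g) q = mk (Q := Q) p (Q.smul g q) := by
  refine congrArg ((toSheafify (J.over S) (contrPresheaf P Q)).app (op X))
    (Quotient.sound ⟨g⁻¹, ?_⟩)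
  simp [← P.act_mul, P.act_one]

lemma res_mk {X Y : Over S} (f : Y ⟶ X) (p : sec P.sheaf X) (q : sec Q.sheaf X.left) :
    res (contr P Q) f (mk p q) = mk (res P.sheaf f p) (res Q.sheaf f.left q) :=
  (ConcreteCategory.congr_hom ((toSheafify (J.over S) (contrPresheaf P Q)).naturality f.op)
    (Quotient.mk (contrSetoid P Q X) (p, q))).symm

/-- Local existence of representatives. -/
lemma exists_rep {X : Over S} (x : sec (contr P Q) X) : ∃ R ∈ J.over S X,
    ∀ ⦃Y : Over S⦄ (f : Y ⟶ X), R f → ∃ (p : sec P.sheaf Y) (q : sec Q.sheaf Y.left),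
      res (contr P Q) f x = mk p q := by
  refine ⟨_, Presheaf.imageSieve_mem (J.over S) (toSheafify (J.over S) (contrPresheaf P Q)) x, ?_⟩
  rintro Y f ⟨y, hy⟩
  induction y using Quotient.inductionOn with
  | h y => exact ⟨y.1, y.2, hy.symm⟩

lemma mk_injective {X : Over S} (p : sec P.sheaf X) :
    Function.Injective (mk (Q := Q) p) := by
  intro q q' h
  refine sec_ext (Q.sheaf.over S) (X := X) (Presheaf.equalizerSieve_mem (J.over S)
    (toSheafify (J.over S) (contrPresheaf P Q)) (X := op X) (Quotient.mk (contrSetoid P Q X) (p, q))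
      (Quotient.mk (contrSetoid P Q X) (p, q')) h) fun Y f hf => ?_
  obtain ⟨g, hg⟩ := Quotient.exact hf
  obtain ⟨h1, h2⟩ := Prod.ext_iff.1 hg
  have := P.eq_one_of_act_eq h1.symm
  simp only [this, inv_one, Q.one_smul] at h2
  exact h2.symm

lemma mk_surjective {X : Over S} (p : sec P.sheaf X) :
    Function.Surjective (mk (Q := Q) p) := by
  intro x
  obtain ⟨R, hR, h⟩ := exists_rep x
  have h' : ∀ ⦃Y : Over S⦄ (f : Y ⟶ X), R f → ∃ q : sec Q.sheaf Y.left,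
      res (contr P Q) f x = mk (res P.sheaf f p) q := by
    intro Y f hf
    obtain ⟨p', q', e⟩ := h f hf
    obtain ⟨g, rfl, -⟩ := P.existsUnique_act (res P.sheaf f p) p'
    exact ⟨Q.smul g q', by rw [e, mk_act]⟩
  choose q hq using h'
  obtain ⟨y, hy⟩ := sec_glue (Q.sheaf.over S) hR q (by
      intro Y Z f hf g
      apply mk_injective (P := P) (Q := Q) (X := Z) (res P.sheaf (g ≫ f) p)
      rw [← hq, res_comp, res_comp, hq f hf, res_mk]
      rfl)
  refine ⟨y, sec_ext _ hR fun Y f hf => ?_⟩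
  exact (res_mk f p _).trans ((congrArg _ (hy f hf)).trans (hq f hf).symm)

/-- The coordinate of a section `x` of `P ∧^G Q` with respect to a section `p` of `P`, i.e. the
unique `q` such that `x` is represented by `(p, q)`. -/
noncomputable def coord {X : Over S} (p : sec P.sheaf X) (x : sec (contr P Q) X) :
    sec Q.sheaf X.left :=
  (mk_surjective p x).choose

@[simp]
lemma mk_coord {X : Over S} (p : sec P.sheaf X) (x : sec (contr P Q) X) :
    mk p (coord p x) = x :=
  (mk_surjective p x).choose_spec

@[simp]
lemma coord_mk {X : Over S} (p : sec P.sheaf X) (q : sec Q.sheaf X.left) :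
    coord p (mk (Q := Q) p q) = q :=
  mk_injective p (mk_coord p _)

lemma coord_eq {X : Over S} {p : sec P.sheaf X} {x : sec (contr P Q) X} {q : sec Q.sheaf X.left}
    (h : x = mk p q) : coord p x = q := by
  rw [h, coord_mk]

lemma coord_act {X : Over S} (p : sec P.sheaf X) (g : gsec G X.left) (x : sec (contr P Q) X) :
    coord (P.act p g) x = Q.smul g⁻¹ (coord p x) := by
  apply coord_eq
  rw [mk_act, ← Q.mul_smul, mul_inv_cancel, Q.one_smul, mk_coord]

lemma coord_res {X Y : Over S} (f : Y ⟶ X) (p : sec P.sheaf X) (x : sec (contr P Q) X) :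
    coord (res P.sheaf f p) (res (contr P Q) f x) = res Q.sheaf f.left (coord p x) := by
  apply coord_eq
  rw [← res_mk, mk_coord]

/-- Two sections of `P ∧^G Q` are equal if they have the same coordinates with respect to all
local sections of `P`. -/
lemma ext_coord {X : Over S} {x y : sec (contr P Q) X}
    (h : ∀ ⦃Y : Over S⦄ (f : Y ⟶ X) (p : sec P.sheaf Y),
      coord p (res (contr P Q) f x) = coord p (res (contr P Q) f y)) : x = y := by
  obtain ⟨R, hR, hP⟩ := P.locally_nonempty X
  refine sec_ext _ hR fun Y f hf => ?_
  obtain ⟨p⟩ := hP f hf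
  rw [← mk_coord p (res _ f x), h, mk_coord]

lemma existsUnique_of_map {X : Over S}
    (s : ∀ ⦃Y : Over S⦄, (Y ⟶ X) → sec P.sheaf Y → sec Q.sheaf Y.left)
    (hs : ∀ ⦃Y Z : Over S⦄ (f : Y ⟶ X) (g : Z ⟶ Y) (p : sec P.sheaf Y),
      s (g ≫ f) (res P.sheaf g p) = res Q.sheaf g.left (s f p))
    (hs' : ∀ ⦃Y : Over S⦄ (f : Y ⟶ X) (p : sec P.sheaf Y) (g : gsec G Y.left),
      s f (P.act p g) = Q.smul g⁻¹ (s f p)) :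
    ∃! x : sec (contr P Q) X, ∀ ⦃Y : Over S⦄ (f : Y ⟶ X) (p : sec P.sheaf Y),
      coord p (res (contr P Q) f x) = s f p := by
  have key : ∀ ⦃Y : Over S⦄ (f : Y ⟶ X) (p p' : sec P.sheaf Y),
      mk (Q := Q) p (s f p) = mk p' (s f p') := by
    intro Y f p p'
    obtain ⟨g, rfl, -⟩ := P.existsUnique_act p p'
    rw [hs', mk_act, ← Q.mul_smul, mul_inv_cancel, Q.one_smul]
  refine existsUnique_of_exists_of_unique ?_ fun x y hx hy => ext_coord fun Y f p => by
    rw [hx, hy]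
  obtain ⟨R, hR, hP⟩ := P.locally_nonempty X
  obtain ⟨x, hx⟩ := sec_glue (contr P Q) hR
    (fun Y f hf => mk (hP f hf).some (s f (hP f hf).some)) (by
      intro Y Z f hf g
      rw [res_mk, ← hs]
      exact key _ _ _)
  refine ⟨x, fun Y f p => mk_injective p ?_⟩
  rw [mk_coord]
  have hR' := (J.over S).pullback_stable f hR
  refine sec_ext _ hR' fun Z g hg => ?_
  rw [← res_comp, hx _ hg, res_mk, ← hs]
  exact key _ _ _

/-- The section of `P ∧^G Q` over `X` whose coordinate with respect to a section `p` of `P` over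
`f : Y ⟶ X` is `s f p`. -/
noncomputable def ofMap {X : Over S}
    (s : ∀ ⦃Y : Over S⦄, (Y ⟶ X) → sec P.sheaf Y → sec Q.sheaf Y.left)
    (hs : ∀ ⦃Y Z : Over S⦄ (f : Y ⟶ X) (g : Z ⟶ Y) (p : sec P.sheaf Y),
      s (g ≫ f) (res P.sheaf g p) = res Q.sheaf g.left (s f p))
    (hs' : ∀ ⦃Y : Over S⦄ (f : Y ⟶ X) (p : sec P.sheaf Y) (g : gsec G Y.left),
      s f (P.act p g) = Q.smul g⁻¹ (s f p)) : sec (contr P Q) X :=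
  (existsUnique_of_map s hs hs').choose

lemma coord_res_ofMap {X : Over S}
    (s : ∀ ⦃Y : Over S⦄, (Y ⟶ X) → sec P.sheaf Y → sec Q.sheaf Y.left)
    (hs : ∀ ⦃Y Z : Over S⦄ (f : Y ⟶ X) (g : Z ⟶ Y) (p : sec P.sheaf Y),
      s (g ≫ f) (res P.sheaf g p) = res Q.sheaf g.left (s f p))
    (hs' : ∀ ⦃Y : Over S⦄ (f : Y ⟶ X) (p : sec P.sheaf Y) (g : gsec G Y.left),
      s f (P.act p g) = Q.smul g⁻¹ (s f p)) ⦃Y : Over S⦄ (f : Y ⟶ X) (p : sec P.sheaf Y) :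
    coord p (res (contr P Q) f (ofMap s hs hs')) = s f p :=
  (existsUnique_of_map s hs hs').choose_spec.1 f p

/-- The morphism of sheaves `P ∧^G Q ⟶ F` induced by a natural family of maps
`s : P(X) × Q(X) → F(X)` such that `s (p · g, q) = s (p, g • q)`. -/
noncomputable def lift {F : Sheaf (J.over S) (Type w)}
    (s : ∀ X : Over S, sec P.sheaf X → sec Q.sheaf X.left → sec F X)
    (hs : ∀ ⦃X Y : Over S⦄ (f : Y ⟶ X) (p : sec P.sheaf X) (q : sec Q.sheaf X.left),
      res F f (s X p q) = s Y (res P.sheaf f p) (res Q.sheaf f.left q))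
    (hs' : ∀ (X : Over S) (p : sec P.sheaf X) (g : gsec G X.left) (q : sec Q.sheaf X.left),
      s X (P.act p g) (Q.smul g⁻¹ q) = s X p q) (X : Over S) (x : sec (contr P Q) X) : sec F X :=
  (sheafifyLift (J.over S) (P := contrPresheaf P Q) (Q := F.obj)
    { app := fun X => ↾(Quotient.lift (fun x => s X.unop x.1 x.2) (by
        rintro x _ ⟨g, rfl⟩
        exact (hs' _ _ _ _).symm))
      naturality := fun X Y f => by
        ext x
        induction x using Quotient.inductionOn with
        | h x => exact (hs f.unop x.1 x.2).symm } F.property).app (op X) x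

section lift

variable {F : Sheaf (J.over S) (Type w)}
    (s : ∀ X : Over S, sec P.sheaf X → sec Q.sheaf X.left → sec F X)
    (hs : ∀ ⦃X Y : Over S⦄ (f : Y ⟶ X) (p : sec P.sheaf X) (q : sec Q.sheaf X.left),
      res F f (s X p q) = s Y (res P.sheaf f p) (res Q.sheaf f.left q))
    (hs' : ∀ (X : Over S) (p : sec P.sheaf X) (g : gsec G X.left) (q : sec Q.sheaf X.left),
      s X (P.act p g) (Q.smul g⁻¹ q) = s X p q)

@[simp]
lemma lift_mk {X : Over S} (p : sec P.sheaf X) (q : sec Q.sheaf X.left) :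
    lift s hs hs' X (mk p q) = s X p q :=
  ConcreteCategory.congr_hom (NatTrans.congr_app
    (toSheafify_sheafifyLift (J.over S) (P := contrPresheaf P Q) (Q := F.obj) _ F.property) (op X))
    (Quotient.mk (contrSetoid P Q X) (p, q))

lemma res_lift {X Y : Over S} (f : Y ⟶ X) (x : sec (contr P Q) X) :
    res F f (lift s hs hs' X x) = lift s hs hs' Y (res (contr P Q) f x) :=
  (ConcreteCategory.congr_hom (NatTrans.naturality (sheafifyLift (J.over S)
    (P := contrPresheaf P Q) (Q := F.obj) _ F.property) f.op) x).symm

end lift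

end contr

end Contracted
namespace Torsor

variable {A : Sheaf J GrpCat.{w}} {S : C}

lemma app_injective {P Q : Torsor A S} (m : P ⟶ Q) (X : Over S) :
    Function.Injective (app m X) := by
  intro p p' h
  obtain ⟨a, rfl, -⟩ := P.existsUnique_act p p'
  rw [app_act] at h
  rw [Q.eq_one_of_act_eq h.symm, P.act_one]

lemma app_surjective {P Q : Torsor A S} (m : P ⟶ Q) (X : Over S) :
    Function.Surjective (app m X) := by
  intro q
  obtain ⟨R, hR, hP⟩ := P.locally_nonempty X
  have h : ∀ ⦃Y : Over S⦄ (f : Y ⟶ X), R f → ∃ p, app m Y p = res Q.sheaf f q := by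
    intro Y f hf
    obtain ⟨p⟩ := hP f hf
    obtain ⟨a, ha, -⟩ := Q.existsUnique_act (app m Y p) (res Q.sheaf f q)
    exact ⟨P.act p a, by rw [app_act, ha]⟩
  choose p hp using h
  obtain ⟨p', hp'⟩ := sec_glue P.sheaf hR p (by
    intro Y Z f hf g
    apply app_injective m
    rw [← res_app, hp, hp, res_comp])
  refine ⟨p', sec_ext _ hR fun Y f hf => ?_⟩
  rw [res_app, hp' f hf, hp]

/-- The unique `a` such that `q = p · a`. -/
noncomputable def diff (P : Torsor A S) {X : Over S} (p q : sec P.sheaf X) : gsec A X.left :=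
  (P.existsUnique_act p q).choose

@[simp]
lemma act_diff (P : Torsor A S) {X : Over S} (p q : sec P.sheaf X) : P.act p (P.diff p q) = q :=
  (P.existsUnique_act p q).choose_spec.1

lemma diff_eq (P : Torsor A S) {X : Over S} {p q : sec P.sheaf X} {a : gsec A X.left}
    (h : P.act p a = q) : P.diff p q = a :=
  (P.existsUnique_act p q).unique (P.act_diff p q) h

/-- Any morphism of torsors is an isomorphism. -/
noncomputable def isoOfHom {P Q : Torsor A S} (m : P ⟶ Q) : P ≅ Q where
  hom := m
  inv := ⟨fun X q => (app_surjective m X q).choose,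
    fun {X Y} f q => app_injective m Y (by
      rw [← res_app, (app_surjective m X q).choose_spec, (app_surjective m Y _).choose_spec]),
    fun {X} q a => app_injective m X (by
      rw [app_act, (app_surjective m X q).choose_spec, (app_surjective m X _).choose_spec])⟩
  hom_inv_id := hom_ext fun X p => app_injective m X (app_surjective m X _).choose_spec
  inv_hom_id := hom_ext fun X p => (app_surjective m X p).choose_spec

end Torsor

/-- A sheaf of groups with a left action of the sheaf of groups `G` by group automorphisms. -/
structure LeftGroup (G : Sheaf J GrpCat.{w}) where
  group : Sheaf J GrpCat.{w}
  smul : ∀ {X : C}, gsec G X → gsec group X → gsec group X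
  one_smul : ∀ {X : C} (q : gsec group X), smul 1 q = q
  mul_smul : ∀ {X : C} (g h : gsec G X) (q : gsec group X), smul (g * h) q = smul g (smul h q)
  smul_mul : ∀ {X : C} (g : gsec G X) (q r : gsec group X), smul g (q * r) = smul g q * smul g r
  res_smul : ∀ {X Y : C} (f : Y ⟶ X) (g : gsec G X) (q : gsec group X),
    gres group f (smul g q) = smul (gres G f g) (gres group f q)

lemma LeftGroup.smul_one {G : Sheaf J GrpCat.{w}} (Q : LeftGroup G) {X : C} (g : gsec G X) :
    Q.smul g (1 : gsec Q.group X) = 1 := by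
  have := Q.smul_mul g (1 : gsec Q.group X) 1
  rw [mul_one] at this
  exact mul_eq_left.1 this.symm

lemma LeftGroup.smul_inv {G : Sheaf J GrpCat.{w}} (Q : LeftGroup G) {X : C} (g : gsec G X)
    (a : gsec Q.group X) : Q.smul g a⁻¹ = (Q.smul g a)⁻¹ :=
  eq_inv_of_mul_eq_one_left (by rw [← Q.smul_mul, inv_mul_cancel, Q.smul_one])

/-- The sheaf of sets underlying a sheaf of groups. -/
noncomputable abbrev usheaf (A : Sheaf J GrpCat.{w}) : Sheaf J (Type w) :=
  (sheafCompose J (forget GrpCat.{w})).obj A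

/-- The sheaf of sets with left action underlying a sheaf of groups with left action. -/
noncomputable def LeftGroup.toLeftObject {G : Sheaf J GrpCat.{w}} (Q : LeftGroup G) :
    LeftObject G where
  sheaf := usheaf Q.group
  smul {X} g q := Q.smul (X := X) g q
  one_smul {X} q := Q.one_smul (X := X) q
  mul_smul {X} g h q := Q.mul_smul (X := X) g h q
  res_smul f g q := Q.res_smul f g q

/-- The sheaf of sets underlying `B` on which `A` acts on the left through `u : A ⟶ B` and
multiplication on the left. -/
noncomputable def leftMul {A B : Sheaf J GrpCat.{w}} (u : A ⟶ B) : LeftObject A where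
  sheaf := usheaf B
  smul {X} a := fun (b : gsec B X) => (ghom u X a * b : gsec B X)
  one_smul {X} := fun (b : gsec B X) => by rw [map_one]; exact one_mul b
  mul_smul {X} g h := fun (b : gsec B X) => by rw [map_mul]; exact mul_assoc _ _ b
  res_smul {X Y} f g := fun (b : gsec B X) =>
    (map_mul (gres B f) _ _).trans (congrArg (· * gres B f b) (gres_ghom u f g))

lemma gsec_ext (B : Sheaf J GrpCat.{w}) {S : C} {X : Over S} {R : Sieve X} (hR : R ∈ J.over S X)
    {b b' : gsec B X.left}
    (h : ∀ ⦃Y : Over S⦄ (f : Y ⟶ X), R f → gres B f.left b = gres B f.left b') : b = b' :=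
  sec_ext ((usheaf B).over S) (X := X) hR h

lemma gsec_glue (B : Sheaf J GrpCat.{w}) {S : C} {X : Over S} {R : Sieve X} (hR : R ∈ J.over S X)
    (b : ∀ ⦃Y : Over S⦄ (f : Y ⟶ X), R f → gsec B Y.left)
    (hb : ∀ ⦃Y Z : Over S⦄ (f : Y ⟶ X) (hf : R f) (g : Z ⟶ Y),
      gres B g.left (b f hf) = b (g ≫ f) (R.downward_closed hf g)) :
    ∃ b' : gsec B X.left, ∀ ⦃Y : Over S⦄ (f : Y ⟶ X) (hf : R f), gres B f.left b' = b f hf :=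
  sec_glue ((usheaf B).over S) (X := X) hR b hb

namespace contr

variable [HasSmallGenerators.{w} J] {A B : Sheaf J GrpCat.{w}} {S : C}

/-- The section of `P ∧^A B` represented by the pair `(p, b)`, for a homomorphism `u : A ⟶ B`. -/
noncomputable def mkM (u : A ⟶ B) {P : Torsor A S} {X : Over S} (p : sec P.sheaf X)
    (b : gsec B X.left) : sec (contr P (leftMul u)) X :=
  mk p b

/-- The coordinate of a section of `P ∧^A B` with respect to a section of `P`. -/
noncomputable def coordM (u : A ⟶ B) {P : Torsor A S} {X : Over S} (p : sec P.sheaf X)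
    (x : sec (contr P (leftMul u)) X) : gsec B X.left :=
  coord p x

section

variable (u : A ⟶ B) {P : Torsor A S}

@[simp]
lemma coordM_mkM {X : Over S} (p : sec P.sheaf X) (b : gsec B X.left) :
    coordM u p (mkM u p b) = b :=
  coord_mk (Q := leftMul u) p b

@[simp]
lemma mkM_coordM {X : Over S} (p : sec P.sheaf X) (x : sec (contr P (leftMul u)) X) :
    mkM u p (coordM u p x) = x :=
  mk_coord (Q := leftMul u) p x

lemma coordM_res {X Y : Over S} (f : Y ⟶ X) (p : sec P.sheaf X)
    (x : sec (contr P (leftMul u)) X) :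
    coordM u (res P.sheaf f p) (res (contr P (leftMul u)) f x) = gres B f.left (coordM u p x) :=
  coord_res (Q := leftMul u) f p x

lemma res_mkM {X Y : Over S} (f : Y ⟶ X) (p : sec P.sheaf X) (b : gsec B X.left) :
    res (contr P (leftMul u)) f (mkM u p b) = mkM u (res P.sheaf f p) (gres B f.left b) :=
  res_mk (Q := leftMul u) f p b

lemma coordM_act {X : Over S} (p : sec P.sheaf X) (g : gsec A X.left)
    (x : sec (contr P (leftMul u)) X) :
    coordM u (P.act p g) x = ghom u X.left g⁻¹ * coordM u p x :=
  coord_act (Q := leftMul u) p g x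

lemma mkM_act {X : Over S} (p : sec P.sheaf X) (g : gsec A X.left) (b : gsec B X.left) :
    mkM u (P.act p g) b = mkM u p (ghom u X.left g * b) :=
  mk_act (Q := leftMul u) p g b

lemma ext_coordM {X : Over S} {x y : sec (contr P (leftMul u)) X}
    (h : ∀ ⦃Y : Over S⦄ (f : Y ⟶ X) (p : sec P.sheaf Y),
      coordM u p (res (contr P (leftMul u)) f x) = coordM u p (res (contr P (leftMul u)) f y)) :
    x = y :=
  ext_coord h

/-- The right action of `B` on the contracted product `P ∧^A B`, given on representatives by
`(p, b) · b' = (p, b b')`. -/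
noncomputable def rightAct {X : Over S}
    (x : sec (contr P (leftMul u)) X) (b : gsec B X.left) : sec (contr P (leftMul u)) X :=
  ofMap (fun Y f p => (coordM u p (res (contr P (leftMul u)) f x) * gres B f.left b : gsec B Y.left))
    (fun Y Z f g p => by
      rw [res_comp, coordM_res, Over.comp_left, gres_comp]
      exact (map_mul (gres B g.left) _ _).symm)
    (fun Y f p g => by
      rw [coordM_act]
      exact mul_assoc (ghom u Y.left g⁻¹) _ _)

lemma coordM_res_rightAct {X Y : Over S} (f : Y ⟶ X) (p : sec P.sheaf Y)
    (x : sec (contr P (leftMul u)) X) (b : gsec B X.left) :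
    coordM u p (res _ f (rightAct u x b)) = coordM u p (res _ f x) * gres B f.left b :=
  coord_res_ofMap (Q := leftMul u) (P := P) (X := X) _ _ _ f p

lemma rightAct_mkM {X : Over S} (p : sec P.sheaf X) (b b' : gsec B X.left) :
    rightAct u (mkM u p b) b' = mkM u p (b * b') := by
  have := coordM_res_rightAct u (𝟙 X) p (mkM u p b) b'
  rw [res_id, res_id, coordM_mkM, Over.id_left, gres_id] at this
  rw [← this, mkM_coordM]

lemma coordM_rightAct {X : Over S} (p : sec P.sheaf X)
    (x : sec (contr P (leftMul u)) X) (b : gsec B X.left) :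
    coordM u p (rightAct u x b) = coordM u p x * b := by
  rw [← mkM_coordM u p x, rightAct_mkM, coordM_mkM, coordM_mkM]

lemma res_rightAct {X Y : Over S} (f : Y ⟶ X)
    (x : sec (contr P (leftMul u)) X) (b : gsec B X.left) :
    res _ f (rightAct u x b) = rightAct u (res _ f x) (gres B f.left b) := by
  refine ext_coordM u fun Z g p => ?_
  rw [← res_comp, coordM_res_rightAct, coordM_res_rightAct, res_comp, Over.comp_left, gres_comp]

end

end contr

namespace Torsor

variable [HasSmallGenerators.{w} J] {A B : Sheaf J GrpCat.{w}} {S : C}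

/-- The `B`-torsor `P ∧^A B` deduced from an `A`-torsor `P` by extension of the structure group
along `u : A ⟶ B`. -/
noncomputable def extend (u : A ⟶ B) (P : Torsor A S) : Torsor B S where
  sheaf := contr P (leftMul u)
  act x b := contr.rightAct u x b
  act_one {X} x := contr.ext_coordM u fun Y f p => by
    rw [contr.res_rightAct, contr.coordM_rightAct, map_one, mul_one]
  act_mul {X} x a b := contr.ext_coordM u fun Y f p => by
    rw [contr.res_rightAct, contr.res_rightAct, contr.res_rightAct, contr.coordM_rightAct,
      contr.coordM_rightAct, contr.coordM_rightAct, map_mul, mul_assoc]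
  res_act {X Y} f x b := contr.res_rightAct u f x b
  existsUnique_act {X} x y := by
    have huniq : ∀ {Y : Over S} {x : sec (contr P (leftMul u)) Y} {b b' : gsec B Y.left},
        contr.rightAct u x b = contr.rightAct u x b' → b = b' := by
      intro Y x b b' h
      obtain ⟨R, hR, hP⟩ := P.locally_nonempty Y
      refine gsec_ext B hR fun Z f hf => ?_
      have e := congrArg (fun y => contr.coordM u (hP f hf).some (res _ f y)) h
      rw [contr.coordM_res_rightAct, contr.coordM_res_rightAct] at e
      exact mul_left_cancel e
    obtain ⟨R, hR, hP⟩ := P.locally_nonempty X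
    have h : ∀ ⦃Y : Over S⦄ (f : Y ⟶ X), R f → ∃ b : gsec B Y.left,
        contr.rightAct u (res _ f x) b = res _ f y := by
      intro Y f hf
      obtain ⟨p⟩ := hP f hf
      refine ⟨(contr.coordM u p (res _ f x))⁻¹ * contr.coordM u p (res _ f y), ?_⟩
      rw [← contr.mkM_coordM u p (contr.rightAct u _ _), contr.coordM_rightAct,
        mul_inv_cancel_left, contr.mkM_coordM]
    choose b hb using h
    obtain ⟨b', hb'⟩ := gsec_glue B hR b (by
      intro Y Z f hf g
      apply huniq (Y := Z) (x := res _ (g ≫ f) x)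
      rw [hb, res_comp, res_comp, ← hb f hf, contr.res_rightAct])
    have h' : contr.rightAct u x b' = y := sec_ext _ hR fun Y f hf => by
      rw [contr.res_rightAct, ← hb f hf, ← hb' f hf]
    exact ⟨b', h', fun b'' hb'' => huniq (hb''.trans h'.symm)⟩
  locally_nonempty X := by
    obtain ⟨R, hR, h⟩ := P.locally_nonempty X
    exact ⟨R, hR, fun Y f hf => ⟨contr.mkM u (h f hf).some 1⟩⟩

lemma extend_act_mkM (u : A ⟶ B) (P : Torsor A S) {X : Over S} (p : sec P.sheaf X)
    (b b' : gsec B X.left) :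
    (extend u P).act (contr.mkM u p b) b' = contr.mkM u p (b * b') :=
  contr.rightAct_mkM u p b b'

end Torsor
namespace Torsor

variable [HasSmallGenerators.{w} J] {A B : Sheaf J GrpCat.{w}}

section

variable {S : C} (u : A ⟶ B)

/-- The section of the extended torsor represented by `(p, b)`. -/
noncomputable def rep {P : Torsor A S} {X : Over S} (p : sec P.sheaf X) (b : gsec B X.left) :
    sec (extend u P).sheaf X :=
  contr.mkM u p b

lemma rep_act {P : Torsor A S} {X : Over S} (p : sec P.sheaf X) (b b' : gsec B X.left) :
    (extend u P).act (rep u p b) b' = rep u p (b * b') :=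
  extend_act_mkM u P p b b'

lemma act_rep {P : Torsor A S} {X : Over S} (p : sec P.sheaf X) (a : gsec A X.left)
    (b : gsec B X.left) : rep u (P.act p a) b = rep u p (ghom u X.left a * b) :=
  contr.mkM_act u p a b

lemma res_rep {P : Torsor A S} {X Y : Over S} (f : Y ⟶ X) (p : sec P.sheaf X)
    (b : gsec B X.left) : res (extend u P).sheaf f (rep u p b) =
      rep u (res P.sheaf f p) (gres B f.left b) :=
  contr.res_mkM u f p b

/-- The unit section `(p, 1)` of the extended torsor. -/
noncomputable def unit {P : Torsor A S} (X : Over S) (p : sec P.sheaf X) :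
    sec (extend u P).sheaf X :=
  rep u p 1

lemma res_unit {P : Torsor A S} ⦃X Y : Over S⦄ (f : Y ⟶ X) (p : sec P.sheaf X) :
    res (extend u P).sheaf f (unit u X p) = unit u Y (res P.sheaf f p) :=
  (res_rep u f p 1).trans (by rw [map_one]; rfl)

lemma unit_act {P : Torsor A S} (X : Over S) (p : sec P.sheaf X) (a : gsec A X.left) :
    unit u X (P.act p a) = (extend u P).act (unit u X p) (ghom u X.left a) := by
  rw [unit, unit, act_rep, rep_act, one_mul, mul_one]

lemma unit_ocast {P : Torsor A S} {U : C} {x y : U ⟶ S} (h : x = y) (p : sec P.sheaf (Over.mk x)) :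
    ocast (extend u P).sheaf h (unit u (Over.mk x) p) = unit u (Over.mk y) (ocast P.sheaf h p) := by
  subst h
  simp

section

variable (P : Torsor A S) (R : Torsor B S)
    (φ : ∀ X : Over S, sec P.sheaf X → sec R.sheaf X)
    (hφ : ∀ ⦃X Y : Over S⦄ (f : Y ⟶ X) (p : sec P.sheaf X),
      res R.sheaf f (φ X p) = φ Y (res P.sheaf f p))
    (hφ' : ∀ (X : Over S) (p : sec P.sheaf X) (a : gsec A X.left),
      φ X (P.act p a) = R.act (φ X p) (ghom u X.left a))

/-- The map `P ∧^A B ⟶ R` given on representatives by `(p, b) ↦ φ p · b`. -/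
noncomputable def extendLiftApp (X : Over S) (x : sec (extend u P).sheaf X) : sec R.sheaf X :=
  contr.lift (Q := leftMul u) (F := R.sheaf) (fun X p (b : gsec B X.left) => R.act (φ X p) b)
    (fun X Y f p (b : gsec B X.left) => by
      rw [R.res_act, hφ]
      rfl)
    (fun X p a (b : gsec B X.left) => by
      rw [hφ']
      exact (R.act_mul _ _ _).symm.trans (congrArg _
        ((congrArg (fun c => _ * (c * b)) (map_inv _ a)).trans (mul_inv_cancel_left _ b)))) X x

lemma extendLiftApp_rep (X : Over S) (p : sec P.sheaf X) (b : gsec B X.left) :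
    extendLiftApp u P R φ hφ hφ' X (rep u p b) = R.act (φ X p) b :=
  contr.lift_mk (Q := leftMul u) (F := R.sheaf)
    (fun X p (b : gsec B X.left) => R.act (φ X p) b) _ _ p b

lemma res_extendLiftApp {X Y : Over S} (f : Y ⟶ X) (x : sec (extend u P).sheaf X) :
    res R.sheaf f (extendLiftApp u P R φ hφ hφ' X x) =
      extendLiftApp u P R φ hφ hφ' Y (res (extend u P).sheaf f x) :=
  contr.res_lift (Q := leftMul u) (F := R.sheaf)
    (fun X p (b : gsec B X.left) => R.act (φ X p) b) _ _ f x

/-- Every section of the extended torsor is locally represented by a pair `(p, b)`. -/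
lemma extend_exists_rep {X : Over S} (x : sec (extend u P).sheaf X) : ∃ R ∈ J.over S X,
    ∀ ⦃Y : Over S⦄ (f : Y ⟶ X), R f → ∃ (p : sec P.sheaf Y) (b : gsec B Y.left),
      res (extend u P).sheaf f x = rep u p b :=
  contr.exists_rep x

/-- The morphism of `B`-torsors `P ∧^A B ⟶ R` induced by a `u`-equivariant morphism `P ⟶ R`. -/
noncomputable def extendLift : extend u P ⟶ R where
  app := extendLiftApp u P R φ hφ hφ'
  res_app f x := res_extendLiftApp u P R φ hφ hφ' f x
  app_act {X} x b := by
    obtain ⟨R', hR', hx⟩ := extend_exists_rep u P x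
    refine sec_ext _ hR' fun Y f hf => ?_
    obtain ⟨p, b', e⟩ := hx f hf
    rw [R.res_act, res_extendLiftApp, res_extendLiftApp, (extend u P).res_act, e, rep_act,
      extendLiftApp_rep, extendLiftApp_rep, R.act_mul]

lemma extendLift_rep (X : Over S) (p : sec P.sheaf X) (b : gsec B X.left) :
    app (extendLift u P R φ hφ hφ') X (rep u p b) = R.act (φ X p) b :=
  extendLiftApp_rep u P R φ hφ hφ' X p b

end

lemma extend_hom_ext {P : Torsor A S} {R : Torsor B S} {m n : extend u P ⟶ R}
    (h : ∀ (X : Over S) (p : sec P.sheaf X),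
      app m X (unit u X p) = app n X (unit u X p)) : m = n := by
  refine hom_ext fun X x => ?_
  obtain ⟨R', hR', hx⟩ := extend_exists_rep u P x
  refine sec_ext _ hR' fun Y f hf => ?_
  obtain ⟨p, b, e⟩ := hx f hf
  rw [res_app, res_app, e, ← one_mul b, ← rep_act, app_act, app_act]
  exact congrArg (fun z => R.act z b) (h Y p)

lemma extendLift_unit (P : Torsor A S) (R : Torsor B S)
    (φ : ∀ X : Over S, sec P.sheaf X → sec R.sheaf X)
    (hφ : ∀ ⦃X Y : Over S⦄ (f : Y ⟶ X) (p : sec P.sheaf X),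
      res R.sheaf f (φ X p) = φ Y (res P.sheaf f p))
    (hφ' : ∀ (X : Over S) (p : sec P.sheaf X) (a : gsec A X.left),
      φ X (P.act p a) = R.act (φ X p) (ghom u X.left a)) (X : Over S) (p : sec P.sheaf X) :
    app (extendLift u P R φ hφ hφ') X (unit u X p) = φ X p :=
  (extendLift_rep u P R φ hφ hφ' X p 1).trans (R.act_one _)

/-- A morphism of `A`-torsors induces a morphism of the extended torsors, given on representatives
by `(p, b) ↦ (m p, b)`. -/
noncomputable def extendMap {P Q : Torsor A S} (m : P ⟶ Q) : extend u P ⟶ extend u Q :=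
  extendLift u P (extend u Q) (fun X p => unit u X (app m X p))
    (fun X Y f p => by rw [res_unit, res_app])
    (fun X p a => by rw [app_act, unit_act])

lemma extendMap_unit {P Q : Torsor A S} (m : P ⟶ Q) (X : Over S) (p : sec P.sheaf X) :
    app (extendMap u m) X (unit u X p) = unit u X (app m X p) :=
  extendLift_unit u _ _ _ _ _ X p

/-- The functor of extension of the structure group. -/
noncomputable def extendFunctor (S : C) : Torsor A S ⥤ Torsor B S where
  obj P := extend u P
  map m := extendMap u m
  map_id _ := extend_hom_ext u fun X p => extendMap_unit u _ X p
  map_comp m n := extend_hom_ext u fun X p => (extendMap_unit u _ X p).trans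
    ((congrArg _ (extendMap_unit u m X p)).trans (extendMap_unit u n X _)).symm

/-- Extension of the structure group commutes with restriction: the isomorphism is
given on representatives by `(p, b) ↦ (p, b)`. -/
noncomputable def extendRestrict {S T : C} (f : T ⟶ S) (P : Torsor A S) :
    extend u (P.restrict f) ⟶ (extend u P).restrict f :=
  extendLift u (P.restrict f) ((extend u P).restrict f)
    (fun X p => unit u ((Over.map f).obj X) p)
    (fun _ _ g p => res_unit u ((Over.map f).map g) p)
    (fun X p a => unit_act u ((Over.map f).obj X) p a)

lemma extendRestrict_unit {S T : C} (f : T ⟶ S) (P : Torsor A S) (X : Over T)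
    (p : sec (P.restrict f).sheaf X) :
    app (extendRestrict u f P) X (unit u X p) = unit u (P := P) ((Over.map f).obj X) p :=
  extendLift_unit u _ _ _ _ _ X p

/-- Extension of the structure group commutes with restriction. -/
noncomputable def extendRestrictIso {S T : C} (f : T ⟶ S) :
    restrictFunctor A f ⋙ extendFunctor u T ≅ extendFunctor u S ⋙ restrictFunctor B f :=
  NatIso.ofComponents (fun P => isoOfHom (extendRestrict u f P)) (fun {P Q} m =>
    extend_hom_ext u fun X p => by
      refine (congrArg (app (extendRestrict u f Q) X)
        (extendMap_unit u ((restrictFunctor A f).map m) X p)).trans ?_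
      refine (extendRestrict_unit u f Q X _).trans ?_
      refine Eq.trans ?_ (congrArg (app (extendMap u m) ((Over.map f).obj X))
        (extendRestrict_unit u f P X p)).symm
      exact (extendMap_unit u m ((Over.map f).obj X) p).symm)

end

end Torsor

lemma naturality_map₂_id {D E : Type*} [Bicategory D] [Bicategory E] (F G : D ⥤ᵖ E) {x y : D}
    (f : x ⟶ y) {a : F.obj x ⟶ G.obj x} {b : F.obj y ⟶ G.obj y}
    (e : F.map f ≫ b ≅ a ≫ G.map f) :
    F.map₂ (𝟙 f) ▷ b ≫ e.hom = e.hom ≫ a ◁ G.map₂ (𝟙 f) := by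
  simp

/-- The morphism of fibred categories `TORSC(E; A) ⟶ TORSC(E; B)` given by extension of the
structure group along `u : A ⟶ B`. -/
noncomputable def torscMap [HasSmallGenerators.{w} J] {A B : Sheaf J GrpCat.{w}} (u : A ⟶ B) :
    (torsc A).StrongTrans (torsc B) where
  app S := (Torsor.extendFunctor u S.as.unop).toCatHom
  naturality f := Cat.Hom.isoMk (Torsor.extendRestrictIso u f.as.unop)
  naturality_naturality {S T f g} η := by
    obtain rfl := LocallyDiscrete.eq_of_hom η
    obtain rfl : η = 𝟙 _ := Subsingleton.elim _ _
    exact naturality_map₂_id (torsc A) (torsc B) f (Cat.Hom.isoMk _)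
  naturality_id S := by
    ext P
    refine Torsor.extend_hom_ext u fun X p => ?_
    refine (congrArg _ (Torsor.extendRestrict_unit u _ P X p)).trans ?_
    refine Eq.trans ?_ (Torsor.extendMap_unit u _ X p).symm
    exact Torsor.unit_ocast u (x := X.hom ≫ 𝟙 _) (y := X.hom) (by simp) p
  naturality_comp {S T U} f g := by
    ext P
    refine Torsor.extend_hom_ext u fun X p => ?_
    refine (congrArg _ (Torsor.extendRestrict_unit u _ P X p)).trans ?_
    refine (Torsor.unit_ocast u (x := X.hom ≫ g.as.unop ≫ f.as.unop)
      (y := (X.hom ≫ g.as.unop) ≫ f.as.unop) (by simp) p).trans ?_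
    have e1 := Torsor.extendMap_unit u ((Torsor.restrictComp A f.as.unop g.as.unop).hom.app P) X p
    have e2 := Torsor.extendRestrict_unit u g.as.unop (P.restrict f.as.unop) X
      (Torsor.app ((Torsor.restrictComp A f.as.unop g.as.unop).hom.app P) X p)
    have e3 := Torsor.extendRestrict_unit u f.as.unop P ((Over.map g.as.unop).obj X)
      (Torsor.app ((Torsor.restrictComp A f.as.unop g.as.unop).hom.app P) X p)
    exact ((congrArg (Torsor.app (Torsor.extendRestrict u f.as.unop P) ((Over.map g.as.unop).obj X))
      ((congrArg (Torsor.app (Torsor.extendRestrict u g.as.unop (P.restrict f.as.unop)) X)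
        e1).trans e2)).trans e3).symm
section ContractedGroups

variable [HasSmallGenerators.{w} J] {G : Sheaf J GrpCat.{w}} {S : C}

/-- The sections over `X` of the contracted product `P ∧^G Q` of a `G`-torsor `P` over `S` and of a
sheaf of groups `Q` on which `G` acts on the left by automorphisms. -/
def ContrGroup (P : Torsor G S) (Q : LeftGroup G) (X : Over S) : Type w :=
  sec (contr P Q.toLeftObject) X

namespace ContrGroup

variable {P : Torsor G S} {Q : LeftGroup G}

/-- The restriction map of the sheaf `P ∧^G Q`. -/
noncomputable def restr {X Y : Over S} (f : Y ⟶ X) (x : ContrGroup P Q X) : ContrGroup P Q Y :=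
  res (contr P Q.toLeftObject) f x

/-- The section of `P ∧^G Q` represented by `(p, a)`. -/
noncomputable def mk {X : Over S} (p : sec P.sheaf X) (a : gsec Q.group X.left) :
    ContrGroup P Q X :=
  contr.mk (Q := Q.toLeftObject) p a

/-- The unique `a` such that `x` is represented by `(p, a)`. -/
noncomputable def coord {X : Over S} (p : sec P.sheaf X) (x : ContrGroup P Q X) :
    gsec Q.group X.left :=
  contr.coord (Q := Q.toLeftObject) p x

@[simp]
lemma coord_mk {X : Over S} (p : sec P.sheaf X) (a : gsec Q.group X.left) :
    coord p (mk (Q := Q) p a) = a :=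
  contr.coord_mk (Q := Q.toLeftObject) p a

lemma coord_eq {X : Over S} {p : sec P.sheaf X} {x : ContrGroup P Q X} {a : gsec Q.group X.left}
    (h : x = mk p a) : coord p x = a := by
  rw [h, coord_mk]

@[simp]
lemma mk_coord {X : Over S} (p : sec P.sheaf X) (x : ContrGroup P Q X) :
    mk p (coord p x) = x :=
  contr.mk_coord (Q := Q.toLeftObject) p x

lemma coord_restr {X Y : Over S} (f : Y ⟶ X) (p : sec P.sheaf X) (x : ContrGroup P Q X) :
    coord (res P.sheaf f p) (restr f x) = gres Q.group f.left (coord p x) :=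
  contr.coord_res (Q := Q.toLeftObject) f p x

lemma restr_mk {X Y : Over S} (f : Y ⟶ X) (p : sec P.sheaf X) (a : gsec Q.group X.left) :
    restr f (mk p a) = mk (Q := Q) (res P.sheaf f p) (gres Q.group f.left a) :=
  contr.res_mk (Q := Q.toLeftObject) f p a

lemma coord_act {X : Over S} (p : sec P.sheaf X) (g : gsec G X.left) (x : ContrGroup P Q X) :
    coord (P.act p g) x = Q.smul g⁻¹ (coord p x) :=
  contr.coord_act (Q := Q.toLeftObject) p g x

lemma mk_act {X : Over S} (p : sec P.sheaf X) (g : gsec G X.left) (a : gsec Q.group X.left) :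
    mk (P.act p g) a = mk (Q := Q) p (Q.smul g a) :=
  contr.mk_act (Q := Q.toLeftObject) p g a

lemma restr_id {X : Over S} (x : ContrGroup P Q X) : restr (𝟙 X) x = x :=
  res_id _ _

lemma restr_comp {X Y Z : Over S} (f : Y ⟶ X) (g : Z ⟶ Y) (x : ContrGroup P Q X) :
    restr (g ≫ f) x = restr g (restr f x) :=
  res_comp _ _ _ _

lemma ext_coord {X : Over S} {x y : ContrGroup P Q X}
    (h : ∀ ⦃Y : Over S⦄ (f : Y ⟶ X) (p : sec P.sheaf Y),
      coord p (restr f x) = coord p (restr f y)) : x = y :=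
  contr.ext_coord (Q := Q.toLeftObject) h

/-- The section of `P ∧^G Q` over `X` whose coordinate with respect to a section `p` of `P` over
`f : Y ⟶ X` is `s f p`. -/
noncomputable def ofMap {X : Over S}
    (s : ∀ ⦃Y : Over S⦄, (Y ⟶ X) → sec P.sheaf Y → gsec Q.group Y.left)
    (hs : ∀ ⦃Y Z : Over S⦄ (f : Y ⟶ X) (g : Z ⟶ Y) (p : sec P.sheaf Y),
      s (g ≫ f) (res P.sheaf g p) = gres Q.group g.left (s f p))
    (hs' : ∀ ⦃Y : Over S⦄ (f : Y ⟶ X) (p : sec P.sheaf Y) (g : gsec G Y.left),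
      s f (P.act p g) = Q.smul g⁻¹ (s f p)) : ContrGroup P Q X :=
  contr.ofMap (Q := Q.toLeftObject) s hs hs'

section

variable {X : Over S}
    (s : ∀ ⦃Y : Over S⦄, (Y ⟶ X) → sec P.sheaf Y → gsec Q.group Y.left)
    (hs : ∀ ⦃Y Z : Over S⦄ (f : Y ⟶ X) (g : Z ⟶ Y) (p : sec P.sheaf Y),
      s (g ≫ f) (res P.sheaf g p) = gres Q.group g.left (s f p))
    (hs' : ∀ ⦃Y : Over S⦄ (f : Y ⟶ X) (p : sec P.sheaf Y) (g : gsec G Y.left),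
      s f (P.act p g) = Q.smul g⁻¹ (s f p))

@[simp]
lemma coord_restr_ofMap ⦃Y : Over S⦄ (f : Y ⟶ X) (p : sec P.sheaf Y) :
    coord p (restr f (ofMap s hs hs')) = s f p :=
  contr.coord_res_ofMap (Q := Q.toLeftObject) s hs hs' f p

end

noncomputable instance (X : Over S) : Mul (ContrGroup P Q X) where
  mul x y := ofMap (fun _ f p => coord p (restr f x) * coord p (restr f y))
    (fun _ _ f g p => by rw [restr_comp, restr_comp, coord_restr, coord_restr, map_mul])
    (fun _ f p g => by rw [coord_act, coord_act, Q.smul_mul])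

noncomputable instance (X : Over S) : One (ContrGroup P Q X) where
  one := ofMap (fun _ _ _ => 1) (fun _ _ f g p => by rw [map_one])
    (fun _ f p g => by rw [Q.smul_one])

noncomputable instance (X : Over S) : Inv (ContrGroup P Q X) where
  inv x := ofMap (fun _ f p => (coord p (restr f x))⁻¹)
    (fun _ _ f g p => by rw [restr_comp, coord_restr, map_inv])
    (fun _ f p g => by rw [coord_act, Q.smul_inv])

@[simp]
lemma coord_restr_mul {X Y : Over S} (f : Y ⟶ X) (p : sec P.sheaf Y) (x y : ContrGroup P Q X) :
    coord p (restr f (x * y)) = coord p (restr f x) * coord p (restr f y) :=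
  coord_restr_ofMap _ _ _ f p

@[simp]
lemma coord_restr_one {X Y : Over S} (f : Y ⟶ X) (p : sec P.sheaf Y) :
    coord p (restr f (1 : ContrGroup P Q X)) = 1 :=
  coord_restr_ofMap _ _ _ f p

@[simp]
lemma coord_restr_inv {X Y : Over S} (f : Y ⟶ X) (p : sec P.sheaf Y) (x : ContrGroup P Q X) :
    coord p (restr f x⁻¹) = (coord p (restr f x))⁻¹ :=
  coord_restr_ofMap _ _ _ f p

/-- The group structure on the sections of `P ∧^G Q`, given on representatives by
`(p, a) (p, a') = (p, a a')`. -/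
noncomputable instance (X : Over S) : Group (ContrGroup P Q X) where
  mul_assoc x y z := ext_coord fun Y f p => by simp [mul_assoc]
  one_mul x := ext_coord fun Y f p => by simp
  mul_one x := ext_coord fun Y f p => by simp
  inv_mul_cancel x := ext_coord fun Y f p => by simp

lemma coord_mul {X : Over S} (p : sec P.sheaf X) (x y : ContrGroup P Q X) :
    coord p (x * y) = coord p x * coord p y := by
  have := coord_restr_mul (𝟙 X) p x y
  rwa [restr_id, restr_id, restr_id] at this

lemma mk_mul_mk {X : Over S} (p : sec P.sheaf X) (a a' : gsec Q.group X.left) :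
    mk p a * mk (Q := Q) p a' = mk p (a * a') := by
  rw [← mk_coord p (mk p a * mk p a'), coord_mul, coord_mk, coord_mk]

lemma restr_mul {X Y : Over S} (f : Y ⟶ X) (x y : ContrGroup P Q X) :
    restr f (x * y) = restr f x * restr f y :=
  ext_coord fun Z g p => by simp [← restr_comp]

lemma exists_rep {X : Over S} (x : ContrGroup P Q X) : ∃ R ∈ J.over S X,
    ∀ ⦃Y : Over S⦄ (f : Y ⟶ X), R f → ∃ (p : sec P.sheaf Y) (a : gsec Q.group Y.left),
      restr f x = mk p a :=
  contr.exists_rep (Q := Q.toLeftObject) x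

section map

variable {G' : Sheaf J GrpCat.{w}} {P' : Torsor G' S} {Q' : LeftGroup G'}
    (φ : ∀ X : Over S, sec P.sheaf X → sec P'.sheaf X)
    (v : Q.group ⟶ Q'.group)

/-- The map `P ∧^G Q → P' ∧^{G'} Q'` given on representatives by `(p, a) ↦ (φ p, v a)`, where
`φ : P → P'` and `v : Q → Q'` are compatible with the actions through some `u : G → G'`. -/
noncomputable def map (u : G ⟶ G')
    (hφ : ∀ ⦃X Y : Over S⦄ (f : Y ⟶ X) (p : sec P.sheaf X),
      res P'.sheaf f (φ X p) = φ Y (res P.sheaf f p))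
    (hφ' : ∀ (X : Over S) (p : sec P.sheaf X) (g : gsec G X.left),
      φ X (P.act p g) = P'.act (φ X p) (ghom u X.left g))
    (hv : ∀ (X : C) (g : gsec G X) (a : gsec Q.group X),
      ghom v X (Q.smul g a) = Q'.smul (ghom u X g) (ghom v X a)) (X : Over S)
    (x : ContrGroup P Q X) : ContrGroup P' Q' X :=
  contr.lift (Q := Q.toLeftObject) (F := contr P' Q'.toLeftObject)
    (fun X p (a : gsec Q.group X.left) => mk (φ X p) (ghom v X.left a))
    (fun X Y f p (a : gsec Q.group X.left) => (restr_mk f _ _).trans (by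
      rw [hφ, gres_ghom]
      rfl))
    (fun X p g (a : gsec Q.group X.left) => by
      rw [hφ', mk_act]
      refine congrArg (mk _) ((hv _ _ _).symm.trans (congrArg _ ?_))
      refine (Q.mul_smul _ _ _).symm.trans ?_
      rw [mul_inv_cancel, Q.one_smul]) X x

variable {u : G ⟶ G'}
    (hφ : ∀ ⦃X Y : Over S⦄ (f : Y ⟶ X) (p : sec P.sheaf X),
      res P'.sheaf f (φ X p) = φ Y (res P.sheaf f p))
    (hφ' : ∀ (X : Over S) (p : sec P.sheaf X) (g : gsec G X.left),
      φ X (P.act p g) = P'.act (φ X p) (ghom u X.left g))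
    (hv : ∀ (X : C) (g : gsec G X) (a : gsec Q.group X),
      ghom v X (Q.smul g a) = Q'.smul (ghom u X g) (ghom v X a))

lemma map_mk (X : Over S) (p : sec P.sheaf X) (a : gsec Q.group X.left) :
    map φ v u hφ hφ' hv X (mk p a) = mk (φ X p) (ghom v X.left a) :=
  contr.lift_mk (Q := Q.toLeftObject) (F := contr P' Q'.toLeftObject)
    (fun X p (a : gsec Q.group X.left) => mk (φ X p) (ghom v X.left a)) _ _ p a

lemma restr_map {X Y : Over S} (f : Y ⟶ X) (x : ContrGroup P Q X) :
    restr f (map φ v u hφ hφ' hv X x) = map φ v u hφ hφ' hv Y (restr f x) :=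
  contr.res_lift (Q := Q.toLeftObject) (F := contr P' Q'.toLeftObject)
    (fun X p (a : gsec Q.group X.left) => mk (φ X p) (ghom v X.left a)) _ _ f x

end map

/-- The map `P ∧^G Q → P' ∧^G Q` induced by a morphism of torsors `m : P ⟶ P'`, given on
representatives by `(p, a) ↦ (m p, a)`. -/
noncomputable def mapTorsor {P P' : Torsor G S} (m : P ⟶ P') (Q : LeftGroup G) (X : Over S)
    (x : ContrGroup P Q X) : ContrGroup P' Q X :=
  map (Torsor.app m) (𝟙 Q.group) (𝟙 G) (fun _ _ f p => Torsor.res_app m f p)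
    (fun _ p g => Torsor.app_act m p g) (fun _ _ _ => rfl) X x

lemma mapTorsor_mk {P P' : Torsor G S} (m : P ⟶ P') (X : Over S) (p : sec P.sheaf X)
    (a : gsec Q.group X.left) : mapTorsor m Q X (mk p a) = mk (Torsor.app m X p) a :=
  map_mk _ _ _ _ _ _ _ _

/-- The identification of the contracted product of the restriction of `P` along `f : T ⟶ S` with
the restriction of the contracted product, given on representatives by `(p, a) ↦ (p, a)`. -/
noncomputable def ofRestrict (P : Torsor G S) (Q : LeftGroup G) {T : C} (f : T ⟶ S) (X : Over T)
    (x : ContrGroup (P.restrict f) Q X) : ContrGroup P Q ((Over.map f).obj X) :=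
  contr.lift (P := P.restrict f) (Q := Q.toLeftObject)
    (F := (J.overMapPullback (Type w) f).obj (contr P Q.toLeftObject))
    (fun X p (a : gsec Q.group X.left) => mk (P := P) (X := (Over.map f).obj X) p a)
    (fun X Y g p (a : gsec Q.group X.left) => restr_mk ((Over.map f).map g) p a)
    (fun X p g (a : gsec Q.group X.left) => (mk_act (P := P) (X := (Over.map f).obj X) p g _).trans
      (congrArg (mk _) ((Q.mul_smul _ _ _).symm.trans (by
        rw [mul_inv_cancel, Q.one_smul])))) X x

lemma ofRestrict_mk (P : Torsor G S) {T : C} (f : T ⟶ S) (X : Over T)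
    (p : sec (P.restrict f).sheaf X) (a : gsec Q.group X.left) :
    ofRestrict P Q f X (mk p a) = mk (P := P) (X := (Over.map f).obj X) p a :=
  contr.lift_mk (P := P.restrict f) (Q := Q.toLeftObject)
    (F := (J.overMapPullback (Type w) f).obj (contr P Q.toLeftObject))
    (fun X p (a : gsec Q.group X.left) => mk (P := P) (X := (Over.map f).obj X) p a) _ _ p a

end ContrGroup

end ContractedGroups
/-- A sheaf of crossed groups `(A, ρ, Π)` on the site: a homomorphism of sheaves of groups
`ρ : A ⟶ Π` and a left action of `Π` on `A` by group automorphisms, compatible with restriction,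
such that `ρ (α • a) = α ρ(a) α⁻¹` and `ρ(a) • a' = a a' a⁻¹`. -/
structure CrossedGroupSheaf (J : GrothendieckTopology C) where
  A : Sheaf J GrpCat.{w}
  Pi : Sheaf J GrpCat.{w}
  ρ : A ⟶ Pi
  smul : ∀ {X : C}, gsec Pi X → gsec A X → gsec A X
  one_smul : ∀ {X : C} (a : gsec A X), smul 1 a = a
  mul_smul : ∀ {X : C} (α β : gsec Pi X) (a : gsec A X), smul (α * β) a = smul α (smul β a)
  smul_mul : ∀ {X : C} (α : gsec Pi X) (a b : gsec A X), smul α (a * b) = smul α a * smul α b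
  res_smul : ∀ {X Y : C} (f : Y ⟶ X) (α : gsec Pi X) (a : gsec A X),
    gres A f (smul α a) = smul (gres Pi f α) (gres A f a)
  ρ_smul : ∀ {X : C} (α : gsec Pi X) (a : gsec A X),
    ghom ρ X (smul α a) = α * ghom ρ X a * α⁻¹
  smul_ρ : ∀ {X : C} (a b : gsec A X), smul (ghom ρ X a) b = a * b * a⁻¹

namespace CrossedGroupSheaf

/-- The sheaf of groups `A`, with its left action of `Π`. -/
def band (Φ : CrossedGroupSheaf J) : LeftGroup Φ.Pi where
  group := Φ.A
  smul := Φ.smul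
  one_smul := Φ.one_smul
  mul_smul := Φ.mul_smul
  smul_mul := Φ.smul_mul
  res_smul := Φ.res_smul

/-- A morphism of sheaves of crossed groups `(A, Π) ⟶ (A', Π')` is a pair of homomorphisms
`f : A ⟶ A'` and `φ : Π ⟶ Π'` compatible with the homomorphisms `ρ` and with the actions. -/
structure Hom (Φ Φ' : CrossedGroupSheaf J) where
  f : Φ.A ⟶ Φ'.A
  φ : Φ.Pi ⟶ Φ'.Pi
  ρ_f : ∀ {X : C} (a : gsec Φ.A X), ghom Φ'.ρ X (ghom f X a) = ghom φ X (ghom Φ.ρ X a)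
  f_smul : ∀ {X : C} (α : gsec Φ.Pi X) (a : gsec Φ.A X),
    ghom f X (Φ.smul α a) = Φ'.smul (ghom φ X α) (ghom f X a)

/-- The identity morphism of a sheaf of crossed groups. -/
def Hom.id (Φ : CrossedGroupSheaf J) : Hom Φ Φ where
  f := 𝟙 _
  φ := 𝟙 _
  ρ_f _ := rfl
  f_smul _ _ := rfl

end CrossedGroupSheaf

/-- The sheaf of groups `A`, on which `A` acts on the left by inner automorphisms. -/
def conj (A : Sheaf J GrpCat.{w}) : LeftGroup A where
  group := A
  smul a b := a * b * a⁻¹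
  one_smul b := by simp
  mul_smul a b c := by simp [mul_assoc]
  smul_mul a b c := by simp [mul_assoc]
  res_smul f a b := by simp

section FibredCategories

/-- Fibred categories over `C`, presented as pseudofunctors. -/
abbrev Fibred (C : Type u) [Category.{w} C] := LocallyDiscrete Cᵒᵖ ⥤ᵖ Cat.{max u w, max u (w + 1)}

/-- The fibre category of a fibred category. -/
abbrev Fib (F : Fibred.{w} C) (S : C) : Type max u (w + 1) := F.obj (.mk (op S))

/-- The inverse image of an object. -/
abbrev pull (F : Fibred.{w} C) {S T : C} (f : T ⟶ S) (x : Fib F S) : Fib F T :=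
  (F.map f.op.toLoc).toFunctor.obj x

/-- The inverse image of an isomorphism. -/
def pullIso (F : Fibred.{w} C) {S T : C} (f : T ⟶ S) {x y : Fib F S} (m : x ≅ y) :
    pull F f x ≅ pull F f y :=
  (F.map f.op.toLoc).toFunctor.mapIso m

/-- The canonical isomorphism between an object and its inverse image along an identity. -/
def pullId (F : Fibred.{w} C) {S : C} (x : Fib F S) : pull F (𝟙 S) x ≅ x :=
  (Cat.Hom.toNatIso (F.mapId (.mk (op S)))).app x

/-- The canonical isomorphism between inverse images for `h = g ≫ f`. -/
def pullComp (F : Fibred.{w} C) {S T U : C} {f : T ⟶ S} {g : U ⟶ T} {h : U ⟶ S}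
    (e : g ≫ f = h) (x : Fib F S) : pull F h x ≅ pull F g (pull F f x) :=
  (Cat.Hom.toNatIso (F.mapComp' f.op.toLoc g.op.toLoc h.op.toLoc (by rw [← e]; rfl))).app x

/-- Two objects `x`, `y` in the fibre over `S` are locally isomorphic if there exists a covering
sieve of `S` along whose arrows the inverse images of `x` and `y` are isomorphic. -/
def LocallyIsomorphic (J : GrothendieckTopology C) (F : Fibred.{w} C) {S : C} (x y : Fib F S) :
    Prop :=
  ∃ R ∈ J S, ∀ ⦃T : C⦄ (f : T ⟶ S), R f → Nonempty (pull F f x ≅ pull F f y)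

/-- A gerbe is a stack in groupoids which is locally non-empty and in which any two objects of the
same fibre are locally isomorphic. -/
structure IsGerbe (J : GrothendieckTopology C) (F : Fibred.{w} C) : Prop where
  isStack : F.IsStack J
  isGroupoid : ∀ S : C, IsGroupoid (Fib F S)
  locally_nonempty : ∀ S : C, ∃ R ∈ J S, ∀ ⦃T : C⦄ (f : T ⟶ S), R f → Nonempty (Fib F T)
  locally_isomorphic : ∀ (S : C) (x y : Fib F S), LocallyIsomorphic J F x y

/-- The restriction map of the sheaf `Aut_S(x)` on `C/S`, whose sections over `X : C/S` are the
automorphisms of the inverse image of `x` over `X`. -/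
def autRes (F : Fibred.{w} C) {S : C} (x : Fib F S) {X Y : Over S} (f : Y ⟶ X) :
    Aut (pull F X.hom x) →* Aut (pull F Y.hom x) :=
  (pullComp F (Over.w f) x).symm.conjAut.toMonoidHom.comp
    ((F.map f.left.op.toLoc).toFunctor.mapAut (pull F X.hom x))

end FibredCategories

section MorphismsOfStacks

variable {F G : Fibred.{w} C}

/-- The image of an object of the fibre over `S` under a morphism of fibred categories. -/
abbrev appObj (l : F.StrongTrans G) {S : C} (x : Fib F S) : Fib G S :=
  (l.app (.mk (op S))).toFunctor.obj x

/-- A morphism of fibred categories commutes with inverse images. -/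
def appPull (l : F.StrongTrans G) {S T : C} (f : T ⟶ S) (x : Fib F S) :
    appObj l (pull F f x) ≅ pull G f (appObj l x) :=
  (Cat.Hom.toNatIso (l.naturality f.op.toLoc)).app x

/-- The morphism `Aut(x) → Aut(l(x))` of sheaves of groups on `C/S` induced by a morphism of
fibred categories `l`. -/
def autMap (l : F.StrongTrans G) {S : C} (x : Fib F S) (X : Over S) :
    Aut (pull F X.hom x) →* Aut (pull G X.hom (appObj l x)) :=
  (appPull l X.hom x).conjAut.toMonoidHom.comp
    ((l.app (.mk (op X.left))).toFunctor.mapAut (pull F X.hom x))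

variable {B : Sheaf J GrpCat.{w}}

/-- The `B`-torsor `μ(x)` over `S`, for a morphism `μ : F ⟶ TORSC(E; B)`. -/
def torsorOf (μ : F.StrongTrans (torsc B)) {S : C} (x : Fib F S) : Torsor B S :=
  (μ.app (.mk (op S))).toFunctor.obj x

/-- The morphism of torsors `μ(m) : μ(x) ⟶ μ(y)`. -/
def torsorMap (μ : F.StrongTrans (torsc B)) {S : C} {x y : Fib F S} (m : x ⟶ y) :
    torsorOf μ x ⟶ torsorOf μ y :=
  (μ.app (.mk (op S))).toFunctor.map m

/-- The identification of `μ(f^* x)` with the restriction of `μ(x)` along `f`. -/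
def torsorPull (μ : F.StrongTrans (torsc B)) {S T : C} (f : T ⟶ S) (x : Fib F S) :
    torsorOf μ (pull F f x) ⟶ (torsorOf μ x).restrict f :=
  (μ.naturality f.op.toLoc).hom.toNatTrans.app x

end MorphismsOfStacks

section Automorphisms

variable {S : C}

/-- The automorphism `β` of the inverse image of `P` over `X`, on the sections over `f : Y ⟶ X`. -/
noncomputable def autApp {A : Sheaf J GrpCat.{w}} (P : Torsor A S) (X : Over S)
    (β : Aut (pull (torsc A) X.hom P)) ⦃Y : Over S⦄ (f : Y ⟶ X) (p : sec P.sheaf Y) :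
    sec P.sheaf Y :=
  ocast (x := f.left ≫ X.hom) (y := Y.hom) P.sheaf (by simp)
    (Torsor.app (β.hom : P.restrict X.hom ⟶ P.restrict X.hom) (Over.mk f.left)
      (ocast (x := Y.hom) (y := f.left ≫ X.hom) P.sheaf (by simp) p))

lemma res_app_aux {A : Sheaf J GrpCat.{w}} (P : Torsor A S) {X U V : C} (x : X ⟶ S)
    (β : P.restrict x ⟶ P.restrict x) (f : U ⟶ X) (y : U ⟶ S) (hy : f ≫ x = y) (g : V ⟶ U)
    (z : V ⟶ S) (hz : g ≫ y = z) (k : V ⟶ X) (hk : k = g ≫ f) (p : sec P.sheaf (Over.mk y)) :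
    res P.sheaf (Over.homMk g hz : Over.mk z ⟶ Over.mk y) (ocast P.sheaf hy
      (Torsor.app β (Over.mk f) (ocast P.sheaf hy.symm p))) =
    ocast (x := k ≫ x) P.sheaf (by rw [hk, ← hz, ← hy, Category.assoc])
      (Torsor.app β (Over.mk k) (ocast (y := k ≫ x) P.sheaf
        (by rw [hk, ← hz, ← hy, Category.assoc])
        (res P.sheaf (Over.homMk g hz : Over.mk z ⟶ Over.mk y) p))) := by
  subst hy hz hk
  refine (congrArg (res P.sheaf _) (ocast_rfl P.sheaf _)).trans ?_
  refine (congrArg (fun q => res P.sheaf (Over.homMk g rfl : Over.mk (g ≫ f ≫ x) ⟶ Over.mk (f ≫ x))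
    (Torsor.app β (Over.mk f) q)) (ocast_rfl P.sheaf p)).trans ?_
  have e := Torsor.res_app β (Over.homMk g : Over.mk (g ≫ f) ⟶ Over.mk f) p
  rw [ocast_res]
  refine Eq.trans ?_ (congrArg _ e)
  exact (ocast_res (x := f ≫ x) (y := (g ≫ f) ≫ x) (z := g ≫ f ≫ x) P.sheaf (by simp) g (by simp)
    (Torsor.app β (Over.mk f) p)).symm

lemma res_autApp {A : Sheaf J GrpCat.{w}} (P : Torsor A S) (X : Over S)
    (β : Aut (pull (torsc A) X.hom P)) ⦃Y Z : Over S⦄ (f : Y ⟶ X) (g : Z ⟶ Y)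
    (p : sec P.sheaf Y) :
    res P.sheaf g (autApp P X β f p) = autApp P X β (g ≫ f) (res P.sheaf g p) :=
  res_app_aux P X.hom (β.hom : P.restrict X.hom ⟶ P.restrict X.hom) f.left Y.hom (by simp)
    g.left Z.hom (by simp) (g ≫ f).left (by simp) p

lemma autApp_act {A : Sheaf J GrpCat.{w}} (P : Torsor A S) (X : Over S)
    (β : Aut (pull (torsc A) X.hom P)) ⦃Y : Over S⦄ (f : Y ⟶ X)
    (p : sec P.sheaf Y) (a : gsec A Y.left) :
    autApp P X β f (P.act p a) = P.act (autApp P X β f p) a := by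
  have h : f.left ≫ X.hom = Y.hom := by simp
  have e1 := Torsor.act_ocast P h.symm p a
  have e2 := Torsor.app_act (β.hom : P.restrict X.hom ⟶ P.restrict X.hom)
    (X := Over.mk f.left) (ocast (x := Y.hom) (y := f.left ≫ X.hom) P.sheaf h.symm p) a
  exact (congrArg (fun q => ocast (x := f.left ≫ X.hom) (y := Y.hom) P.sheaf h
    (Torsor.app (β.hom : P.restrict X.hom ⟶ P.restrict X.hom) (Over.mk f.left) q))
    e1).trans ((congrArg (ocast (x := f.left ≫ X.hom) (y := Y.hom) P.sheaf h) e2).trans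
      (Torsor.act_ocast P h _ a))

end Automorphisms

section CrossedGerbes

variable [HasSmallGenerators.{w} J]

/-- For a morphism of fibred categories `μ : G ⟶ TORSC(E; Π)`, an isomorphism
`j : Aut(G) ≅ (- ∧^Π A) ∘ μ` of morphisms of fibred categories with values in sheaves of groups,
such that, for every `x` in the fibre over `S`, every section `a_x` over `S` of `μ(x) ∧^Π A` and
every local representative `(α, a)` of `a_x`, one has `μ(j⁻¹(a_x))(α) = α · ρ(a)`. -/
structure BandIso (Φ : CrossedGroupSheaf.{w} J) (G : Fibred.{w} C)
    (μ : G.StrongTrans (torsc Φ.Pi)) where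
  /-- The isomorphisms `j_x : Aut_S(x) ≅ μ(x) ∧^Π A`, on the sections over `X : C/S`. -/
  j : ∀ {S : C} (x : Fib G S) (X : Over S),
    Aut (pull G X.hom x) ≃* ContrGroup (torsorOf μ x) Φ.band X
  /-- The `j_x` are morphisms of sheaves. -/
  restr_j : ∀ {S : C} (x : Fib G S) {X Y : Over S} (f : Y ⟶ X) (β : Aut (pull G X.hom x)),
    (j x X β).restr f = j x Y (autRes G x f β)
  /-- The `j_x` are natural in `x`. -/
  natural : ∀ {S : C} {x y : Fib G S} (m : x ≅ y) (X : Over S) (β : Aut (pull G X.hom x)),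
    j y X ((pullIso G X.hom m).conjAut β) =
      ContrGroup.mapTorsor (torsorMap μ m.hom) Φ.band X (j x X β)
  /-- The `j_x` are compatible with inverse images. -/
  cartesian : ∀ {S T : C} (f : T ⟶ S) (x : Fib G S) (X : Over T)
    (β : Aut (pull G X.hom (pull G f x))),
    j x ((Over.map f).obj X) ((pullComp G rfl x).symm.conjAut β) =
      ContrGroup.ofRestrict (torsorOf μ x) Φ.band f X
        (ContrGroup.mapTorsor (torsorPull μ f x) Φ.band X (j (pull G f x) X β))
  map_symm_act : ∀ {S : C} (x : Fib G S)
    (a_x : ContrGroup (torsorOf μ x) Φ.band (Over.mk (𝟙 S))) (X : Over S)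
    (α : sec (torsorOf μ x).sheaf X) (a : gsec Φ.A X.left),
    a_x.restr (Over.homMk X.hom : X ⟶ Over.mk (𝟙 S)) = ContrGroup.mk α a →
      Torsor.app (torsorMap μ ((pullId G x).conjAut ((j x (Over.mk (𝟙 S))).symm a_x)).hom) X α =
        (torsorOf μ x).act α (ghom Φ.ρ X.left a)

/-- A structure of `(A, Π)`-gerbe on a gerbe `G`: a morphism `μ : G ⟶ TORSC(E; Π)` and an
isomorphism `j : Aut(G) ≅ (- ∧^Π A) ∘ μ` as above. -/
structure CrossedGerbeStr (Φ : CrossedGroupSheaf.{w} J) (G : Fibred.{w} C) where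
  μ : G.StrongTrans (torsc Φ.Pi)
  band : BandIso Φ G μ

/-- An `(A, Π)`-gerbe `(G, μ, j)`. -/
structure CrossedGerbe (Φ : CrossedGroupSheaf.{w} J) where
  G : Fibred.{w} C
  isGerbe : IsGerbe J G
  str : CrossedGerbeStr Φ G

section

open scoped CategoryTheory.Pseudofunctor.StrongTrans

/-- Isomorphisms between the composites `TORSC(E; φ) ∘ μ` and `μ' ∘ l`, for `φ : B ⟶ B'`. -/
abbrev TorsorIso {B B' : Sheaf J GrpCat.{w}} (φ : B ⟶ B') {G G' : Fibred.{w} C} (l : G ⟶ G')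
    (μ : G ⟶ torsc B) (μ' : G' ⟶ torsc B') :=
  μ ≫ (torscMap φ : torsc B ⟶ torsc B') ≅ l ≫ μ'

/-- The component `μ(x) ∧^B B' ⟶ μ'(l(x))` of an isomorphism `TORSC(E; φ) ∘ μ ≅ μ' ∘ l`. -/
def TorsorIso.app {B B' : Sheaf J GrpCat.{w}} {φ : B ⟶ B'} {G G' : Fibred.{w} C} {l : G ⟶ G'}
    {μ : G ⟶ torsc B} {μ' : G' ⟶ torsc B'} (i : TorsorIso φ l μ μ') {S : C} (x : Fib G S) :
    Torsor.extend φ (torsorOf μ x) ⟶ torsorOf μ' (appObj l x) :=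
  (i.hom.as.app (.mk (op S))).toNatTrans.app x

/-- The map `μ(x) ∧^Π A → μ'(l(x)) ∧^Π' A'` deduced from an isomorphism
`i : TORSC(E; φ) ∘ μ ≅ μ' ∘ l` and from a morphism `(f, φ)` of sheaves of crossed groups: it is
given on representatives by `(p, a) ↦ (i_x(p, 1), f a)`. -/
noncomputable def TorsorIso.contrMap {Φ Φ' : CrossedGroupSheaf.{w} J} (h : Φ.Hom Φ')
    {G G' : Fibred.{w} C} {l : G ⟶ G'} {μ : G ⟶ torsc Φ.Pi} {μ' : G' ⟶ torsc Φ'.Pi}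
    (i : TorsorIso h.φ l μ μ') {S : C} (x : Fib G S) (X : Over S)
    (y : ContrGroup (torsorOf μ x) Φ.band X) :
    ContrGroup (torsorOf μ' (appObj l x)) Φ'.band X :=
  ContrGroup.map (Q := Φ.band) (Q' := Φ'.band)
    (fun X p => Torsor.app (i.app x) X (Torsor.unit h.φ X p)) h.f h.φ
    (fun _ _ f p => by rw [Torsor.res_app, Torsor.res_unit])
    (fun X p g => by rw [Torsor.unit_act, Torsor.app_act])
    (fun _ α a => h.f_smul α a) X y

/-- A `(f, φ)`-morphism `(G, μ, j) ⟶ (G', μ', j')`, for a morphism `(f, φ)` of sheaves of crossed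
groups: a morphism of gerbes `l : G ⟶ G'` with an isomorphism `i : TORSC(E; φ) ∘ μ ≅ μ' ∘ l`
such that, for every `x`, the composite of `Aut(x) → Aut(l(x))` and `j'` is the composite of `j`
and of the map `μ(x) ∧^Π A → μ'(l(x)) ∧^Π' A'` deduced from `i` and `f`. -/
structure CrossedGerbe.Hom {Φ Φ' : CrossedGroupSheaf.{w} J} (h : Φ.Hom Φ') (𝔤 : CrossedGerbe Φ)
    (𝔤' : CrossedGerbe Φ') where
  l : 𝔤.G ⟶ 𝔤'.G
  i : TorsorIso h.φ l 𝔤.str.μ 𝔤'.str.μ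
  comm : ∀ {S : C} (x : Fib 𝔤.G S) (X : Over S) (β : Aut (pull 𝔤.G X.hom x)),
    𝔤'.str.band.j (appObj l x) X (autMap l x X β) = i.contrMap h x X (𝔤.str.band.j x X β)

end

/-- Two `(A, Π)`-gerbes are equivalent if there is a morphism between them over the identity of
`(A, Π)`. -/
def CrossedGerbe.Equivalent {Φ : CrossedGroupSheaf.{w} J} (𝔤 𝔤' : CrossedGerbe Φ) : Prop :=
  Nonempty (CrossedGerbe.Hom (CrossedGroupSheaf.Hom.id Φ) 𝔤 𝔤')

/-- The set `H²(E; (A, Π))` of equivalence classes of `(A, Π)`-gerbes. -/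
def H2 (Φ : CrossedGroupSheaf.{w} J) := Quot (CrossedGerbe.Equivalent (Φ := Φ))

/-- The class of an `(A, Π)`-gerbe. -/
def H2.mk {Φ : CrossedGroupSheaf.{w} J} (𝔤 : CrossedGerbe Φ) : H2 Φ := Quot.mk _ 𝔤

variable {S : C}

/-- The canonical map `dui : Aut_A(P) → P ∧^A A`, where `A` acts on itself by inner automorphisms:
the image of the automorphism `β` is represented by `(p, a)` where `β(p) = p · a`. -/
noncomputable def dui {A : Sheaf J GrpCat.{w}} (P : Torsor A S) (X : Over S)
    (β : Aut (pull (torsc A) X.hom P)) : ContrGroup P (conj A) X :=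
  ContrGroup.ofMap (fun _ f p => P.diff p (autApp P X β f p))
    (fun Y Z f g p => P.diff_eq (by
      rw [← res_autApp, ← P.act_diff p (autApp P X β f p), P.res_act, P.act_diff]
      rfl))
    (fun Y f p a => P.diff_eq (by
      rw [autApp_act]
      refine Eq.trans ?_ ((P.act_mul p (P.diff p (autApp P X β f p)) a).trans
        (congrArg (fun q => P.act q a) (P.act_diff p _)))
      refine (P.act_mul _ _ _).symm.trans (congrArg _ ?_)
      simp [conj, mul_assoc]))

lemma coord_restr_dui {A : Sheaf J GrpCat.{w}} (P : Torsor A S) (X : Over S)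
    (β : Aut (pull (torsc A) X.hom P)) ⦃Y : Over S⦄ (f : Y ⟶ X) (p : sec P.sheaf Y) :
    ContrGroup.coord p ((dui P X β).restr f) = P.diff p (autApp P X β f p) :=
  ContrGroup.coord_restr_ofMap (Q := conj A) _ _ _ f p

lemma dui_eq_mk {A : Sheaf J GrpCat.{w}} (P : Torsor A S) (X : Over S)
    (β : Aut (pull (torsc A) X.hom P)) (p : sec P.sheaf X) (a : gsec A X.left)
    (h : autApp P X β (𝟙 X) p = P.act p a) :
    dui P X β = ContrGroup.mk (Q := conj A) p a := by
  have e := coord_restr_dui P X β (𝟙 X) p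
  rw [ContrGroup.restr_id, P.diff_eq h.symm] at e
  rw [← ContrGroup.mk_coord p (dui P X β)]
  exact congrArg _ e

/-- The map underlying `uni`. -/
noncomputable def uniFun (Φ : CrossedGroupSheaf.{w} J) (P : Torsor Φ.A S) (X : Over S)
    (x : ContrGroup (Torsor.extend Φ.ρ P) Φ.band X) : ContrGroup P (conj Φ.A) X :=
  ContrGroup.ofMap (Q := conj Φ.A)
    (fun Y f p => ContrGroup.coord (P := Torsor.extend Φ.ρ P) (Q := Φ.band)
      (Torsor.unit Φ.ρ Y p) (x.restr f))
    (fun Y Z f g p => by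
      rw [← Torsor.res_unit, ContrGroup.restr_comp, ContrGroup.coord_restr]
      rfl)
    (fun Y f p a => by
      rw [Torsor.unit_act, ContrGroup.coord_act, ← map_inv]
      exact Φ.smul_ρ _ _)

lemma coord_restr_uniFun (Φ : CrossedGroupSheaf.{w} J) (P : Torsor Φ.A S) {X Y : Over S}
    (x : ContrGroup (Torsor.extend Φ.ρ P) Φ.band X) (f : Y ⟶ X) (p : sec P.sheaf Y) :
    ContrGroup.coord p ((uniFun Φ P X x).restr f) =
      ContrGroup.coord (P := Torsor.extend Φ.ρ P) (Q := Φ.band)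
        (Torsor.unit Φ.ρ Y p) (x.restr f) :=
  ContrGroup.coord_restr_ofMap (Q := conj Φ.A) _ _ _ f p

/-- The map `(p, a) ↦ ((p, 1), a)`. -/
noncomputable def uniInv (Φ : CrossedGroupSheaf.{w} J) (P : Torsor Φ.A S) (X : Over S)
    (y : ContrGroup P (conj Φ.A) X) : ContrGroup (Torsor.extend Φ.ρ P) Φ.band X :=
  ContrGroup.map (Q := conj Φ.A) (Q' := Φ.band) (Torsor.unit Φ.ρ) (𝟙 Φ.A) Φ.ρ
    (Torsor.res_unit Φ.ρ) (Torsor.unit_act Φ.ρ) (fun _ a b => (Φ.smul_ρ a b).symm) X y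

lemma uniInv_mk (Φ : CrossedGroupSheaf.{w} J) (P : Torsor Φ.A S) (X : Over S) (p : sec P.sheaf X)
    (a : gsec Φ.A X.left) : uniInv Φ P X (ContrGroup.mk (Q := conj Φ.A) p a) =
      ContrGroup.mk (Q := Φ.band) (Torsor.unit Φ.ρ X p) a :=
  ContrGroup.map_mk (Q := conj Φ.A) (Q' := Φ.band) (Torsor.unit Φ.ρ) (𝟙 Φ.A)
    (Torsor.res_unit Φ.ρ) (Torsor.unit_act Φ.ρ) (fun _ a b => (Φ.smul_ρ a b).symm) X p a

lemma restr_uniInv (Φ : CrossedGroupSheaf.{w} J) (P : Torsor Φ.A S) {X Y : Over S} (f : Y ⟶ X)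
    (y : ContrGroup P (conj Φ.A) X) :
    (uniInv Φ P X y).restr f = uniInv Φ P Y (y.restr f) :=
  ContrGroup.restr_map (Q := conj Φ.A) (Q' := Φ.band) (Torsor.unit Φ.ρ) (𝟙 Φ.A)
    (Torsor.res_unit Φ.ρ) (Torsor.unit_act Φ.ρ) (fun _ a b => (Φ.smul_ρ a b).symm) f y

/-- The canonical isomorphism `uni : (P ∧^A Π) ∧^Π A ≅ P ∧^A A`, where `A` acts on itself by inner
automorphisms on the right-hand side: it is given on representatives by
`((p, α), a) ↦ (p, α • a)`, and its inverse by `(p, a) ↦ ((p, 1), a)`. -/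
noncomputable def uni (Φ : CrossedGroupSheaf.{w} J) (P : Torsor Φ.A S) (X : Over S) :
    ContrGroup (Torsor.extend Φ.ρ P) Φ.band X ≃* ContrGroup P (conj Φ.A) X where
  toFun := uniFun Φ P X
  invFun := uniInv Φ P X
  left_inv x := by
    obtain ⟨R, hR, hP⟩ := P.locally_nonempty X
    refine sec_ext _ hR fun Y f hf => ?_
    obtain ⟨p⟩ := hP f hf
    refine (restr_uniInv Φ P f _).trans ?_
    rw [← ContrGroup.mk_coord p ((uniFun Φ P X x).restr f), coord_restr_uniFun]
    exact (uniInv_mk Φ P Y p _).trans (ContrGroup.mk_coord (Torsor.unit Φ.ρ Y p) (x.restr f))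
  right_inv y := ContrGroup.ext_coord fun Y f p => by
    rw [coord_restr_uniFun, restr_uniInv]
    refine ContrGroup.coord_eq ?_
    exact (congrArg (uniInv Φ P Y) (ContrGroup.mk_coord p (y.restr f)).symm).trans
      (uniInv_mk Φ P Y p _)
  map_mul' x y := ContrGroup.ext_coord fun Y f p => by
    rw [coord_restr_uniFun, ContrGroup.coord_restr_mul, ContrGroup.coord_restr_mul]
    exact (congrArg₂ (· * ·) (coord_restr_uniFun Φ P x f p) (coord_restr_uniFun Φ P y f p)).symm

lemma uni_mk (Φ : CrossedGroupSheaf.{w} J) (P : Torsor Φ.A S) (X : Over S) (p : sec P.sheaf X)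
    (α : gsec Φ.Pi X.left) (a : gsec Φ.A X.left) :
    uni Φ P X (ContrGroup.mk (Q := Φ.band) (Torsor.rep Φ.ρ p α) a) =
      ContrGroup.mk (Q := conj Φ.A) p (Φ.smul α a) := by
  rw [← MulEquiv.eq_symm_apply]
  refine Eq.trans ?_ (uniInv_mk Φ P X p _).symm
  refine Eq.trans ?_ (ContrGroup.mk_act (Q := Φ.band) (Torsor.unit Φ.ρ X p) α a)
  rw [Torsor.unit, Torsor.rep_act, one_mul]

/-- A structure of `(A, Π)`-gerbe `(μ, j)` on `TORSC(E; A)` is canonical if `μ` is the morphism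
`P ↦ P ∧^A Π` of extension of the structure group along `ρ : A ⟶ Π` and `j = uni⁻¹ ∘ dui`. -/
def CrossedGerbeStr.IsCanonical {Φ : CrossedGroupSheaf.{w} J}
    (𝔰 : CrossedGerbeStr Φ (torsc Φ.A)) : Prop :=
  ∃ b : BandIso Φ (torsc Φ.A) (torscMap Φ.ρ),
    (∀ {S : C} (P : Torsor Φ.A S) (X : Over S) (β : Aut (pull (torsc Φ.A) X.hom P)),
      b.j (S := S) P X β = (uni Φ P X).symm (dui P X β)) ∧
    𝔰 = ⟨torscMap Φ.ρ, b⟩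

/-- A class is a unit class if it is the class of `TORSC(E; A)` endowed with a canonical structure
of `(A, Π)`-gerbe. -/
def H2.IsUnitClass {Φ : CrossedGroupSheaf.{w} J} (c : H2 Φ) : Prop :=
  ∃ (h : IsGerbe J (torsc Φ.A)) (𝔰 : CrossedGerbeStr Φ (torsc Φ.A)), 𝔰.IsCanonical ∧
    c = H2.mk ⟨torsc Φ.A, h, 𝔰⟩

end CrossedGerbes

end Torsors

end CrossedGerbes

open CrossedGerbes

/-!
Torsors under a sheaf of groups `A` form a gerbe, which carries a canonical structure of
`(A, Π)`-gerbe, and hence defines the unit class of `H²(E; Φ)`.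

*Gerbe.* The trivial torsor shows that the fibres are non-empty, and two torsors are isomorphic
wherever both have a section (`locallyIsomorphic_torsor`); every morphism of torsors is an
isomorphism. The main point is descent (`isStack_torsc`). Morphisms glue since they are maps of
sheaves (`isPrestackFor_torsc`). For a descent datum on a covering sieve `R`, the global sections
over `Y` of the torsor attached to `q : Y ⟶ S` in `R` form, by means of the transition maps, a sheaf
with an action of `A` on the arrows of `R`: a `SieveTorsor`. A torsor over `S` is obtained by taking
as sections over `X` the families of elements of the `SieveTorsor` over the arrows to `X` whose
composite with `X ⟶ S` lies in `R`, compatible with restriction (`SieveTorsor.glued`). There may be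
too many arrows to `X` for these families to form a small set by construction; but a family is
determined by its values at arrows from the objects of a small generating family, and this is where
the existence of such a family is used (`SieveTorsor.Family.small`).

*Canonical structure.* An automorphism `β` of a torsor `P` is described over a section `p` by the
section `a` of `A` with `β(p) = p · a`, and this identifies `Aut(P)` with `P ∧^A A`, as a sheaf of
groups (`duiEquiv`). Hence `uni⁻¹(dui(β))` is locally represented by `((p, 1), a)`
(`restr_uni_symm_dui`), and naturality, compatibility with inverse images and the condition
`μ(β)(α) = α · ρ(a)` are all checked on such representatives; the last one amounts to
`ρ(g • a) g = g ρ(a)`. Uniqueness holds since a canonical structure is prescribed on all its data,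
and it follows that there is exactly one unit class.
-/

namespace CrossedGerbes

variable {C : Type u} [Category.{w} C] {J : GrothendieckTopology C}

/-! ### Automorphisms of torsors on sections -/

section Canonical

/-- On sections, the coherence isomorphisms of `TORSC(E; A)` are the identifications `ocast` of
sections over equal arrows. -/
lemma pullComp_torsc_hom_app {A : Sheaf J GrpCat.{w}} {S T U : C} {f : T ⟶ S} {g : U ⟶ T}
    {h : U ⟶ S} (e : g ≫ f = h) (P : Torsor A S) (X : Over U)
    (p : sec P.sheaf (Over.mk (X.hom ≫ h))) :
    Torsor.app (P := P.restrict h) (Q := (P.restrict f).restrict g)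
      (pullComp (torsc A) e P).hom X p =
      ocast (x := X.hom ≫ h) (y := (X.hom ≫ g) ≫ f) P.sheaf (by simp [← e]) p := by
  subst e
  have : (torsc A).mapComp' f.op.toLoc g.op.toLoc (g ≫ f).op.toLoc rfl =
    (torsc A).mapComp f.op.toLoc g.op.toLoc := Pseudofunctor.mapComp'_eq_mapComp _ _ _
  unfold pullComp
  rw [this]
  rfl

lemma pullComp_torsc_inv_app {A : Sheaf J GrpCat.{w}} {S T U : C} {f : T ⟶ S} {g : U ⟶ T}
    {h : U ⟶ S} (e : g ≫ f = h) (P : Torsor A S) (X : Over U)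
    (p : sec P.sheaf (Over.mk ((X.hom ≫ g) ≫ f))) :
    Torsor.app (P := (P.restrict f).restrict g) (Q := P.restrict h)
      (pullComp (torsc A) e P).inv X p =
      ocast (x := (X.hom ≫ g) ≫ f) (y := X.hom ≫ h) P.sheaf (by simp [← e]) p := by
  subst e
  have : (torsc A).mapComp' f.op.toLoc g.op.toLoc (g ≫ f).op.toLoc rfl =
    (torsc A).mapComp f.op.toLoc g.op.toLoc := Pseudofunctor.mapComp'_eq_mapComp _ _ _
  unfold pullComp
  rw [this]
  rfl

variable {A : Sheaf J GrpCat.{w}} {S : C} (P : Torsor A S) (X : Over S)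

lemma autApp_mul (β γ : Aut (pull (torsc A) X.hom P)) ⦃Y : Over S⦄ (f : Y ⟶ X)
    (p : sec P.sheaf Y) : autApp P X (β * γ) f p = autApp P X β f (autApp P X γ f p) := by
  refine congrArg (fun q => ocast (x := f.left ≫ X.hom) (y := Y.hom) P.sheaf (by simp)
    (Torsor.app (β.hom : P.restrict X.hom ⟶ P.restrict X.hom) (Over.mk f.left) q)) ?_
  exact ((ocast_ocast (x := f.left ≫ X.hom) (y := Y.hom) (z := f.left ≫ X.hom) P.sheaf
    (by simp) (by simp) _).trans (ocast_rfl _ _)).symm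

/-- `autApp` recovers the components of `β`, so that `β` is determined by it. -/
lemma autApp_homMk (β : Aut (pull (torsc A) X.hom P)) (Z : Over X.left)
    (p : sec P.sheaf (Over.mk (Z.hom ≫ X.hom))) :
    autApp P X β (Over.homMk Z.hom : Over.mk (Z.hom ≫ X.hom) ⟶ X) p =
      Torsor.app (β.hom : P.restrict X.hom ⟶ P.restrict X.hom) Z p := by
  refine (ocast_rfl (x := Z.hom ≫ X.hom) P.sheaf _).trans ?_
  exact congrArg (Torsor.app (β.hom : P.restrict X.hom ⟶ P.restrict X.hom) Z)
    (ocast_rfl (x := Z.hom ≫ X.hom) P.sheaf p)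

variable {P X} in
lemma aut_ext {β γ : Aut (pull (torsc A) X.hom P)}
    (h : ∀ ⦃Y : Over S⦄ (f : Y ⟶ X) (p : sec P.sheaf Y), autApp P X β f p = autApp P X γ f p) :
    β = γ := by
  refine Iso.ext (Torsor.hom_ext (P := P.restrict X.hom) (Q := P.restrict X.hom) fun Z p => ?_)
  exact (autApp_homMk P X β Z p).symm.trans ((h _ p).trans (autApp_homMk P X γ Z p))

/-- The automorphism of the inverse image of `P` over `X` given by an equivariant automorphism
of the restriction of the sheaf `P` to the objects over `X`. -/
noncomputable def autOfMap (φ : ∀ ⦃Y : Over S⦄, (Y ⟶ X) → sec P.sheaf Y → sec P.sheaf Y)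
    (hφ : ∀ ⦃Y Z : Over S⦄ (f : Y ⟶ X) (g : Z ⟶ Y) (p : sec P.sheaf Y),
      res P.sheaf g (φ f p) = φ (g ≫ f) (res P.sheaf g p))
    (hφ' : ∀ ⦃Y : Over S⦄ (f : Y ⟶ X) (p : sec P.sheaf Y) (a : gsec A Y.left),
      φ f (P.act p a) = P.act (φ f p) a) : Aut (pull (torsc A) X.hom P) :=
  Torsor.isoOfHom (P := P.restrict X.hom) (Q := P.restrict X.hom)
    ⟨fun Z p => φ (Over.homMk Z.hom : (Over.map X.hom).obj Z ⟶ X) p,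
      fun {Z Z'} g p => (hφ _ ((Over.map X.hom).map g) p).trans
        (congrArg (fun f => φ (Y := (Over.map X.hom).obj Z') f
          (res P.sheaf ((Over.map X.hom).map g) p)) (by ext; exact Over.w g)),
      fun {Z} p a => hφ' (Over.homMk Z.hom : (Over.map X.hom).obj Z ⟶ X) p a⟩

lemma autApp_autOfMap (φ : ∀ ⦃Y : Over S⦄, (Y ⟶ X) → sec P.sheaf Y → sec P.sheaf Y)
    (hφ : ∀ ⦃Y Z : Over S⦄ (f : Y ⟶ X) (g : Z ⟶ Y) (p : sec P.sheaf Y),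
      res P.sheaf g (φ f p) = φ (g ≫ f) (res P.sheaf g p))
    (hφ' : ∀ ⦃Y : Over S⦄ (f : Y ⟶ X) (p : sec P.sheaf Y) (a : gsec A Y.left),
      φ f (P.act p a) = P.act (φ f p) a) ⦃Y : Over S⦄ (f : Y ⟶ X) (p : sec P.sheaf Y) :
    autApp P X (autOfMap P X φ hφ hφ') f p = φ f p := by
  have e : Y.hom = f.left ≫ X.hom := (Over.w f).symm
  refine (hφ (Over.homMk f.left : Over.mk (f.left ≫ X.hom) ⟶ X)
    (Over.homMk (𝟙 Y.left) (by simp) : Y ⟶ Over.mk (f.left ≫ X.hom)) _).trans ?_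
  have e2 : (Over.homMk (𝟙 Y.left) (by simp) : Y ⟶ Over.mk (f.left ≫ X.hom)) ≫
    (Over.homMk f.left : Over.mk (f.left ≫ X.hom) ⟶ X) = f := by ext; simp
  rw [e2]
  exact congrArg (φ f) ((ocast_ocast (x := Y.hom) (y := f.left ≫ X.hom) (z := Y.hom) P.sheaf
    e e.symm p).trans (ocast_rfl _ _))

/-- The restriction map of `Aut_S(P)` is the expected one: restricting `β` along `f` does not change
its action on sections. -/
lemma autApp_autRes {X Y : Over S} (f : Y ⟶ X) (β : Aut (pull (torsc A) X.hom P))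
    ⦃Z : Over S⦄ (g : Z ⟶ Y) (p : sec P.sheaf Z) :
    autApp P Y (autRes (torsc A) P f β) g p = autApp P X β (g ≫ f) p := by
  have e : (autRes (torsc A) P f β).hom = (pullComp (torsc A) (Over.w f) P).hom ≫
    (Torsor.restrictFunctor A f.left).map β.hom ≫ (pullComp (torsc A) (Over.w f) P).inv := by
    simp [autRes, Iso.conjAut]
    rfl
  have hX : (g ≫ f).left ≫ X.hom = Z.hom := Over.w (g ≫ f)
  have hY : g.left ≫ Y.hom = Z.hom := Over.w g
  have hXY : (g.left ≫ f.left) ≫ X.hom = g.left ≫ Y.hom := by simp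
  have e1 := pullComp_torsc_hom_app (Over.w f) P (Over.mk g.left)
    (ocast (x := Z.hom) (y := g.left ≫ Y.hom) P.sheaf hY.symm p)
  have e2 := pullComp_torsc_inv_app (Over.w f) P (Over.mk g.left)
    (Torsor.app (β.hom : P.restrict X.hom ⟶ P.restrict X.hom) (Over.mk (g.left ≫ f.left))
      (ocast (x := Z.hom) (y := (g.left ≫ f.left) ≫ X.hom) P.sheaf hX.symm p))
  refine (congrArg (fun m : P.restrict Y.hom ⟶ P.restrict Y.hom =>
    ocast (x := g.left ≫ Y.hom) (y := Z.hom) P.sheaf hY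
      (Torsor.app m (Over.mk g.left) (ocast (x := Z.hom) P.sheaf hY.symm p))) e).trans ?_
  refine (congrArg (fun q => ocast (x := g.left ≫ Y.hom) (y := Z.hom) P.sheaf hY
    (Torsor.app (P := (P.restrict X.hom).restrict f.left) (Q := P.restrict Y.hom)
      (pullComp (torsc A) (Over.w f) P).inv (Over.mk g.left)
      (Torsor.app (β.hom : P.restrict X.hom ⟶ P.restrict X.hom) (Over.mk (g.left ≫ f.left)) q)))
    (e1.trans (ocast_ocast P.sheaf _ _ _))).trans ?_
  exact (congrArg (ocast (x := g.left ≫ Y.hom) (y := Z.hom) P.sheaf hY) e2).trans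
    (ocast_ocast P.sheaf hXY hY _)

lemma Torsor.diff_app {A : Sheaf J GrpCat.{w}} {P Q : Torsor A S} (m : P ⟶ Q) {X : Over S}
    (p p' : sec P.sheaf X) : Q.diff (Torsor.app m X p) (Torsor.app m X p') = P.diff p p' :=
  Q.diff_eq (by rw [← Torsor.app_act, P.act_diff])

lemma conjAut_hom {D : Type*} [Category* D] {x y : D} (e : x ≅ y) (β : Aut x) :
    (e.conjAut β).hom = e.inv ≫ β.hom ≫ e.hom :=
  rfl

/-- Transport of `β` along an isomorphism `m : P ≅ Q` acts on sections as `m ∘ β ∘ m⁻¹`. -/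
lemma autApp_conjAut_pullIso {P Q : Torsor A S} (m : P ≅ Q) (X : Over S)
    (β : Aut (pull (torsc A) X.hom P)) ⦃Y : Over S⦄ (f : Y ⟶ X) (p : sec P.sheaf Y) :
    autApp Q X ((pullIso (torsc A) X.hom (S := S) (x := P) (y := Q) m).conjAut β) f
      (Torsor.app m.hom Y p) = Torsor.app m.hom Y (autApp P X β f p) := by
  have e : ((pullIso (torsc A) X.hom (S := S) (x := P) (y := Q) m).conjAut β).hom =
      (Torsor.restrictFunctor A X.hom).map m.inv ≫ β.hom ≫
        (Torsor.restrictFunctor A X.hom).map m.hom := by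
    simp [pullIso, Iso.conjAut]
    rfl
  have h : f.left ≫ X.hom = Y.hom := Over.w f
  have e1 : Torsor.app m.inv (Over.mk (f.left ≫ X.hom))
      (ocast (x := Y.hom) (y := f.left ≫ X.hom) Q.sheaf h.symm (Torsor.app m.hom Y p)) =
      ocast (x := Y.hom) (y := f.left ≫ X.hom) P.sheaf h.symm p := by
    refine (Torsor.app_ocast m.inv h.symm _).trans (congrArg _ ?_)
    exact congrArg (fun n : P ⟶ P => Torsor.app n Y p) m.hom_inv_id
  refine (congrArg (fun m : Q.restrict X.hom ⟶ Q.restrict X.hom =>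
    ocast (x := f.left ≫ X.hom) (y := Y.hom) Q.sheaf h
      (Torsor.app m (Over.mk f.left) (ocast (x := Y.hom) Q.sheaf h.symm _))) e).trans ?_
  refine (congrArg (fun q => ocast (x := f.left ≫ X.hom) (y := Y.hom) Q.sheaf h
    (Torsor.app m.hom (Over.mk (f.left ≫ X.hom))
      (Torsor.app (β.hom : P.restrict X.hom ⟶ P.restrict X.hom) (Over.mk f.left) q))) e1).trans ?_
  exact (Torsor.app_ocast m.hom h _).symm

lemma ocast_restrict {T U : C} (f : T ⟶ S) {x y : U ⟶ T} (h : x = y)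
    (p : sec (P.restrict f).sheaf (Over.mk x)) :
    ocast (P.restrict f).sheaf h p =
      ocast (x := x ≫ f) (y := y ≫ f) P.sheaf (by rw [h]) p := by
  subst h
  exact (ocast_rfl _ _).trans (ocast_rfl _ _).symm

/-- The identification of the automorphisms of `f^* P` with those of `P` does not change their
action on sections. -/
lemma autApp_conjAut_pullComp {T : C} (f : T ⟶ S) (X : Over T)
    (β : Aut (pull (torsc A) X.hom (P.restrict f))) ⦃Y : Over T⦄ (g : Y ⟶ X)
    (p : sec P.sheaf ((Over.map f).obj Y)) :
    autApp P ((Over.map f).obj X)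
      ((pullComp (torsc A) (h := X.hom ≫ f) rfl P).symm.conjAut β) ((Over.map f).map g) p =
      autApp (P.restrict f) X β g p := by
  have e : ((pullComp (torsc A) (h := X.hom ≫ f) rfl P).symm.conjAut β).hom =
      (pullComp (torsc A) (h := X.hom ≫ f) rfl P).hom ≫ β.hom ≫
        (pullComp (torsc A) (h := X.hom ≫ f) rfl P).inv :=
    conjAut_hom _ _
  have h : g.left ≫ X.hom = Y.hom := Over.w g
  have h' : g.left ≫ X.hom ≫ f = Y.hom ≫ f := by rw [← h, Category.assoc]
  have e1 := pullComp_torsc_hom_app (h := X.hom ≫ f) rfl P (Over.mk g.left)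
    (ocast (x := Y.hom ≫ f) (y := g.left ≫ X.hom ≫ f) P.sheaf h'.symm p)
  have e3 := ocast_restrict P f h.symm p
  have e2 := pullComp_torsc_inv_app (h := X.hom ≫ f) rfl P (Over.mk g.left)
    (Torsor.app (β.hom : (P.restrict f).restrict X.hom ⟶ (P.restrict f).restrict X.hom)
      (Over.mk g.left) (ocast (x := Y.hom) (y := g.left ≫ X.hom) (P.restrict f).sheaf h.symm p))
  refine (congrArg (fun m : P.restrict (X.hom ≫ f) ⟶ P.restrict (X.hom ≫ f) =>
    ocast (x := g.left ≫ X.hom ≫ f) (y := Y.hom ≫ f) P.sheaf h'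
      (Torsor.app m (Over.mk g.left) (ocast (x := Y.hom ≫ f) P.sheaf h'.symm p))) e).trans ?_
  refine (congrArg (fun q => ocast (x := g.left ≫ X.hom ≫ f) (y := Y.hom ≫ f) P.sheaf h'
    (Torsor.app (P := (P.restrict f).restrict X.hom) (Q := P.restrict (X.hom ≫ f))
      (pullComp (torsc A) (h := X.hom ≫ f) rfl P).inv (Over.mk g.left)
      (Torsor.app (β.hom : (P.restrict f).restrict X.hom ⟶ (P.restrict f).restrict X.hom)
        (Over.mk g.left) q)))
    (e1.trans ((ocast_ocast P.sheaf _ _ _).trans e3.symm))).trans ?_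
  refine (congrArg (ocast (x := g.left ≫ X.hom ≫ f) (y := Y.hom ≫ f) P.sheaf h') e2).trans ?_
  exact (ocast_ocast P.sheaf (by simp) h' _).trans (ocast_restrict P f h _).symm

/-! ### The canonical structure on the fibred category of torsors -/

variable [HasSmallGenerators.{w} J]

/-- The map `dui` is an isomorphism of groups: its inverse sends a section `y` of `P ∧^A A` to the
automorphism `p ↦ p · a`, where `(p, a)` represents `y`. -/
noncomputable def duiEquiv : Aut (pull (torsc A) X.hom P) ≃* ContrGroup P (conj A) X where
  toFun := dui P X
  invFun y := autOfMap P X (fun Y f p => P.act p (ContrGroup.coord (Q := conj A) p (y.restr f)))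
    (fun Y Z f g p => by
      rw [ContrGroup.restr_comp, ContrGroup.coord_restr]
      exact P.res_act g p (ContrGroup.coord p (y.restr f)))
    (fun Y f p a => by
      rw [ContrGroup.coord_act]
      refine (P.act_mul p a ((conj A).smul a⁻¹ (ContrGroup.coord p (y.restr f)))).symm.trans ?_
      refine Eq.trans (congrArg (P.act p) ?_) (P.act_mul p (ContrGroup.coord p (y.restr f)) a)
      simp [conj, mul_assoc])
  left_inv β := aut_ext fun Y f p => by
    rw [autApp_autOfMap, coord_restr_dui]
    exact P.act_diff _ _
  right_inv y := ContrGroup.ext_coord fun Y f p => by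
    rw [coord_restr_dui, autApp_autOfMap]
    exact P.diff_eq rfl
  map_mul' β γ := ContrGroup.ext_coord fun Y f p => by
    rw [ContrGroup.coord_restr_mul, coord_restr_dui, coord_restr_dui, coord_restr_dui, autApp_mul]
    refine P.diff_eq ?_
    refine (P.act_mul p (P.diff p (autApp P X β f p)) (P.diff p (autApp P X γ f p))).trans ?_
    rw [P.act_diff, ← autApp_act, P.act_diff]

lemma dui_restr {X Y : Over S} (f : Y ⟶ X) (β : Aut (pull (torsc A) X.hom P)) :
    (dui P X β).restr f = dui P Y (autRes (torsc A) P f β) :=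
  ContrGroup.ext_coord fun Z g p => by
    rw [← ContrGroup.restr_comp, coord_restr_dui, coord_restr_dui, autApp_autRes]

variable {Φ : CrossedGroupSheaf.{w} J}

/-- The sections of `(P ∧^A Π) ∧^Π A` corresponding to automorphisms of `P`: if `β(p) = p · a` then
`uni⁻¹ (dui β)` is represented by `((p, 1), a)`. -/
lemma uni_symm_dui (P : Torsor Φ.A S) (X : Over S) (β : Aut (pull (torsc Φ.A) X.hom P))
    (p : sec P.sheaf X) : (uni Φ P X).symm (dui P X β) =
      ContrGroup.mk (Q := Φ.band) (Torsor.unit Φ.ρ X p) (P.diff p (autApp P X β (𝟙 X) p)) :=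
  (congrArg (uniInv Φ P X) (dui_eq_mk P X β p _ (P.act_diff _ _).symm)).trans
    (uniInv_mk Φ P X p _)

lemma uni_symm_dui_restr (P : Torsor Φ.A S) {X Y : Over S} (f : Y ⟶ X)
    (β : Aut (pull (torsc Φ.A) X.hom P)) :
    ((uni Φ P X).symm (dui P X β)).restr f =
      (uni Φ P Y).symm (dui P Y (autRes (torsc Φ.A) P f β)) :=
  (restr_uniInv Φ P f _).trans (congrArg (uniInv Φ P Y) (dui_restr P f β))

lemma ContrGroup.ext_of_locally {G : Sheaf J GrpCat.{w}} {P : Torsor G S} {Q : LeftGroup G}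
    {X : Over S} {x y : ContrGroup P Q X} {R : Sieve X} (hR : R ∈ J.over S X)
    (h : ∀ ⦃Y : Over S⦄ (f : Y ⟶ X), R f → x.restr f = y.restr f) : x = y :=
  sec_ext _ hR h

lemma ContrGroup.restr_mapTorsor {G : Sheaf J GrpCat.{w}} {P P' : Torsor G S} (m : P ⟶ P')
    {Q : LeftGroup G} {X Y : Over S} (f : Y ⟶ X) (x : ContrGroup P Q X) :
    (ContrGroup.mapTorsor m Q X x).restr f = ContrGroup.mapTorsor m Q Y (x.restr f) :=
  ContrGroup.restr_map (Torsor.app m) (𝟙 Q.group) (u := 𝟙 G) (fun _ _ f p => Torsor.res_app m f p)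
    (fun _ p g => Torsor.app_act m p g) (fun _ _ _ => rfl) f x

lemma ContrGroup.restr_ofRestrict {G : Sheaf J GrpCat.{w}} (P : Torsor G S) {Q : LeftGroup G}
    {T : C} (f : T ⟶ S) {X Y : Over T} (g : Y ⟶ X) (x : ContrGroup (P.restrict f) Q X) :
    (ContrGroup.ofRestrict P Q f X x).restr ((Over.map f).map g) =
      ContrGroup.ofRestrict P Q f Y (x.restr g) :=
  contr.res_lift (P := P.restrict f) (Q := Q.toLeftObject)
    (F := (J.overMapPullback (Type w) f).obj (contr P Q.toLeftObject))
    (fun X p (a : gsec Q.group X.left) => ContrGroup.mk (P := P) (X := (Over.map f).obj X) p a)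
    _ _ g x

/-- If `β(p) = p · a` for a section `p` of `P` over `f : Y ⟶ X`, then the section `uni⁻¹ (dui β)` is
represented over `Y` by `((p, 1), a)`. -/
lemma restr_uni_symm_dui (P : Torsor Φ.A S) {X Y : Over S} (f : Y ⟶ X)
    (β : Aut (pull (torsc Φ.A) X.hom P)) (p : sec P.sheaf Y) :
    ((uni Φ P X).symm (dui P X β)).restr f =
      ContrGroup.mk (Q := Φ.band) (Torsor.unit Φ.ρ Y p) (P.diff p (autApp P X β f p)) := by
  rw [uni_symm_dui_restr, uni_symm_dui P Y _ p, autApp_autRes, Category.id_comp]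

/-- Naturality of `uni⁻¹ ∘ dui`: over a section `p` of `P`, both sides are represented by
`((m(p), 1), a)` where `β(p) = p · a`. -/
lemma uni_symm_dui_conjAut_pullIso {P Q : Torsor Φ.A S} (m : P ≅ Q) (X : Over S)
    (β : Aut (pull (torsc Φ.A) X.hom P)) :
    (uni Φ Q X).symm
      (dui Q X ((pullIso (torsc Φ.A) X.hom (S := S) (x := P) (y := Q) m).conjAut β)) =
      ContrGroup.mapTorsor (Torsor.extendMap Φ.ρ m.hom) Φ.band X
        ((uni Φ P X).symm (dui P X β)) := by
  obtain ⟨R, hR, hP⟩ := P.locally_nonempty X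
  refine ContrGroup.ext_of_locally hR fun Y f hf => ?_
  obtain ⟨p⟩ := hP f hf
  rw [restr_uni_symm_dui Q f _ (Torsor.app m.hom Y p), autApp_conjAut_pullIso, Torsor.diff_app,
    ContrGroup.restr_mapTorsor, restr_uni_symm_dui P f β p]
  refine Eq.trans ?_ (ContrGroup.mapTorsor_mk (Q := Φ.band) _ Y (Torsor.unit Φ.ρ Y p)
    (P.diff p (autApp P X β f p))).symm
  rw [Torsor.extendMap_unit]

/-- Compatibility of `uni⁻¹ ∘ dui` with inverse images. -/
lemma uni_symm_dui_conjAut_pullComp (P : Torsor Φ.A S) {T : C} (f : T ⟶ S) (X : Over T)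
    (β : Aut (pull (torsc Φ.A) X.hom (P.restrict f))) :
    (uni Φ P ((Over.map f).obj X)).symm (dui P ((Over.map f).obj X)
      ((pullComp (torsc Φ.A) (h := X.hom ≫ f) rfl P).symm.conjAut β)) =
      ContrGroup.ofRestrict (Torsor.extend Φ.ρ P) Φ.band f X
        (ContrGroup.mapTorsor (Torsor.extendRestrict Φ.ρ f P) Φ.band X
          ((uni Φ (P.restrict f) X).symm (dui (P.restrict f) X β))) := by
  obtain ⟨R, hR, hP⟩ := (P.restrict f).locally_nonempty X
  refine sec_ext ((J.overMapPullback (Type w) f).obj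
    (contr (Torsor.extend Φ.ρ P) Φ.band.toLeftObject)) hR fun Y g hg => ?_
  obtain ⟨p⟩ := hP g hg
  refine (restr_uni_symm_dui P ((Over.map f).map g) _ p).trans ?_
  refine Eq.trans ?_ (ContrGroup.restr_ofRestrict (Torsor.extend Φ.ρ P) (Q := Φ.band) f g _).symm
  rw [ContrGroup.restr_mapTorsor, restr_uni_symm_dui (P.restrict f) g β p]
  refine Eq.trans (congrArg (fun q => ContrGroup.mk (Q := Φ.band) (P := Torsor.extend Φ.ρ P)
    (X := (Over.map f).obj Y) (Torsor.unit Φ.ρ ((Over.map f).obj Y) p)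
    (P.diff (X := (Over.map f).obj Y) p q)) (autApp_conjAut_pullComp P f X β g p)) ?_
  refine Eq.trans ?_ (congrArg (ContrGroup.ofRestrict _ _ f Y)
    (ContrGroup.mapTorsor_mk (Q := Φ.band) _ Y (Torsor.unit Φ.ρ Y p) _)).symm
  refine Eq.trans ?_ (ContrGroup.ofRestrict_mk (Q := Φ.band) (Torsor.extend Φ.ρ P) f Y _ _).symm
  rw [Torsor.extendRestrict_unit]
  rfl

/-- The condition `μ(β)(α) = α · ρ(a)` for `μ(P) = P ∧^A Π`. Locally `α = (p, 1) · g` and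
`β(p) = p · b`; comparing representatives gives `b = g • a`, and
`ρ(g • a) g = g ρ(a)` yields the claim. -/
lemma extendMap_act_of_restr_eq_mk (P : Torsor Φ.A S)
    (β : Aut (pull (torsc Φ.A) (𝟙 S) P)) (X : Over S) (α : sec (Torsor.extend Φ.ρ P).sheaf X)
    (a : gsec Φ.A X.left)
    (h : ((uni Φ P (Over.mk (𝟙 S))).symm (dui P (Over.mk (𝟙 S)) β)).restr
      (Over.homMk X.hom : X ⟶ Over.mk (𝟙 S)) = ContrGroup.mk (Q := Φ.band) α a) :
    Torsor.app (Torsor.extendMap (P := P) (Q := P) Φ.ρ ((pullId (torsc Φ.A) P).conjAut β).hom) X α =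
      (Torsor.extend Φ.ρ P).act α (ghom Φ.ρ X.left a) := by
  obtain ⟨R, hR, hP⟩ := P.locally_nonempty X
  refine sec_ext _ hR fun Y f hf => ?_
  obtain ⟨p⟩ := hP f hf
  rw [Torsor.res_app, Torsor.res_act]
  obtain ⟨g, hg⟩ : ∃ g : gsec Φ.Pi Y.left, (Torsor.extend Φ.ρ P).act (Torsor.unit Φ.ρ Y p) g =
    res (Torsor.extend Φ.ρ P).sheaf f α := ⟨_, (Torsor.extend Φ.ρ P).act_diff _ _⟩
  have e : f ≫ (Over.homMk X.hom : X ⟶ Over.mk (𝟙 S)) = Over.homMk Y.hom := by ext; simp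
  have h' := congrArg (ContrGroup.restr f) h
  rw [← ContrGroup.restr_comp, e] at h'
  have h'' : P.diff p (autApp P (Over.mk (𝟙 S)) β (Over.homMk Y.hom) p) =
      Φ.smul g (gres Φ.A f.left a) := contr.mk_injective (Q := Φ.band.toLeftObject) _ <|
    (restr_uni_symm_dui P (X := Over.mk (𝟙 S)) (Over.homMk Y.hom) β p).symm.trans <|
    h'.trans <| (ContrGroup.restr_mk (Q := Φ.band) f α a).trans <|
    (congrArg (ContrGroup.mk (Q := Φ.band) · (gres Φ.A f.left a)) hg.symm).trans
    (ContrGroup.mk_act (Q := Φ.band) (Torsor.unit Φ.ρ Y p) g (gres Φ.A f.left a))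
  have hu : Torsor.unit Φ.ρ Y (autApp P (Over.mk (𝟙 S)) β (Over.homMk Y.hom) p) =
      (Torsor.extend Φ.ρ P).act (Torsor.unit Φ.ρ Y p)
        (ghom Φ.ρ Y.left (Φ.smul g (gres Φ.A f.left a))) := by
    rw [← Torsor.unit_act, ← h'', P.act_diff]
  rw [← hg, Torsor.app_act]
  refine (congrArg (fun x => (Torsor.extend Φ.ρ P).act x g)
    ((Torsor.extendMap_unit (P := P) (Q := P) Φ.ρ
      ((pullId (torsc Φ.A) P).conjAut β).hom Y p).trans hu)).trans ?_
  refine ((Torsor.extend Φ.ρ P).act_mul _ _ _).symm.trans (Eq.trans (congrArg _ ?_)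
    ((Torsor.extend Φ.ρ P).act_mul _ _ _))
  refine (congrArg (· * g) (Φ.ρ_smul g (gres Φ.A f.left a))).trans ?_
  rw [inv_mul_cancel_right, gres_ghom]

/-- The isomorphism `uni⁻¹ ∘ dui : Aut_A(P) ≅ (P ∧^A Π) ∧^Π A`. -/
noncomputable def canonicalEquiv (P : Torsor Φ.A S) (X : Over S) :
    Aut (pull (torsc Φ.A) X.hom P) ≃* ContrGroup (Torsor.extend Φ.ρ P) Φ.band X :=
  (duiEquiv P X).trans (uni Φ P X).symm

/-- The isomorphisms `uni⁻¹ ∘ dui` form an isomorphism of morphisms of stacks, and satisfy the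
compatibility with the action of automorphisms on `P ∧^A Π`. -/
noncomputable def canonicalBandIso (Φ : CrossedGroupSheaf.{w} J) :
    BandIso Φ (torsc Φ.A) (torscMap Φ.ρ) where
  j {S} P X := canonicalEquiv (S := S) P X
  restr_j {S} P {_ _} f β := uni_symm_dui_restr (S := S) P f β
  natural {S} {P Q} m X β := uni_symm_dui_conjAut_pullIso (S := S) (P := P) (Q := Q) m X β
  cartesian {S _} f P X β := uni_symm_dui_conjAut_pullComp (S := S) P f X β
  map_symm_act {S} P a_x X α a h := extendMap_act_of_restr_eq_mk (S := S) P _ X α a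
    ((congrArg (ContrGroup.restr _)
      ((canonicalEquiv (S := S) P (Over.mk (𝟙 S))).apply_symm_apply a_x)).trans h)

/-- The conditions defining a canonical structure prescribe all of its data, so that only the
existence requires a proof. -/
lemma existsUnique_isCanonical (Φ : CrossedGroupSheaf.{w} J) :
    ∃! 𝔰 : CrossedGerbeStr Φ (torsc Φ.A), 𝔰.IsCanonical := by
  refine ⟨⟨torscMap Φ.ρ, canonicalBandIso Φ⟩, ⟨canonicalBandIso Φ, fun _ _ _ => rfl, rfl⟩, ?_⟩
  rintro _ ⟨b, hb, rfl⟩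
  have h : @b.j = @(canonicalBandIso Φ).j := by
    funext S P X
    exact MulEquiv.ext (hb P X)
  congr 1
  cases b
  cases h
  rfl

end Canonical

/-! ### Trivial torsors and local isomorphisms -/

section Trivial

namespace Torsor

/-- The trivial `A`-torsor over `S`: the restriction of `A`, on which `A` acts by multiplication on
the right. -/
noncomputable def trivial (A : Sheaf J GrpCat.{w}) (S : C) : Torsor A S where
  sheaf := (usheaf A).over S
  act {X} := fun (p : gsec A X.left) a => (p * a : gsec A X.left)
  act_one {X} := fun (p : gsec A X.left) => mul_one p
  act_mul {X} := fun (p : gsec A X.left) a b => (mul_assoc p a b).symm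
  res_act {X Y} f := fun (p : gsec A X.left) a => map_mul (gres A f.left) p a
  existsUnique_act {X} := fun (p q : gsec A X.left) => ⟨p⁻¹ * q, mul_inv_cancel_left p q,
    fun _ h => eq_inv_mul_of_mul_eq (G := gsec A X.left) h⟩
  locally_nonempty X := ⟨⊤, (J.over S).top_mem X, fun Y _ _ => ⟨(1 : gsec A Y.left)⟩⟩

variable {A : Sheaf J GrpCat.{w}} {S : C}

/-- The morphism of torsors over `S` which sends the global section `p` of `P` to the global section
`q` of `Q`. -/
noncomputable def homOfSec (P Q : Torsor A S) (p : sec P.sheaf (Over.mk (𝟙 S)))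
    (q : sec Q.sheaf (Over.mk (𝟙 S))) : P ⟶ Q where
  app X x := Q.act (res Q.sheaf (Over.homMk X.hom) q)
    (P.diff (res P.sheaf (Over.homMk X.hom) p) x)
  res_app {X Y} f x := by
    have e : f ≫ (Over.homMk X.hom : X ⟶ Over.mk (𝟙 S)) = Over.homMk Y.hom := by ext; simp
    rw [Q.res_act, ← res_comp, e]
    refine congrArg _ (P.diff_eq ?_).symm
    rw [← e, res_comp, ← P.res_act, P.act_diff]
  app_act {X} x a := by
    rw [← Q.act_mul]
    refine congrArg _ (P.diff_eq ?_)
    rw [P.act_mul, P.act_diff]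

end Torsor

/-- Every morphism of torsors is an isomorphism. -/
lemma isGroupoid_torsor (A : Sheaf J GrpCat.{w}) (S : C) : IsGroupoid (Fib (torsc A) S) :=
  ⟨fun {P Q} m => (Torsor.isoOfHom (A := A) (S := S) (P := P) (Q := Q) m).isIso_hom⟩

/-- Two torsors are isomorphic over any object over which both have a section. -/
lemma locallyIsomorphic_torsor (A : Sheaf J GrpCat.{w}) {S : C} (P Q : Torsor A S) :
    LocallyIsomorphic J (torsc A) (S := S) P Q := by
  obtain ⟨R, hR, hP⟩ := P.locally_nonempty (Over.mk (𝟙 S))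
  obtain ⟨R', hR', hQ⟩ := Q.locally_nonempty (Over.mk (𝟙 S))
  refine ⟨Sieve.overEquiv _ (R ⊓ R'), ?_, fun T f hf => ?_⟩
  · exact (J.mem_over_iff _).1 ((J.over S).intersection_covering hR hR')
  · have hf' := (Sieve.overEquiv_iff (Y := Over.mk (𝟙 S)) (R ⊓ R') f).1 hf
    obtain ⟨p⟩ := hP _ hf'.1
    obtain ⟨q⟩ := hQ _ hf'.2
    have e : f ≫ 𝟙 S = 𝟙 T ≫ f := by simp
    exact ⟨Torsor.isoOfHom (P := P.restrict f) (Q := Q.restrict f)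
      ((P.restrict f).homOfSec (Q.restrict f) (ocast (x := f ≫ 𝟙 S) (y := 𝟙 T ≫ f) P.sheaf e p)
        (ocast (x := f ≫ 𝟙 S) (y := 𝟙 T ≫ f) Q.sheaf e q))⟩

end Trivial

/-! ### Evaluation of morphisms between inverse images -/

section

variable {S : C} (F : Sheaf (J.over S) (Type w))

/-- Restriction along `g : V ⟶ U` of a section over `y : U ⟶ S` to a section over `z : V ⟶ S`, where
`z = g ≫ y`. -/
def hres {U V : C} {y : U ⟶ S} {z : V ⟶ S} (g : V ⟶ U) (h : g ≫ y = z)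
    (p : sec F (Over.mk y)) : sec F (Over.mk z) :=
  res F (Over.homMk g h : Over.mk z ⟶ Over.mk y) p

@[simp]
lemma hres_id {U : C} {y : U ⟶ S} (h : 𝟙 U ≫ y = y) (p : sec F (Over.mk y)) :
    hres F (𝟙 U) h p = p :=
  ocast_rfl F p

lemma hres_hres {U V W : C} {x : U ⟶ S} {y : V ⟶ S} {z : W ⟶ S} (f : V ⟶ U) (h : f ≫ x = y)
    (g : W ⟶ V) (h' : g ≫ y = z) (p : sec F (Over.mk x)) :
    hres F g h' (hres F f h p) = hres F (g ≫ f) (by rw [Category.assoc, h, h']) p := by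
  refine (res_comp F _ _ p).symm.trans ?_
  exact congrArg (fun k => res F k p) (by ext; rfl)

lemma hres_congr {U V : C} {y : U ⟶ S} {z : V ⟶ S} {g g' : V ⟶ U} (e : g = g') (h : g ≫ y = z)
    (p : sec F (Over.mk y)) : hres F g h p = hres F g' (e ▸ h) p := by
  subst e
  rfl

lemma ocast_ocast3 {U : C} {x y z t : U ⟶ S} (h₁ : x = y)
    (h₂ : y = z) (h₃ : z = t) (p : sec F (Over.mk x)) :
    ocast F h₃ (ocast F h₂ (ocast F h₁ p)) = ocast F (h₁.trans (h₂.trans h₃)) p := by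
  subst h₁ h₂ h₃
  simp

lemma hres_eq_of_hres_eq {U V : C} {y : U ⟶ S} {z z' : V ⟶ S} {g : V ⟶ U} (h : g ≫ y = z)
    (h' : g ≫ y = z') {p p' : sec F (Over.mk y)} (e : hres F g h p = hres F g h p') :
    hres F g h' p = hres F g h' p' := by
  subst h h'
  exact e

/-- Sections agree if they agree along the arrows of a covering sieve of the source of `y`. -/
lemma hres_ext {U : C} {y : U ⟶ S} {R : Sieve U} (hR : R ∈ J U) {p p' : sec F (Over.mk y)}
    (e : ∀ ⦃V : C⦄ (g : V ⟶ U), R g → hres F g rfl p = hres F g rfl p') : p = p' := by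
  refine sec_ext F (J.overEquiv_symm_mem_over (Over.mk y) R hR) fun Y g hg => ?_
  have := congrArg (hres F (𝟙 _) (by simpa using Over.w g)) (e g.left hg)
  rw [hres_hres, hres_hres] at this
  have e' : (Over.homMk (𝟙 _ ≫ g.left) (by simpa using Over.w g) : Y ⟶ Over.mk y) = g := by
    ext; simp
  exact (congrArg (fun k => res F k p) e').symm.trans
    (this.trans (congrArg (fun k => res F k p') e'))

/-- Gluing of sections over a covering sieve of the source of `y`. The restriction along `g` may be
written over any arrow `z` equal to `g ≫ y`. -/
lemma hres_glue {U : C} {y : U ⟶ S} {R : Sieve U} (hR : R ∈ J U)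
    (x : ∀ ⦃V : C⦄ (g : V ⟶ U) (z : V ⟶ S), g ≫ y = z → R g → sec F (Over.mk z))
    (hx : ∀ ⦃V W : C⦄ (g : V ⟶ U) (z : V ⟶ S) (h : g ≫ y = z) (hg : R g) (k : W ⟶ V),
      hres F k rfl (x g z h hg) = x (k ≫ g) (k ≫ z) (by rw [Category.assoc, h])
        (R.downward_closed hg k)) :
    ∃ p : sec F (Over.mk y), ∀ ⦃V : C⦄ (g : V ⟶ U) (z : V ⟶ S) (h : g ≫ y = z) (hg : R g),
      hres F g h p = x g z h hg := by
  obtain ⟨p, hp⟩ := sec_glue F (J.overEquiv_symm_mem_over (Over.mk y) R hR)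
    (fun Y g hg => x g.left Y.hom (Over.w g) hg) (fun Y Z g hg k => by
      have e : k.left ≫ Y.hom = Z.hom := Over.w k
      have h1 := hx g.left Y.hom (Over.w g) hg k.left
      have aux : ∀ (z : Z.left ⟶ S) (e : k.left ≫ Y.hom = z),
        hres F k.left e (x g.left Y.hom (Over.w g) hg) = x (k.left ≫ g.left) z
          (by rw [← e, Category.assoc]; exact congrArg _ (Over.w g))
          (R.downward_closed hg k.left) := by
        rintro z rfl
        exact h1
      exact aux Z.hom e)
  exact ⟨p, fun V g z h hg => hp (Over.homMk g h : Over.mk z ⟶ Over.mk y) hg⟩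

end

section

variable {A : Sheaf J GrpCat.{w}} {S : C}

lemma Torsor.hres_act (P : Torsor A S) {U V : C} {y : U ⟶ S} {z : V ⟶ S} (g : V ⟶ U)
    (h : g ≫ y = z) (p : sec P.sheaf (Over.mk y)) (a : gsec A U) :
    hres P.sheaf g h (P.act (X := Over.mk y) p a) =
      P.act (X := Over.mk z) (hres P.sheaf g h p) (gres A g a) :=
  P.res_act (Over.homMk g h : Over.mk z ⟶ Over.mk y) p a

lemma Torsor.hres_app {P Q : Torsor A S} (m : P ⟶ Q) {U V : C} {y : U ⟶ S} {z : V ⟶ S} (g : V ⟶ U)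
    (h : g ≫ y = z) (p : sec P.sheaf (Over.mk y)) :
    hres Q.sheaf g h (Torsor.app m (Over.mk y) p) =
      Torsor.app m (Over.mk z) (hres P.sheaf g h p) :=
  Torsor.res_app m _ p

/-- The map from sections of `P` over `y` to sections of `Q` over `z` given by a morphism of torsors
`φ : f₁^* P ⟶ f₂^* Q`, where `y = a ≫ f₁` and `z = a ≫ f₂`. -/
def pullEval {S₁ S₂ T U : C} {P : Torsor A S₁} {Q : Torsor A S₂} {f₁ : T ⟶ S₁} {f₂ : T ⟶ S₂}
    (φ : P.restrict f₁ ⟶ Q.restrict f₂) (a : U ⟶ T) {y : U ⟶ S₁} {z : U ⟶ S₂} (hy : a ≫ f₁ = y)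
    (hz : a ≫ f₂ = z) (p : sec P.sheaf (Over.mk y)) : sec Q.sheaf (Over.mk z) :=
  hres (y := a ≫ f₂) (z := z) Q.sheaf (𝟙 U) (by simpa using hz) (Torsor.app φ (Over.mk a)
    (hres (y := y) (z := a ≫ f₁) P.sheaf (𝟙 U) (by simpa using hy.symm) p))

lemma app_eq_pullEval {S₁ S₂ T : C} {P : Torsor A S₁} {Q : Torsor A S₂} {f₁ : T ⟶ S₁}
    {f₂ : T ⟶ S₂} (φ : P.restrict f₁ ⟶ Q.restrict f₂) (X : Over T)
    (p : sec P.sheaf (Over.mk (X.hom ≫ f₁))) :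
    Torsor.app φ X p = pullEval φ X.hom rfl rfl p :=
  ((hres_id (y := X.hom ≫ f₂) Q.sheaf (by simp) _).trans
    (congrArg (Torsor.app φ X) (hres_id (y := X.hom ≫ f₁) P.sheaf (by simp) p))).symm

section

variable {S₁ S₂ S₃ T U : C} {P : Torsor A S₁} {Q : Torsor A S₂} {R : Torsor A S₃} {f₁ : T ⟶ S₁}
  {f₂ : T ⟶ S₂} {f₃ : T ⟶ S₃}

lemma pullEval_rfl (φ : P.restrict f₁ ⟶ Q.restrict f₂) (a : U ⟶ T)
    (p : sec P.sheaf (Over.mk (a ≫ f₁))) :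
    pullEval φ a rfl rfl p = Torsor.app φ (Over.mk a) p :=
  (app_eq_pullEval φ (Over.mk a) p).symm

lemma hres_pullEval (φ : P.restrict f₁ ⟶ Q.restrict f₂) (a : U ⟶ T) {y : U ⟶ S₁} {z : U ⟶ S₂}
    (hy : a ≫ f₁ = y) (hz : a ≫ f₂ = z) {V : C} (g : V ⟶ U) {y' : V ⟶ S₁} {z' : V ⟶ S₂}
    (hy' : g ≫ y = y') (hz' : g ≫ z = z') (p : sec P.sheaf (Over.mk y)) :
    hres Q.sheaf g hz' (pullEval φ a hy hz p) =
      pullEval φ (g ≫ a) (by rw [Category.assoc, hy, hy']) (by rw [Category.assoc, hz, hz'])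
        (hres P.sheaf g hy' p) := by
  subst hy hz
  subst hy' hz'
  have := Torsor.hres_app φ (y := a) (z := g ≫ a) g rfl p
  rw [pullEval_rfl]
  refine (hres_congr Q.sheaf (Category.id_comp g).symm rfl _).trans ?_
  refine (hres_hres (y := (g ≫ a) ≫ f₂) Q.sheaf g (by simp) (𝟙 V) (by simp) _).symm.trans ?_
  refine (congrArg (hres (y := (g ≫ a) ≫ f₂) Q.sheaf (𝟙 V) (by simp)) this).trans ?_
  refine congrArg (fun q => hres (y := (g ≫ a) ≫ f₂) Q.sheaf (𝟙 V) (by simp)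
    (Torsor.app φ (Over.mk (g ≫ a)) q)) ?_
  refine Eq.trans ?_ (hres_hres (x := a ≫ f₁) (y := g ≫ a ≫ f₁) (z := (g ≫ a) ≫ f₁) P.sheaf g rfl
    (𝟙 V) (by simp) p).symm
  exact (hres_congr (y := a ≫ f₁) (z := (g ≫ a) ≫ f₁) P.sheaf (Category.id_comp g).symm
    (by simp) p)

lemma pullEval_act (φ : P.restrict f₁ ⟶ Q.restrict f₂) (a : U ⟶ T) {y : U ⟶ S₁} {z : U ⟶ S₂}
    (hy : a ≫ f₁ = y) (hz : a ≫ f₂ = z) (p : sec P.sheaf (Over.mk y)) (b : gsec A U) :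
    pullEval φ a hy hz (P.act (X := Over.mk y) p b) =
      Q.act (X := Over.mk z) (pullEval φ a hy hz p) b := by
  subst hy hz
  rw [pullEval_rfl, pullEval_rfl]
  exact Torsor.app_act φ (X := Over.mk a) p b

lemma pullEval_comp (φ : P.restrict f₁ ⟶ Q.restrict f₂) (ψ : Q.restrict f₂ ⟶ R.restrict f₃)
    (a : U ⟶ T) {x : U ⟶ S₁} {y : U ⟶ S₂} {z : U ⟶ S₃} (hx : a ≫ f₁ = x) (hy : a ≫ f₂ = y)
    (hz : a ≫ f₃ = z) (p : sec P.sheaf (Over.mk x)) :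
    pullEval (φ ≫ ψ) a hx hz p = pullEval ψ a hy hz (pullEval φ a hx hy p) := by
  subst hx hy hz
  rw [pullEval_rfl, pullEval_rfl, pullEval_rfl]
  rfl

lemma pullEval_id (a : U ⟶ T) {y : U ⟶ S₁} (hy : a ≫ f₁ = y) (p : sec P.sheaf (Over.mk y)) :
    pullEval (𝟙 (P.restrict f₁)) a hy hy p = p := by
  subst hy
  exact pullEval_rfl _ a p

lemma pullEval_restrictFunctor_map {P' : Torsor A S₁} (m : P ⟶ P') (a : U ⟶ T) {y : U ⟶ S₁}
    (hy : a ≫ f₁ = y) (p : sec P.sheaf (Over.mk y)) :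
    pullEval (P := P) (Q := P') ((Torsor.restrictFunctor A f₁).map m) a hy hy p =
      Torsor.app m (Over.mk y) p := by
  subst hy
  exact pullEval_rfl _ a p

/-- The base change of `φ` along `g` is evaluated over `a` as `φ` over `a ≫ g`. -/
lemma pullEval_pullHom (φ : P.restrict f₁ ⟶ Q.restrict f₂) {T' : C} (g : T' ⟶ T) (gf₁ : T' ⟶ S₁)
    (gf₂ : T' ⟶ S₂) (h₁ : g ≫ f₁ = gf₁) (h₂ : g ≫ f₂ = gf₂) (a : U ⟶ T') {y : U ⟶ S₁} {z : U ⟶ S₂}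
    (hy : a ≫ gf₁ = y) (hz : a ≫ gf₂ = z) (p : sec P.sheaf (Over.mk y)) :
    pullEval (P := P) (Q := Q) (Pseudofunctor.LocallyDiscreteOpToCat.pullHom (F := torsc A)
      (M₁ := P) (M₂ := Q) φ g gf₁ gf₂ h₁ h₂) a hy hz p =
      pullEval φ (a ≫ g) (by rw [Category.assoc, h₁, hy]) (by rw [Category.assoc, h₂, hz]) p := by
  subst h₁ h₂
  subst hy hz
  refine (pullEval_rfl (P := P) (Q := Q) (f₁ := g ≫ f₁) (f₂ := g ≫ f₂) _ a p).trans ?_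
  refine (pullComp_torsc_inv_app (f := f₂) (g := g) (h := g ≫ f₂) rfl Q (Over.mk a) _).trans ?_
  refine congrArg (fun q => ocast (x := (a ≫ g) ≫ f₂) (y := a ≫ g ≫ f₂) Q.sheaf (by simp)
    (Torsor.app φ (Over.mk (a ≫ g)) q)) ?_
  exact pullComp_torsc_hom_app (f := f₁) (g := g) (h := g ≫ f₁) rfl P (Over.mk a) p

end

end

/-! ### Gluing of torsors over a sieve -/

/-- A torsor under `A` defined only over the arrows `q : Y ⟶ S` of a sieve `R`: sets `V(q)` of
sections, which form a sheaf and carry a free and transitive right action of `A`, and which are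
locally non-empty. -/
structure SieveTorsor (A : Sheaf J GrpCat.{w}) {S : C} (R : Sieve S) where
  obj : ∀ {Y : C} (q : Y ⟶ S), R q → Type w
  map : ∀ {Y Z : C} {q : Y ⟶ S} {q' : Z ⟶ S} {hq : R q} {hq' : R q'} (g : Z ⟶ Y),
    g ≫ q = q' → obj q hq → obj q' hq'
  map_id : ∀ {Y : C} {q : Y ⟶ S} {hq : R q} (h : 𝟙 Y ≫ q = q) (p : obj q hq),
    map (hq' := hq) (𝟙 Y) h p = p
  map_map : ∀ {X Y Z : C} {q : X ⟶ S} {q' : Y ⟶ S} {q'' : Z ⟶ S} {hq : R q} {hq' : R q'}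
    {hq'' : R q''} (f : Y ⟶ X) (h : f ≫ q = q') (g : Z ⟶ Y) (h' : g ≫ q' = q'') (p : obj q hq),
    map (hq' := hq'') g h' (map (hq' := hq') f h p) =
      map (g ≫ f) (by rw [Category.assoc, h, h']) p
  act : ∀ {Y : C} {q : Y ⟶ S} {hq : R q}, obj q hq → gsec A Y → obj q hq
  act_one : ∀ {Y : C} {q : Y ⟶ S} {hq : R q} (p : obj q hq), act p 1 = p
  act_mul : ∀ {Y : C} {q : Y ⟶ S} {hq : R q} (p : obj q hq) (a b : gsec A Y),
    act p (a * b) = act (act p a) b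
  map_act : ∀ {Y Z : C} {q : Y ⟶ S} {q' : Z ⟶ S} {hq : R q} {hq' : R q'} (g : Z ⟶ Y)
    (h : g ≫ q = q') (p : obj q hq) (a : gsec A Y),
    map (hq' := hq') g h (act p a) = act (map g h p) (gres A g a)
  existsUnique_act : ∀ {Y : C} {q : Y ⟶ S} {hq : R q} (p p' : obj q hq),
    ∃! a : gsec A Y, act p a = p'
  locally_nonempty : ∀ {Y : C} (q : Y ⟶ S) (hq : R q), ∃ T ∈ J Y, ∀ ⦃Z : C⦄ (g : Z ⟶ Y), T g →
    Nonempty (obj (g ≫ q) (R.downward_closed hq g))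
  ext : ∀ {Y : C} {q : Y ⟶ S} {hq : R q} {T : Sieve Y}, T ∈ J Y → ∀ {p p' : obj q hq},
    (∀ ⦃Z : C⦄ (g : Z ⟶ Y), T g → map (hq' := R.downward_closed hq g) g rfl p = map g rfl p') →
      p = p'
  glue : ∀ {Y : C} {q : Y ⟶ S} {hq : R q} {T : Sieve Y}, T ∈ J Y →
    ∀ (x : ∀ ⦃Z : C⦄ (g : Z ⟶ Y), T g → obj (g ≫ q) (R.downward_closed hq g)),
    (∀ ⦃Z W : C⦄ (g : Z ⟶ Y) (hg : T g) (k : W ⟶ Z),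
      map k (Category.assoc _ _ _).symm (x g hg) = x (k ≫ g) (T.downward_closed hg k)) →
    ∃ p : obj q hq, ∀ ⦃Z : C⦄ (g : Z ⟶ Y) (hg : T g), map g rfl p = x g hg

namespace SieveTorsor

variable {A : Sheaf J GrpCat.{w}} {S : C} {R : Sieve S} (V : SieveTorsor A R)

/-- The sections over `X : C/S` of the torsor obtained by gluing: the compatible families of
sections of `V` over the arrows to `X` whose composite with `X ⟶ S` belongs to the sieve. The value
at `g` may be written over any arrow `q` equal to `g ≫ X.hom`. -/
@[ext]
structure Family (X : Over S) where
  val : ∀ ⦃Y : C⦄ (g : Y ⟶ X.left) (q : Y ⟶ S) (_ : g ≫ X.hom = q) (hq : R q), V.obj q hq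
  res_val : ∀ ⦃Y Z : C⦄ (g : Y ⟶ X.left) (q : Y ⟶ S) (h : g ≫ X.hom = q) (hq : R q) (k : Z ⟶ Y)
    (q' : Z ⟶ S) (h' : k ≫ q = q') (hq' : R q'),
    V.map k h' (val g q h hq) = val (k ≫ g) q' (by rw [Category.assoc, h, h']) hq'

namespace Family

variable {V}

/-- The restriction of a family. -/
def restr {X X' : Over S} (f : X' ⟶ X) (s : V.Family X) : V.Family X' where
  val _ g q h hq := s.val (g ≫ f.left) q (by rw [Category.assoc, Over.w f, h]) hq
  res_val Y Z g q h hq k q' h' hq' := by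
    rw [s.res_val (h' := h') (hq' := hq')]
    simp only [Category.assoc]

@[simp]
lemma restr_val {X X' : Over S} (f : X' ⟶ X) (s : V.Family X) {Y : C} (g : Y ⟶ X'.left)
    (q : Y ⟶ S) (h : g ≫ X'.hom = q) (hq : R q) :
    (s.restr f).val g q h hq = s.val (g ≫ f.left) q (by rw [Category.assoc, Over.w f, h]) hq :=
  rfl

lemma ext_val {X : Over S} {s t : V.Family X}
    (h : ∀ ⦃Y : C⦄ (g : Y ⟶ X.left) (q : Y ⟶ S) (h : g ≫ X.hom = q) (hq : R q),
      s.val g q h hq = t.val g q h hq) : s = t := by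
  ext Y g q h' hq
  exact h g q h' hq

lemma val_congr {X : Over S} (s : V.Family X) {Y : C} {g g' : Y ⟶ X.left} (e : g = g')
    {q : Y ⟶ S} (h : g ≫ X.hom = q) (hq : R q) : s.val g q h hq = s.val g' q (e ▸ h) hq := by
  subst e
  rfl

/-- The action of `A` on families. -/
def act {X : Over S} (s : V.Family X) (a : gsec A X.left) : V.Family X where
  val _ g q h hq := V.act (s.val g q h hq) (gres A g a)
  res_val Y Z g q h hq k q' h' hq' := by
    rw [V.map_act, s.res_val (hq' := hq') (h' := h'), gres_comp]

/-- The family of the restrictions of a section of `V`. -/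
def ofSec {X : Over S} (hX : R X.hom) (p : V.obj X.hom hX) : V.Family X where
  val _ g _ h _ := V.map g h p
  res_val _ _ _ _ _ _ _ _ _ _ := V.map_map _ _ _ _ _

lemma ext_of_cover {X : Over S} {T : Sieve X} (hT : T ∈ J.over S X) {s t : V.Family X}
    (e : ∀ ⦃Y : Over S⦄ (f : Y ⟶ X), T f → s.restr f = t.restr f) : s = t := by
  refine ext_val fun Y g q h hq => V.ext ((J.over S).pullback_stable
    (Over.homMk g h : Over.mk q ⟶ X) hT) fun Z k hk => ?_
  have hk' := (Sieve.overEquiv_iff (Y := Over.mk q) _ k).1 hk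
  have := congrArg (fun s => s.val (𝟙 Z) (k ≫ q) (Category.id_comp _) (R.downward_closed hq k))
    (e _ hk')
  simp only [restr_val] at this
  rw [s.res_val, t.res_val]
  exact (s.val_congr (Category.id_comp _).symm _ _).trans
    (this.trans (t.val_congr (Category.id_comp _) _ _))

lemma glue {X : Over S} {T : Sieve X} (hT : T ∈ J.over S X)
    (y : ∀ ⦃Y : Over S⦄ (f : Y ⟶ X), T f → V.Family Y)
    (hy : ∀ ⦃Y Z : Over S⦄ (f : Y ⟶ X) (hf : T f) (g : Z ⟶ Y),
      (y f hf).restr g = y (g ≫ f) (T.downward_closed hf g)) :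
    ∃ s : V.Family X, ∀ ⦃Y : Over S⦄ (f : Y ⟶ X) (hf : T f), s.restr f = y f hf := by
  -- The arrows to `Y` over which a member of the given families can be evaluated.
  let T' : ∀ ⦃Y : C⦄ (g : Y ⟶ X.left) (q : Y ⟶ S), g ≫ X.hom = q → Sieve Y := fun Y g q h =>
    Sieve.overEquiv (Over.mk q) (T.pullback (Over.homMk g h : Over.mk q ⟶ X))
  have hT' : ∀ ⦃Y : C⦄ (g : Y ⟶ X.left) (q : Y ⟶ S) (h : g ≫ X.hom = q), T' g q h ∈ J Y :=
    fun Y g q h => (J.over S).pullback_stable (Over.homMk g h : Over.mk q ⟶ X) hT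
  have hmem : ∀ ⦃Y Z : C⦄ (g : Y ⟶ X.left) (q : Y ⟶ S) (h : g ≫ X.hom = q) (k : Z ⟶ Y)
      (_ : T' g q h k) (q' : Z ⟶ S) (h' : k ≫ q = q'),
      T (Over.homMk (k ≫ g) (by simp [h, h']) : Over.mk q' ⟶ X) := by
    rintro Y Z g q h k hk _ rfl
    exact (Sieve.overEquiv_iff (Y := Over.mk q) _ k).1 hk
  have hT_congr : ∀ ⦃Y : Over S⦄ {f f' : Y ⟶ X}, f = f' → T f → T f' := by
    rintro Y f _ rfl hf
    exact hf
  have hy' : ∀ ⦃Y : Over S⦄ (f f' : Y ⟶ X) (hf : T f) (hf' : T f'), f = f' →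
      y f hf = y f' hf' := by
    rintro Y f _ hf hf' rfl
    rfl
  have hval : ∀ ⦃Y : C⦄ (g : Y ⟶ X.left) (q : Y ⟶ S) (h : g ≫ X.hom = q) (hq : R q),
      ∃ p : V.obj q hq, ∀ ⦃Z : C⦄ (k : Z ⟶ Y) (hk : T' g q h k) (q' : Z ⟶ S) (h' : k ≫ q = q')
        (hq' : R q'), V.map (hq' := hq') k h' p =
          (y _ (hmem g q h k hk q' h')).val (𝟙 Z) q' (Category.id_comp _) hq' := by
    intro Y g q h hq
    obtain ⟨p, hp⟩ := V.glue (hT' g q h) (hq := hq) (fun Z k hk =>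
      (y _ (hmem g q h k hk _ rfl)).val (𝟙 Z) (k ≫ q) (Category.id_comp _)
        (R.downward_closed hq k)) (fun Z W k hk l => by
      have e := (hy _ (hmem g q h k hk _ rfl)
        (Over.homMk l (by simp) : Over.mk ((l ≫ k) ≫ q) ⟶ Over.mk (k ≫ q))).trans
        (hy' _ _ _ (hmem g q h (l ≫ k) ((T' g q h).downward_closed hk l) _ rfl) (by ext; simp))
      rw [res_val, ← e, restr_val]
      exact val_congr _ (by simp) _ _)
    refine ⟨p, ?_⟩
    rintro Z k hk _ rfl hq'
    exact hp k hk
  choose val hval using hval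
  refine ⟨⟨val, fun Y Z g q h hq k q' h' hq' => ?_⟩, fun Y f hf => ?_⟩
  · refine V.ext (hT' (k ≫ g) q' (by rw [Category.assoc, h, h'])) fun W l hl => ?_
    have hl' : T' g q h (l ≫ k) := by
      refine (Sieve.overEquiv_iff (Y := Over.mk q) _ (l ≫ k)).2 ?_
      subst h'
      exact hT_congr (by ext; simp) (hmem _ _ _ l hl ((l ≫ k) ≫ q) (by simp))
    rw [V.map_map, hval g q h hq (l ≫ k) hl', hval _ _ _ _ l hl]
    rw [hy' _ _ _ _]
    ext
    simp
  · refine ext_val fun Z g q h hq => ?_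
    have hf' : T ((Over.homMk g h : Over.mk q ⟶ Y) ≫ f) := T.downward_closed hf _
    have e : (Over.homMk (𝟙 Z ≫ g ≫ f.left) (by simp [h]) : Over.mk q ⟶ X) =
      (Over.homMk g h : Over.mk q ⟶ Y) ≫ f := by ext; simp
    have h1 : T' (g ≫ f.left) q (by simp [h]) (𝟙 Z) := by
      refine (Sieve.overEquiv_iff (Y := Over.mk q) _ (𝟙 Z)).2 ?_
      exact hT_congr (by ext; simp) (T.downward_closed hf'
        (Over.homMk (𝟙 Z) : Over.mk (𝟙 Z ≫ q) ⟶ Over.mk q))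
    have h2 := hval (g ≫ f.left) q (by simp [h]) hq (𝟙 Z) h1 q (Category.id_comp q) hq
    rw [V.map_id, hy' _ _ _ hf' e, ← hy f hf, restr_val] at h2
    exact h2.trans (val_congr _ (by simp) _ _)

/-- The action on families is free and transitive: the sections of `A` that relate the values of two
families glue, since the sieve is covering. -/
lemma existsUnique_act (hR : R ∈ J S) {X : Over S} (s t : V.Family X) :
    ∃! a : gsec A X.left, s.act a = t := by
  have hR' : R.pullback X.hom ∈ J X.left := J.pullback_stable _ hR
  have huniq : ∀ a b : gsec A X.left, s.act a = s.act b → a = b := by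
    intro a b hab
    refine sec_ext (usheaf A) hR' fun Y g hg => ?_
    exact (V.existsUnique_act (s.val g _ rfl hg) _).unique rfl
      (congrArg (fun s => s.val g _ rfl hg) hab).symm
  choose a ha ha' using fun (Y : C) (g : Y ⟶ X.left) (hg : R.pullback X.hom g) =>
    V.existsUnique_act (s.val g _ rfl hg) (t.val g _ rfl hg)
  obtain ⟨b, hb⟩ := sec_glue (usheaf A) hR' a (fun Y Z g hg k => ha' Z (k ≫ g) _
    (gres A k (a Y g hg)) (by
    have hk : R ((k ≫ g) ≫ X.hom) := (R.pullback X.hom).downward_closed hg k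
    have h : k ≫ g ≫ X.hom = (k ≫ g) ≫ X.hom := (Category.assoc _ _ _).symm
    refine (congrArg (V.act · _) (s.res_val g _ rfl hg k _ h hk)).symm.trans ?_
    refine (V.map_act (hq' := hk) k h (s.val g _ rfl hg) (a Y g hg)).symm.trans ?_
    exact (congrArg (V.map (hq' := hk) k h) (ha Y g hg)).trans (t.res_val g _ rfl hg k _ h hk)))
  have hst : s.act b = t := ext_val fun Y g q h hq => by
    subst h
    exact (congrArg (V.act (s.val g _ rfl hq)) (hb g hq)).trans (ha Y g hq)
  exact ⟨b, hst, fun c hc => huniq c b (hc.trans hst.symm)⟩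

/-- The families form a small set: they are determined by their values at the arrows whose sources
belong to a small family of topological generators. -/
instance small [HasSmallGenerators.{w} J] (X : Over S) : Small.{w} (V.Family X) := by
  obtain ⟨ι, U, hU⟩ := HasSmallGenerators.exists_generators (J := J)
  let β : Type w := ∀ (i : ι) (g : U i ⟶ X.left) (hq : R (g ≫ X.hom)), V.obj (g ≫ X.hom) hq
  refine small_of_injective (β := β) (f := fun s i g hq => s.val g _ rfl hq) fun s t hst => ?_
  have key : ∀ (i : ι) (g : U i ⟶ X.left) (q : U i ⟶ S) (h : g ≫ X.hom = q) (hq : R q),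
      s.val g q h hq = t.val g q h hq := by
    rintro i g _ rfl hq
    exact congrFun (congrFun (congrFun hst i) g) hq
  refine ext_val fun Y g q h hq => V.ext (hU Y) ?_
  rintro Z _ ⟨_, l, _, ⟨i⟩, rfl⟩
  have hi : R (i.2 ≫ q) := R.downward_closed hq _
  have e := congrArg (V.map (hq' := by rw [Category.assoc]; exact R.downward_closed hi l) l
    (Category.assoc l i.2 q).symm) (key i.1 (i.2 ≫ g) (i.2 ≫ q) (by rw [Category.assoc, h]) hi)
  rw [← s.res_val g q h hq i.2 _ rfl, ← t.res_val g q h hq i.2 _ rfl, V.map_map, V.map_map] at e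
  exact e

end Family

variable [HasSmallGenerators.{w} J]

/-- The presheaf of families, reduced to the universe of the coefficients. -/
noncomputable def presheaf : (Over S)ᵒᵖ ⥤ Type w where
  obj X := Shrink.{w} (V.Family X.unop)
  map f := ↾fun s => equivShrink _ (((equivShrink _).symm s).restr f.unop)
  map_id X := by
    refine ConcreteCategory.hom_ext _ _ fun s => ?_
    refine (Equiv.eq_symm_apply _).1 (Family.ext_val fun Y g q h hq => ?_)
    exact Family.val_congr _ (Category.comp_id g) _ _
  map_comp f g := by
    refine ConcreteCategory.hom_ext _ _ fun s => ?_
    refine congrArg (equivShrink _) (Family.ext_val fun Y g q h hq => ?_)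
    refine Eq.trans ?_ (congrArg (fun t => (Family.restr _ t).val _ q h hq)
      ((equivShrink _).symm_apply_apply _)).symm
    exact Family.val_congr _ (Category.assoc _ _ _).symm _ _

lemma isSheaf_presheaf : Presheaf.IsSheaf (J.over S) V.presheaf := by
  rw [isSheaf_iff_isSheaf_of_type]
  intro X T hT x hx
  have hx' := (Presieve.compatible_iff_sieveCompatible x).1 hx
  obtain ⟨s, hs⟩ := Family.glue hT (fun Y f hf => (equivShrink (V.Family Y)).symm (x f hf))
    (fun Y Z f hf g => ((equivShrink _).eq_symm_apply).2 (hx' f g hf).symm)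
  refine ⟨equivShrink _ s, fun Y f hf => ?_, fun t ht => ?_⟩
  · refine (congrArg (fun t => equivShrink _ (Family.restr f t))
      ((equivShrink _).symm_apply_apply s)).trans ?_
    rw [hs f hf]
    exact (equivShrink _).apply_symm_apply _
  · refine ((equivShrink _).symm_apply_eq).1 (Family.ext_of_cover hT fun Y f hf => ?_)
    rw [hs f hf]
    exact ((equivShrink _).eq_symm_apply).2 (ht f hf)

/-- The sheaf of families. -/
noncomputable def sheaf : Sheaf (J.over S) (Type w) := ⟨V.presheaf, V.isSheaf_presheaf⟩

/-- The family corresponding to a section of the sheaf of families. -/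
noncomputable def family {X : Over S} : sec V.sheaf X ≃ V.Family X :=
  (equivShrink (V.Family X)).symm

lemma family_res {X Y : Over S} (f : Y ⟶ X) (p : sec V.sheaf X) :
    V.family (res V.sheaf f p) = (V.family p).restr f :=
  (equivShrink (V.Family Y)).symm_apply_apply _

/-- The torsor over `S` obtained by gluing, for a covering sieve. -/
noncomputable def glued (hR : R ∈ J S) : Torsor A S where
  sheaf := V.sheaf
  act {X} p a := V.family.symm ((V.family p).act a)
  act_one p := V.family.symm_apply_eq.2 (Family.ext_val fun Y g q h hq =>
    (congrArg _ (map_one (gres A g))).trans (V.act_one _))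
  act_mul p a b := congrArg V.family.symm (Family.ext_val fun Y g q h hq => by
    rw [Equiv.apply_symm_apply]
    exact (congrArg _ (map_mul (gres A g) a b)).trans (V.act_mul _ _ _))
  res_act {X Y} f p a := V.family.injective (by
    rw [family_res, Equiv.apply_symm_apply, Equiv.apply_symm_apply, family_res]
    refine Family.ext_val fun Y g q h hq => ?_
    exact congrArg (V.act _) (gres_comp A f.left g a))
  existsUnique_act p q := by
    simpa only [Equiv.symm_apply_eq] using Family.existsUnique_act hR (V.family p) (V.family q)
  locally_nonempty X := by
    -- The arrows to `X` over which `V` is defined and has a section.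
    let T : Sieve X.left :=
      { arrows := fun Y k => ∃ h : R (k ≫ X.hom), Nonempty (V.obj (k ≫ X.hom) h)
        downward_closed := by
          rintro Y Z k ⟨h, ⟨p⟩⟩ l
          exact ⟨by rw [Category.assoc]; exact R.downward_closed h l,
            ⟨V.map l (Category.assoc _ _ _).symm p⟩⟩ }
    have hT : T ∈ J X.left := by
      refine J.transitive (J.pullback_stable X.hom hR) _ fun Y k hk => ?_
      obtain ⟨T', hT', hV⟩ := V.locally_nonempty (k ≫ X.hom) hk
      refine J.superset_covering (fun Z l hl => ?_) hT'
      obtain ⟨p⟩ := hV l hl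
      exact ⟨by rw [Category.assoc]; exact R.downward_closed hk l,
        ⟨V.map (𝟙 Z) (by simp) p⟩⟩
    refine ⟨_, J.overEquiv_symm_mem_over X T hT, ?_⟩
    rintro Y f ⟨h, ⟨p⟩⟩
    have hY : R Y.hom := by rw [← Over.w f]; exact h
    exact ⟨V.family.symm (Family.ofSec hY (V.map (𝟙 _) (by simp) p))⟩

lemma family_act (hR : R ∈ J S) {X : Over S} (p : sec V.sheaf X) (a : gsec A X.left) :
    V.family ((V.glued hR).act p a) = (V.family p).act a :=
  Equiv.apply_symm_apply _ _

end SieveTorsor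

/-! ### Descent of morphisms of torsors -/

lemma pullEval_congr {A : Sheaf J GrpCat.{w}} {S₁ S₂ T U : C} {P : Torsor A S₁} {Q : Torsor A S₂}
    {f₁ : T ⟶ S₁} {f₂ : T ⟶ S₂} (φ : P.restrict f₁ ⟶ Q.restrict f₂) {a b : U ⟶ T} (e : a = b)
    {y : U ⟶ S₁} {z : U ⟶ S₂} (hy : a ≫ f₁ = y) (hz : a ≫ f₂ = z) (p : sec P.sheaf (Over.mk y)) :
    pullEval φ a hy hz p = pullEval φ b (e ▸ hy) (e ▸ hz) p := by
  subst e
  rfl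

section Prestack

variable {A : Sheaf J GrpCat.{w}} {S : C} {R : Sieve S}

/-- Morphisms of torsors agree if their restrictions along the arrows of a covering sieve agree. -/
lemma torsor_hom_ext_of_cover (hR : R ∈ J S) {P Q : Torsor A S} {m n : P ⟶ Q}
    (e : ∀ ⦃T : C⦄ (f : T ⟶ S), R f →
      (Torsor.restrictFunctor A f).map m = (Torsor.restrictFunctor A f).map n) : m = n := by
  refine Torsor.hom_ext fun X p => ?_
  refine hres_ext Q.sheaf (y := X.hom) (J.pullback_stable X.hom hR) fun T g hg => ?_
  refine (Torsor.hres_app m (y := X.hom) g rfl p).trans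
    (Eq.trans ?_ (Torsor.hres_app n (y := X.hom) g rfl p).symm)
  rw [← pullEval_restrictFunctor_map (f₁ := g ≫ X.hom) m (𝟙 T) (Category.id_comp _),
    ← pullEval_restrictFunctor_map (f₁ := g ≫ X.hom) n (𝟙 T) (Category.id_comp _), e _ hg]

/-- Gluing of morphisms of torsors: `φ q` is the map from the sections of `P` over `q` to the
sections of `Q` over `q`, given for all `q` in a covering sieve. -/
lemma exists_torsor_hom_of_cover (hR : R ∈ J S) (P Q : Torsor A S)
    (φ : ∀ ⦃T : C⦄ (q : T ⟶ S), R q → sec P.sheaf (Over.mk q) → sec Q.sheaf (Over.mk q))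
    (hφ : ∀ ⦃T U : C⦄ (q : T ⟶ S) (hq : R q) (g : U ⟶ T) (q' : U ⟶ S) (h : g ≫ q = q') (hq' : R q')
      (p : sec P.sheaf (Over.mk q)), hres Q.sheaf g h (φ q hq p) = φ q' hq' (hres P.sheaf g h p))
    (hφ' : ∀ ⦃T : C⦄ (q : T ⟶ S) (hq : R q) (p : sec P.sheaf (Over.mk q)) (a : gsec A T),
      φ q hq (P.act (X := Over.mk q) p a) = Q.act (X := Over.mk q) (φ q hq p) a) :
    ∃ m : P ⟶ Q, ∀ ⦃T : C⦄ (q : T ⟶ S) (hq : R q) (p : sec P.sheaf (Over.mk q)),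
      Torsor.app m (Over.mk q) p = φ q hq p := by
  -- The image of `p` is glued from the images of its restrictions to the arrows of the sieve.
  have key : ∀ {T : C} (q : T ⟶ S) (p : sec P.sheaf (Over.mk q)), ∃ x : sec Q.sheaf (Over.mk q),
      ∀ ⦃U : C⦄ (g : U ⟶ T) (q' : U ⟶ S) (h : g ≫ q = q') (hq' : R q'),
        hres Q.sheaf g h x = φ q' hq' (hres P.sheaf g h p) := by
    intro T q p
    obtain ⟨x, hx⟩ := hres_glue Q.sheaf (y := q) (J.pullback_stable q hR)
      (fun U g z h hg => φ z (by rw [← h]; exact hg) (hres P.sheaf g h p))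
      (fun U W g z h hg k => by
        rw [hφ _ _ _ _ _ (R.downward_closed (by rw [← h]; exact hg) k), hres_hres])
    exact ⟨x, fun U g q' h hq' => hx g q' h (show R (g ≫ q) by rw [h]; exact hq')⟩
  choose x hx using @key
  refine ⟨⟨fun X p => x X.hom p, fun {X Y} f p => ?_, fun {X} p a => ?_⟩, fun T q hq p => ?_⟩
  · refine hres_ext Q.sheaf (y := Y.hom) (J.pullback_stable Y.hom hR) fun T g hg => ?_
    rw [hx _ _ _ _ _ hg]
    refine (hres_hres Q.sheaf (x := X.hom) (y := Y.hom) f.left (Over.w f) g rfl _).trans ?_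
    rw [hx _ _ _ _ _ hg]
    exact congrArg _ (hres_hres P.sheaf (x := X.hom) (y := Y.hom) f.left (Over.w f) g rfl _).symm
  · refine hres_ext Q.sheaf (y := X.hom) (J.pullback_stable X.hom hR) fun T g hg => ?_
    rw [hx _ _ _ _ _ hg]
    refine Eq.trans ?_ (Torsor.hres_act Q (y := X.hom) g rfl _ a).symm
    rw [hx _ _ _ _ _ hg]
    exact (congrArg _ (Torsor.hres_act P (y := X.hom) g rfl p a)).trans (hφ' (g ≫ X.hom) hg _ _)
  · have := hx q p (𝟙 T) q (Category.id_comp q) hq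
    rw [hres_id, hres_id] at this
    exact this

/-- The morphism of torsors over the source of `q` which is part of a morphism between the descent
data of two torsors over `S`. -/
def descHom {P Q : Torsor A S}
    (h : ((torsc A).toDescentData (fun i : R.arrows.category => i.obj.hom)).obj P ⟶
      ((torsc A).toDescentData (fun i : R.arrows.category => i.obj.hom)).obj Q)
    {T : C} (q : T ⟶ S) (hq : R q) : P.restrict q ⟶ Q.restrict q :=
  Pseudofunctor.DescentData.Hom.hom h (⟨Over.mk q, hq⟩ : R.arrows.category)

/-- The components of a morphism of descent data are compatible with base change: on the sections
over `g ≫ q = q'`, the component at `q` agrees with the component at `q'`. -/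
lemma pullEval_descHom {P Q : Torsor A S}
    (h : ((torsc A).toDescentData (fun i : R.arrows.category => i.obj.hom)).obj P ⟶
      ((torsc A).toDescentData (fun i : R.arrows.category => i.obj.hom)).obj Q)
    {T U : C} (q : T ⟶ S) (hq : R q) (g : U ⟶ T) (q' : U ⟶ S) (e : g ≫ q = q') (hq' : R q')
    (p : sec P.sheaf (Over.mk q')) :
    pullEval (descHom h q hq) g e e p =
      pullEval (descHom h q' hq') (𝟙 U) (Category.id_comp q') (Category.id_comp q') p := by
  have hg : q' = (𝟙 U ≫ g) ≫ q := by simp [e]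
  have hg' : 𝟙 U ≫ q' = (𝟙 U ≫ 𝟙 U) ≫ q' := by simp
  -- The compatibility of `h` with the descent data, evaluated at `p`: the coherence isomorphisms
  -- act on sections by `ocast`, and the remaining factors are the two sides of the claim.
  have comm := congrArg (fun m : (P.restrict q).restrict g ⟶ (Q.restrict q').restrict (𝟙 U) =>
      Torsor.app m (Over.mk (𝟙 U)) (ocast P.sheaf hg p))
    (Pseudofunctor.DescentData.Hom.comm h q' (i₁ := ⟨Over.mk q, hq⟩) (i₂ := ⟨Over.mk q', hq'⟩)
      g (𝟙 U) e (Category.id_comp q'))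
  have c1 := pullComp_torsc_inv_app e P (Over.mk (𝟙 U)) (ocast P.sheaf hg p)
  have c2 := pullComp_torsc_hom_app (Category.id_comp q') P (Over.mk (𝟙 U))
    (ocast (x := (𝟙 U ≫ g) ≫ q) (y := 𝟙 U ≫ q') P.sheaf (by simp [e]) (ocast P.sheaf hg p))
  have c3 := pullComp_torsc_inv_app e Q (Over.mk (𝟙 U))
    (Torsor.app (descHom h q hq) (Over.mk (𝟙 U ≫ g)) (ocast P.sheaf hg p))
  have c4 := pullComp_torsc_hom_app (Category.id_comp q') Q (Over.mk (𝟙 U))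
    (ocast (x := (𝟙 U ≫ g) ≫ q) (y := 𝟙 U ≫ q') Q.sheaf (by simp [e])
      (Torsor.app (descHom h q hq) (Over.mk (𝟙 U ≫ g)) (ocast P.sheaf hg p)))
  rw [pullEval_congr _ (Category.id_comp g).symm, pullEval_congr (descHom h q' hq')
    (Category.id_comp (𝟙 U)).symm]
  have hl : Torsor.app (P := (P.restrict q).restrict g) (Q := (Q.restrict q').restrict (𝟙 U))
      ((torsc A |>.map g.op.toLoc).toFunctor.map (descHom h q hq) ≫
        (((torsc A).toDescentData (fun i : R.arrows.category => i.obj.hom)).obj Q).hom q'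
          (i₁ := ⟨Over.mk q, hq⟩) (i₂ := ⟨Over.mk q', hq'⟩) g (𝟙 U) e (Category.id_comp q'))
      (Over.mk (𝟙 U)) (ocast P.sheaf hg p) = _ :=
    (congrArg (Torsor.app (P := Q.restrict q') (Q := (Q.restrict q').restrict (𝟙 U))
      (pullComp (torsc A) (Category.id_comp q') Q).hom (Over.mk (𝟙 U))) c3).trans c4
  have hr := congrArg (Torsor.app (descHom h q' hq') (Over.mk (𝟙 U ≫ 𝟙 U)))
    ((congrArg (Torsor.app (P := P.restrict q') (Q := (P.restrict q').restrict (𝟙 U))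
      (pullComp (torsc A) (Category.id_comp q') P).hom (Over.mk (𝟙 U))) c1).trans c2)
  have key := hl.symm.trans (comm.trans hr)
  have key' := congrArg (ocast (x := (𝟙 U ≫ 𝟙 U) ≫ q') (y := q') Q.sheaf (by simp)) key
  refine (ocast_ocast3 (x := (𝟙 U ≫ g) ≫ q) (y := 𝟙 U ≫ q') (z := (𝟙 U ≫ 𝟙 U) ≫ q') (t := q')
    Q.sheaf (by simp [e]) (by simp) (by simp) _).symm.trans (key'.trans ?_)
  refine congrArg (fun x => ocast (x := (𝟙 U ≫ 𝟙 U) ≫ q') (y := q') Q.sheaf (by simp)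
    (Torsor.app (descHom h q' hq') (Over.mk (𝟙 U ≫ 𝟙 U)) x)) ?_
  rw [ocast_ocast, ocast_ocast]
  rfl

/-- Morphisms of torsors satisfy descent. -/
lemma isPrestackFor_torsc (hR : R ∈ J S) : (torsc A).IsPrestackFor R.arrows := by
  rw [Pseudofunctor.isPrestackFor_iff, Functor.FullyFaithful.nonempty_iff_map_bijective]
  intro P Q
  refine ⟨fun m n h => ?_, fun h => ?_⟩
  · exact torsor_hom_ext_of_cover (P := P) (Q := Q) hR fun T f hf =>
      congrArg (fun k => Pseudofunctor.DescentData.Hom.hom k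
        (⟨Over.mk f, hf⟩ : R.arrows.category)) h
  · obtain ⟨m, hm⟩ := exists_torsor_hom_of_cover hR P Q
      (fun T q hq p => pullEval (descHom h q hq) (𝟙 T) (Category.id_comp q) (Category.id_comp q) p)
      (fun T U q hq g q' e hq' p => by
        exact (hres_pullEval (P := P) (Q := Q) (descHom h q hq) (𝟙 T) _ _ g e e p).trans
          ((pullEval_congr (P := P) (Q := Q) (descHom h q hq) (Category.comp_id g) _ _ _).trans
            (pullEval_descHom (P := P) (Q := Q) h q hq g q' e hq' _)))
      (fun T q hq p a => pullEval_act _ _ _ _ p a)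
    refine ⟨m, ?_⟩
    refine Pseudofunctor.DescentData.hom_ext fun i => ?_
    refine Torsor.hom_ext (P := P.restrict i.obj.hom) (Q := Q.restrict i.obj.hom) fun Z p => ?_
    have hZ : R (Z.hom ≫ i.obj.hom) := R.downward_closed i.property Z.hom
    refine (hm (Z.hom ≫ i.obj.hom) hZ p).trans ?_
    exact (pullEval_descHom (P := P) (Q := Q) h i.obj.hom i.property Z.hom _ rfl hZ p).symm.trans
      (pullEval_rfl _ _ _)

lemma isPrestack_torsc (A : Sheaf J GrpCat.{w}) : (torsc A).IsPrestack J :=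
  .of_isPrestackFor fun _ _ hR => isPrestackFor_torsc hR

end Prestack

/-! ### Transition maps of a descent datum -/

section Descent

variable {A : Sheaf J GrpCat.{w}} {S : C} {ι : Type*} {X : ι → C} {f : ∀ i, X i ⟶ S}
  (D : (torsc A).DescentData f)

/-- The torsor over `X i` of a descent datum. -/
def descObj (i : ι) : Torsor A (X i) := D.obj i

/-- The transition map of a descent datum, from the sections over `f₁ : Y ⟶ X i₁` to the sections
over `f₂ : Y ⟶ X i₂`. -/
def descMap {Y : C} (q : Y ⟶ S) {i₁ i₂ : ι} (f₁ : Y ⟶ X i₁) (f₂ : Y ⟶ X i₂)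
    (h₁ : f₁ ≫ f i₁ = q) (h₂ : f₂ ≫ f i₂ = q) (p : sec (descObj D i₁).sheaf (Over.mk f₁)) :
    sec (descObj D i₂).sheaf (Over.mk f₂) :=
  pullEval (P := descObj D i₁) (Q := descObj D i₂) (D.hom q f₁ f₂ h₁ h₂) (𝟙 Y)
    (Category.id_comp f₁) (Category.id_comp f₂) p

/-- The isomorphisms of a descent datum are determined by the transition maps `descMap`. -/
lemma pullEval_hom {Y Z : C} (q : Y ⟶ S) {i₁ i₂ : ι} (f₁ : Y ⟶ X i₁) (f₂ : Y ⟶ X i₂)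
    (h₁ : f₁ ≫ f i₁ = q) (h₂ : f₂ ≫ f i₂ = q) (g : Z ⟶ Y) (q' : Z ⟶ S) (hq' : g ≫ q = q')
    {y : Z ⟶ X i₁} {z : Z ⟶ X i₂} (hy : g ≫ f₁ = y) (hz : g ≫ f₂ = z)
    (p : sec (descObj D i₁).sheaf (Over.mk y)) :
    pullEval (P := descObj D i₁) (Q := descObj D i₂) (D.hom q f₁ f₂ h₁ h₂) g hy hz p =
      descMap D q' y z (by rw [← hy, Category.assoc, h₁, hq'])
        (by rw [← hz, Category.assoc, h₂, hq']) p := by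
  have e := pullEval_pullHom (P := descObj D i₁) (Q := descObj D i₂) (D.hom q f₁ f₂ h₁ h₂) g y z
    hy hz (𝟙 Z) (Category.id_comp y) (Category.id_comp z) p
  refine (pullEval_congr (P := descObj D i₁) (Q := descObj D i₂) (D.hom q f₁ f₂ h₁ h₂)
    (Category.id_comp g).symm hy hz p).trans (e.symm.trans ?_)
  exact congrArg (fun m : (descObj D i₁).restrict y ⟶ (descObj D i₂).restrict z =>
    pullEval m (𝟙 Z) (Category.id_comp y) (Category.id_comp z) p)
    (D.pullHom_hom g q q' hq' f₁ f₂ h₁ h₂ y z hy hz)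

lemma hres_descMap {Y Z : C} (q : Y ⟶ S) {i₁ i₂ : ι} (f₁ : Y ⟶ X i₁) (f₂ : Y ⟶ X i₂)
    (h₁ : f₁ ≫ f i₁ = q) (h₂ : f₂ ≫ f i₂ = q) (g : Z ⟶ Y) (q' : Z ⟶ S) (hq' : g ≫ q = q')
    {y : Z ⟶ X i₁} {z : Z ⟶ X i₂} (hy : g ≫ f₁ = y) (hz : g ≫ f₂ = z)
    (p : sec (descObj D i₁).sheaf (Over.mk f₁)) :
    hres (descObj D i₂).sheaf g hz (descMap D q f₁ f₂ h₁ h₂ p) =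
      descMap D q' y z (by rw [← hy, Category.assoc, h₁, hq'])
        (by rw [← hz, Category.assoc, h₂, hq']) (hres (descObj D i₁).sheaf g hy p) := by
  rw [← pullEval_hom D q f₁ f₂ h₁ h₂ g q' hq' hy hz]
  refine (hres_pullEval (P := descObj D i₁) (Q := descObj D i₂) (D.hom q f₁ f₂ h₁ h₂) (𝟙 Y)
    (Category.id_comp f₁) (Category.id_comp f₂) g hy hz p).trans ?_
  congr 1
  simp

lemma descMap_act {Y : C} (q : Y ⟶ S) {i₁ i₂ : ι} (f₁ : Y ⟶ X i₁) (f₂ : Y ⟶ X i₂)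
    (h₁ : f₁ ≫ f i₁ = q) (h₂ : f₂ ≫ f i₂ = q) (p : sec (descObj D i₁).sheaf (Over.mk f₁))
    (a : gsec A Y) : descMap D q f₁ f₂ h₁ h₂ ((descObj D i₁).act (X := Over.mk f₁) p a) =
      (descObj D i₂).act (X := Over.mk f₂) (descMap D q f₁ f₂ h₁ h₂ p) a :=
  pullEval_act (P := descObj D i₁) (Q := descObj D i₂) _ _ _ _ p a

lemma descMap_self {Y : C} (q : Y ⟶ S) {i : ι} (f₁ : Y ⟶ X i) (h₁ : f₁ ≫ f i = q)
    (p : sec (descObj D i).sheaf (Over.mk f₁)) : descMap D q f₁ f₁ h₁ h₁ p = p :=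
  (congrArg (fun m : (descObj D i).restrict f₁ ⟶ (descObj D i).restrict f₁ =>
    pullEval m (𝟙 Y) (Category.id_comp f₁) (Category.id_comp f₁) p) (D.hom_self q f₁ h₁)).trans
    (pullEval_id (P := descObj D i) (f₁ := f₁) _ _ p)

/-- The cocycle condition. -/
lemma descMap_descMap {Y : C} (q : Y ⟶ S) {i₁ i₂ i₃ : ι} (f₁ : Y ⟶ X i₁) (f₂ : Y ⟶ X i₂)
    (f₃ : Y ⟶ X i₃) (h₁ : f₁ ≫ f i₁ = q) (h₂ : f₂ ≫ f i₂ = q) (h₃ : f₃ ≫ f i₃ = q)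
    (p : sec (descObj D i₁).sheaf (Over.mk f₁)) :
    descMap D q f₂ f₃ h₂ h₃ (descMap D q f₁ f₂ h₁ h₂ p) = descMap D q f₁ f₃ h₁ h₃ p :=
  (pullEval_comp (P := descObj D i₁) (Q := descObj D i₂) (R := descObj D i₃)
    (D.hom q f₁ f₂ h₁ h₂) (D.hom q f₂ f₃ h₂ h₃) (𝟙 Y) _ _ _ p).symm.trans
    (congrArg (fun m : (descObj D i₁).restrict f₁ ⟶ (descObj D i₃).restrict f₃ =>
      pullEval m (𝟙 Y) (Category.id_comp f₁) (Category.id_comp f₃) p)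
      (D.hom_comp q f₁ f₂ f₃ h₁ h₂ h₃))

end Descent

/-! ### Effective descent for torsors -/

section Effective

variable {A : Sheaf J GrpCat.{w}} {S : C} {R : Sieve S}

/-- An arrow of the sieve `R`, as an index of a descent datum. -/
abbrev arrowIdx {Y : C} (q : Y ⟶ S) (hq : R q) : R.arrows.category := ⟨Over.mk q, hq⟩

variable (D : (torsc A).DescentData (fun i : R.arrows.category => i.obj.hom))

/-- The restriction map of the torsor over a sieve defined by a descent datum. -/
def sieveMap {Y Z : C} {q : Y ⟶ S} {q' : Z ⟶ S} (hq : R q) (hq' : R q') (g : Z ⟶ Y)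
    (h : g ≫ q = q') (p : sec (descObj D (arrowIdx q hq)).sheaf (Over.mk (𝟙 Y))) :
    sec (descObj D (arrowIdx q' hq')).sheaf (Over.mk (𝟙 Z)) :=
  descMap D q' (i₁ := arrowIdx q hq) (i₂ := arrowIdx q' hq') g (𝟙 Z) h (Category.id_comp q')
    (hres _ g (Category.comp_id g) p)

lemma sieveMap_id {Y : C} {q : Y ⟶ S} (hq : R q) (h : 𝟙 Y ≫ q = q)
    (p : sec (descObj D (arrowIdx q hq)).sheaf (Over.mk (𝟙 Y))) :
    sieveMap D hq hq (𝟙 Y) h p = p :=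
  (descMap_self D q (i := arrowIdx q hq) (𝟙 Y) h _).trans (hres_id _ _ p)

/-- Transition maps absorb the restriction maps of the torsor over the sieve. -/
lemma descMap_sieveMap {Y Z : C} {q : Y ⟶ S} {q' : Z ⟶ S} (hq : R q) (hq' : R q') (g : Z ⟶ Y)
    (h : g ≫ q = q') (i : R.arrows.category) (f : Z ⟶ i.obj.left) (hf : f ≫ i.obj.hom = q')
    (p : sec (descObj D (arrowIdx q hq)).sheaf (Over.mk (𝟙 Y))) :
    descMap D q' (i₁ := arrowIdx q' hq') (𝟙 Z) f (Category.id_comp q') hf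
      (sieveMap D hq hq' g h p) =
      descMap D q' (i₁ := arrowIdx q hq) g f h hf (hres _ g (Category.comp_id g) p) :=
  descMap_descMap D q' (i₁ := arrowIdx q hq) (i₂ := arrowIdx q' hq') g (𝟙 Z) f h _ hf _

lemma sieveMap_sieveMap {X Y Z : C} {q : X ⟶ S} {q' : Y ⟶ S} {q'' : Z ⟶ S} (hq : R q)
    (hq' : R q') (hq'' : R q'') (f : Y ⟶ X) (h : f ≫ q = q') (g : Z ⟶ Y) (h' : g ≫ q' = q'')
    (p : sec (descObj D (arrowIdx q hq)).sheaf (Over.mk (𝟙 X))) :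
    sieveMap D hq' hq'' g h' (sieveMap D hq hq' f h p) =
      sieveMap D hq hq'' (g ≫ f) (by rw [Category.assoc, h, h']) p := by
  have e1 := hres_descMap D q' (i₁ := arrowIdx q hq) (i₂ := arrowIdx q' hq') f (𝟙 Y) h
    (Category.id_comp q') g q'' h' (y := g ≫ f) rfl (Category.comp_id g)
    (hres _ f (Category.comp_id f) p)
  refine (congrArg (descMap D q'' (i₁ := arrowIdx q' hq') (i₂ := arrowIdx q'' hq'') g (𝟙 Z) h'
    (Category.id_comp q'')) e1).trans ?_
  refine (descMap_descMap D q'' (i₁ := arrowIdx q hq) (i₂ := arrowIdx q' hq')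
    (i₃ := arrowIdx q'' hq'') (g ≫ f) g (𝟙 Z) _ _ _ _).trans ?_
  exact congrArg (descMap D q'' (i₁ := arrowIdx q hq) (i₂ := arrowIdx q'' hq'') (g ≫ f) (𝟙 Z) _ _)
    (hres_hres _ f _ g rfl p)

lemma sieveMap_act {Y Z : C} {q : Y ⟶ S} {q' : Z ⟶ S} (hq : R q) (hq' : R q') (g : Z ⟶ Y)
    (h : g ≫ q = q') (p : sec (descObj D (arrowIdx q hq)).sheaf (Over.mk (𝟙 Y)))
    (a : gsec A Y) :
    sieveMap D hq hq' g h ((descObj D (arrowIdx q hq)).act (X := Over.mk (𝟙 Y)) p a) =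
      (descObj D (arrowIdx q' hq')).act (X := Over.mk (𝟙 Z)) (sieveMap D hq hq' g h p)
        (gres A g a) :=
  (congrArg (descMap D q' (i₁ := arrowIdx q hq) (i₂ := arrowIdx q' hq') g (𝟙 Z) h _)
    (Torsor.hres_act _ g (Category.comp_id g) p a)).trans
    (descMap_act D q' (i₁ := arrowIdx q hq) (i₂ := arrowIdx q' hq') g (𝟙 Z) h _ _ _)

lemma sieveMap_ext {Y : C} {q : Y ⟶ S} (hq : R q) {T : Sieve Y} (hT : T ∈ J Y)
    {p p' : sec (descObj D (arrowIdx q hq)).sheaf (Over.mk (𝟙 Y))}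
    (e : ∀ ⦃Z : C⦄ (g : Z ⟶ Y), T g →
      sieveMap D hq (R.downward_closed hq g) g rfl p = sieveMap D hq _ g rfl p') : p = p' := by
  refine hres_ext _ hT fun Z g hg => hres_eq_of_hres_eq _ (Category.comp_id g) _ ?_
  have h := congrArg (descMap D (g ≫ q) (i₁ := arrowIdx (g ≫ q) (R.downward_closed hq g))
    (i₂ := arrowIdx q hq) (𝟙 Z) g (Category.id_comp _) rfl) (e g hg)
  rw [descMap_sieveMap, descMap_sieveMap] at h
  exact (descMap_self D (i := arrowIdx q hq) _ _ _ _).symm.trans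
    (h.trans (descMap_self D (i := arrowIdx q hq) _ _ _ _))

lemma sieveMap_glue {Y : C} {q : Y ⟶ S} (hq : R q) {T : Sieve Y} (hT : T ∈ J Y)
    (x : ∀ ⦃Z : C⦄ (g : Z ⟶ Y), T g →
      sec (descObj D (arrowIdx (g ≫ q) (R.downward_closed hq g))).sheaf (Over.mk (𝟙 Z)))
    (hx : ∀ ⦃Z W : C⦄ (g : Z ⟶ Y) (hg : T g) (k : W ⟶ Z),
      sieveMap D _ (R.downward_closed hq (k ≫ g)) k (Category.assoc _ _ _).symm (x g hg) =
        x (k ≫ g) (T.downward_closed hg k)) :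
    ∃ p : sec (descObj D (arrowIdx q hq)).sheaf (Over.mk (𝟙 Y)), ∀ ⦃Z : C⦄ (g : Z ⟶ Y)
      (hg : T g), sieveMap D hq (R.downward_closed hq g) g rfl p = x g hg := by
  -- The sections `x g` are transported to the torsor with index `q`, where they glue.
  obtain ⟨p, hp⟩ := hres_glue (descObj D (arrowIdx q hq)).sheaf (y := 𝟙 Y) hT
    (fun Z g z h hg => descMap D (g ≫ q) (i₁ := arrowIdx (g ≫ q) (R.downward_closed hq g))
      (i₂ := arrowIdx q hq) (𝟙 Z) z (Category.id_comp _) (by simp [← h]) (x g hg))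
    (fun Z W g z h hg k => by
      have e := congrArg (descMap D ((k ≫ g) ≫ q)
        (i₁ := arrowIdx ((k ≫ g) ≫ q) (R.downward_closed hq _))
        (i₂ := arrowIdx q hq) (𝟙 W) (k ≫ z) (Category.id_comp _) (by simp [← h])) (hx g hg k)
      rw [descMap_sieveMap] at e
      exact (hres_descMap D (g ≫ q) (i₁ := arrowIdx (g ≫ q) (R.downward_closed hq g))
        (i₂ := arrowIdx q hq) (𝟙 Z) z _ _ k ((k ≫ g) ≫ q) (Category.assoc _ _ _).symm
        (Category.comp_id k) rfl (x g hg)).trans e)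
  refine ⟨p, fun Z g hg => ?_⟩
  refine (congrArg (descMap D (g ≫ q) (i₁ := arrowIdx q hq)
    (i₂ := arrowIdx (g ≫ q) (R.downward_closed hq g)) g (𝟙 Z) rfl (Category.id_comp _))
    (hp g g (Category.comp_id g) hg)).trans ?_
  exact (descMap_descMap D _ _ _ _ _ _ _ _).trans (descMap_self D _ _ _ _)

lemma exists_nonempty_descObj {Y : C} (q : Y ⟶ S) (hq : R q) :
    ∃ T ∈ J Y, ∀ ⦃Z : C⦄ (g : Z ⟶ Y), T g → Nonempty
      (sec (descObj D (arrowIdx (g ≫ q) (R.downward_closed hq g))).sheaf (Over.mk (𝟙 Z))) := by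
  obtain ⟨T, hT, h⟩ := (descObj D (arrowIdx q hq)).locally_nonempty (Over.mk (𝟙 Y))
  refine ⟨Sieve.overEquiv _ T, (J.mem_over_iff _).1 hT, fun Z g hg => ?_⟩
  obtain ⟨p⟩ := h _ ((Sieve.overEquiv_iff (Y := Over.mk (𝟙 Y)) T g).1 hg)
  exact ⟨descMap D (g ≫ q) (i₁ := arrowIdx q hq) (i₂ := arrowIdx (g ≫ q) _) (g ≫ 𝟙 Y) (𝟙 Z)
    (by simp) (Category.id_comp _) p⟩

/-- The torsor over the sieve `R` defined by a descent datum: its sections over `q` are the global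
sections of the torsor of the descent datum over the source of `q`. -/
def sieveTorsor : SieveTorsor A R where
  obj {Y} q hq := sec (descObj D (arrowIdx q hq)).sheaf (Over.mk (𝟙 Y))
  map {_ _ _ _ hq hq'} g h p := sieveMap D hq hq' g h p
  map_id h p := sieveMap_id D _ h p
  map_map f h g h' p := sieveMap_sieveMap D _ _ _ f h g h' p
  act {Y q hq} p a := (descObj D (arrowIdx q hq)).act (X := Over.mk (𝟙 Y)) p a
  act_one {_ q hq} p := (descObj D (arrowIdx q hq)).act_one p
  act_mul {Y q hq} p a b := (descObj D (arrowIdx q hq)).act_mul (X := Over.mk (𝟙 Y)) p a b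
  map_act {_ _ _ _ hq hq'} g h p a := sieveMap_act D hq hq' g h p a
  existsUnique_act {_ q hq} p p' := (descObj D (arrowIdx q hq)).existsUnique_act p p'
  locally_nonempty q hq := exists_nonempty_descObj D q hq
  ext hT _ _ e := sieveMap_ext D _ hT e
  glue hT x hx := sieveMap_glue D _ hT x hx

variable [HasSmallGenerators.{w} J]

/-- The comparison map from the sections over `q` of the torsor obtained by gluing a descent datum
to the sections over `z` of its torsor with index `i`, where `z` is a lift of `q`. -/
noncomputable def gluedEval (i : R.arrows.category) {Z : C} (z : Z ⟶ i.obj.left) (q : Z ⟶ S)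
    (h : z ≫ i.obj.hom = q) (p : sec (sieveTorsor D).sheaf (Over.mk q)) :
    sec (descObj D i).sheaf (Over.mk z) :=
  descMap D q (i₁ := arrowIdx q (h ▸ R.downward_closed i.property z)) (𝟙 Z) z
    (Category.id_comp q) h (((sieveTorsor D).family p).val (𝟙 Z) q (Category.id_comp q) _)

lemma hres_gluedEval (i : R.arrows.category) {Y Z : C} (z : Z ⟶ i.obj.left) (q : Z ⟶ S)
    (h : z ≫ i.obj.hom = q) (g : Y ⟶ Z) (z' : Y ⟶ i.obj.left) (hz' : g ≫ z = z') (q' : Y ⟶ S)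
    (hq' : g ≫ q = q') (p : sec (sieveTorsor D).sheaf (Over.mk q)) :
    hres (descObj D i).sheaf g hz' (gluedEval D i z q h p) =
      gluedEval D i z' q' (by rw [← hz', Category.assoc, h, hq'])
        (hres (sieveTorsor D).sheaf g hq' p) := by
  have hRq : R q := h ▸ R.downward_closed i.property z
  have hRq' : R q' := hq' ▸ R.downward_closed hRq g
  refine (hres_descMap D q (i₁ := arrowIdx q hRq) (𝟙 Z) z _ h g q' hq' (Category.comp_id g) hz'
    _).trans ?_
  refine (descMap_sieveMap D hRq hRq' g hq' i z' _ _).symm.trans ?_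
  refine congrArg (descMap D q' (i₁ := arrowIdx q' hRq') (𝟙 Y) z' _ _) ?_
  refine (((sieveTorsor D).family p).res_val (𝟙 Z) q (Category.id_comp q) hRq g q' hq'
    hRq').trans ?_
  refine Eq.trans ?_ (congrArg (fun s => SieveTorsor.Family.val s (𝟙 Y) q' (Category.id_comp q')
    hRq') ((sieveTorsor D).family_res (Over.homMk g hq' : Over.mk q' ⟶ Over.mk q) p)).symm
  exact SieveTorsor.Family.val_congr _ (by simp) _ _

lemma gluedEval_act (hR : R ∈ J S) (i : R.arrows.category) {Z : C} (z : Z ⟶ i.obj.left)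
    (q : Z ⟶ S) (h : z ≫ i.obj.hom = q) (p : sec (sieveTorsor D).sheaf (Over.mk q))
    (a : gsec A Z) :
    gluedEval D i z q h (((sieveTorsor D).glued hR).act (X := Over.mk q) p a) =
      (descObj D i).act (X := Over.mk z) (gluedEval D i z q h p) a := by
  have hRq : R q := h ▸ R.downward_closed i.property z
  refine (congrArg (descMap D q (i₁ := arrowIdx q hRq) (𝟙 Z) z (Category.id_comp q) h) ?_).trans
    (descMap_act D q (i₁ := arrowIdx q hRq) (𝟙 Z) z (Category.id_comp q) h _ a)
  refine (congrArg (fun s => SieveTorsor.Family.val s (𝟙 Z) q (Category.id_comp q) hRq)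
    ((sieveTorsor D).family_act hR p a)).trans ?_
  exact congrArg ((sieveTorsor D).act (hq := hRq) _) (gres_id A a)

lemma gluedEval_ocast (i : R.arrows.category) {Z : C} (z : Z ⟶ i.obj.left) {q q' : Z ⟶ S}
    (e : q = q') (h : z ≫ i.obj.hom = q') (p : sec (sieveTorsor D).sheaf (Over.mk q)) :
    gluedEval D i z q' h (ocast (sieveTorsor D).sheaf e p) =
      gluedEval D i z q (h.trans e.symm) p := by
  subst e
  rw [ocast_rfl]

/-- The comparison maps are compatible with the transition maps. -/
lemma descMap_gluedEval {i₁ i₂ : R.arrows.category} {Z : C} (f₁ : Z ⟶ i₁.obj.left)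
    (f₂ : Z ⟶ i₂.obj.left) (q : Z ⟶ S) (h₁ : f₁ ≫ i₁.obj.hom = q) (h₂ : f₂ ≫ i₂.obj.hom = q)
    (p : sec (sieveTorsor D).sheaf (Over.mk q)) :
    descMap D q f₁ f₂ h₁ h₂ (gluedEval D i₁ f₁ q h₁ p) = gluedEval D i₂ f₂ q h₂ p :=
  descMap_descMap D q _ _ _ _ _ _ _

/-- The comparison between the inverse image of the torsor obtained by gluing a descent datum and
the torsor of the descent datum. -/
noncomputable def gluedHom (hR : R ∈ J S) (i : R.arrows.category) :
    ((sieveTorsor D).glued hR).restrict i.obj.hom ⟶ descObj D i :=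
  ⟨fun Z p => gluedEval D i Z.hom _ rfl p,
    fun {Y Z} f p => hres_gluedEval D i Y.hom _ rfl f.left Z.hom (Over.w f) _
      (by rw [← Category.assoc, Over.w f]) p,
    fun {X} p a => gluedEval_act D hR i X.hom _ rfl p a⟩

/-- The descent datum of the torsor obtained by gluing is the given one. -/
noncomputable def toDescentDataGluedIso (hR : R ∈ J S) :
    ((torsc A).toDescentData (fun i : R.arrows.category => i.obj.hom)).obj
      ((sieveTorsor D).glued hR) ≅ D :=
  Pseudofunctor.DescentData.isoMk
    (fun i => Torsor.isoOfHom (P := ((sieveTorsor D).glued hR).restrict i.obj.hom)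
      (Q := descObj D i) (gluedHom D hR i))
    (fun Y q i₁ i₂ f₁ f₂ h₁ h₂ => by
      refine Torsor.hom_ext (P := (((sieveTorsor D).glued hR).restrict i₁.obj.hom).restrict f₁)
        (Q := (descObj D i₂).restrict f₂) fun X p => ?_
      have e : (X.hom ≫ f₂) ≫ i₂.obj.hom = (X.hom ≫ f₁) ≫ i₁.obj.hom := by
        rw [Category.assoc, h₂, Category.assoc, h₁]
      have c1 := pullComp_torsc_inv_app h₁ ((sieveTorsor D).glued hR) X p
      have c2 := pullComp_torsc_hom_app h₂ ((sieveTorsor D).glued hR) X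
        (ocast (x := (X.hom ≫ f₁) ≫ i₁.obj.hom) (y := X.hom ≫ q) (sieveTorsor D).sheaf
          (by rw [Category.assoc, h₁]) p)
      have hr := (congrArg (Torsor.app (P := ((sieveTorsor D).glued hR).restrict q)
        (Q := (((sieveTorsor D).glued hR).restrict i₂.obj.hom).restrict f₂)
        (pullComp (torsc A) h₂ ((sieveTorsor D).glued hR)).hom X) c1).trans
        (c2.trans (ocast_ocast _ _ _ _))
      -- Both composites are the comparison map with index `i₂`.
      have hl : Torsor.app (P := (descObj D i₁).restrict f₁) (Q := (descObj D i₂).restrict f₂)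
          (D.hom q f₁ f₂ h₁ h₂) X (gluedEval D i₁ (X.hom ≫ f₁) _ rfl p) =
          gluedEval D i₂ (X.hom ≫ f₂) _ e p :=
        (app_eq_pullEval (P := descObj D i₁) (Q := descObj D i₂) (D.hom q f₁ f₂ h₁ h₂) X _).trans
          ((pullEval_hom D q f₁ f₂ h₁ h₂ X.hom ((X.hom ≫ f₁) ≫ i₁.obj.hom)
            (by rw [Category.assoc, h₁]) rfl rfl _).trans (descMap_gluedEval D _ _ _ _ _ p))
      refine hl.trans ?_
      refine ((gluedEval_ocast D i₂ (X.hom ≫ f₂) e.symm rfl p).symm.trans ?_)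
      exact (congrArg (gluedEval D i₂ (X.hom ≫ f₂) _ rfl) hr).symm)

/-- Torsors satisfy effective descent. -/
lemma isStack_torsc (A : Sheaf J GrpCat.{w}) : (torsc A).IsStack J :=
  { toIsPrestack := isPrestack_torsc A
    essSurj_of_sieve := fun _ hR =>
      ⟨fun D => ⟨(sieveTorsor D).glued hR, ⟨toDescentDataGluedIso D hR⟩⟩⟩ }

lemma isGerbe_torsc (A : Sheaf J GrpCat.{w}) : IsGerbe J (torsc A) where
  isStack := isStack_torsc A
  isGroupoid := isGroupoid_torsor A
  locally_nonempty S := ⟨⊤, J.top_mem S, fun T _ _ => ⟨Torsor.trivial A T⟩⟩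
  locally_isomorphic _ P Q := locallyIsomorphic_torsor A P Q

end Effective

end CrossedGerbes

theorem mainTheorem8 {C : Type u} [Category.{w} C] (J : GrothendieckTopology C)
    [HasSmallGenerators.{w} J] (Φ : CrossedGroupSheaf.{w} J) :
    IsGerbe J (torsc Φ.A) ∧
      (∃! 𝔰 : CrossedGerbeStr Φ (torsc Φ.A), 𝔰.IsCanonical) ∧
      (∃! c : H2 Φ, c.IsUnitClass) := by
  obtain ⟨𝔰, h𝔰, huniq⟩ := existsUnique_isCanonical Φ
  have hG := isGerbe_torsc Φ.A
  refine ⟨hG, ⟨𝔰, h𝔰, huniq⟩, H2.mk ⟨torsc Φ.A, hG, 𝔰⟩, ⟨hG, 𝔰, h𝔰, rfl⟩, ?_⟩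
  rintro _ ⟨_, 𝔰', h', rfl⟩
  rw [huniq 𝔰' h']
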